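/- **Problem and noise.** Consider $\min_{x\in\mathbb R^n} f(x)$ subject to $c(x)=0$, with $f:\mathbb R^n\to\mathbb R$, $c:\mathbb R^n\to\mathbb R^m$, $J=\nabla c^T$, $\|\cdot\|$ Euclidean (spectral for matrices), and noisy evaluations $\bar f,\bar g,\bar c,\bar J$ of $f,\nabla f,c,J$. There is an open convex set $\mathcal X$ that contains all $x_k$ and $x_k+\bar d_k$ and on which $f,c$ are differentiable, $f_{\inf}\le f\le f_{\sup}$, $\|\nabla f\|\le\kappa_g$, $\|c\|\le\kappa_c$, $\|J\|\le\kappa_J$, $\nabla f$ is $L$-Lipschitz, $J$ is $\Gamma$-Lipschitz, and $|\bar f-f|\le\epsilon_f$, $\|\bar g-\nabla f\|\le\epsilon_g$, $\|\bar c-c\|\le\epsilon_c$, $\|\bar J-J\|\le\epsilon_J$. A subscript $k$ means evaluation at $x_k$. Let $0\le\epsilon_o\le\epsilon_c$, $\phi(x,\tau)=\tau f(x)+\|c(x)\|$, $\bar\phi(x,\tau)=\tau\bar f(x)+\|\bar c(x)\|$, and $\Delta\bar l(x,\tau,d)=-\tau\bar g(x)^Td+\|\bar c(x)\|-\|\bar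 c(x)+\bar J(x)d\|$. **Algorithm.** Parameters: $\bar\tau_{-1},\sigma_{Jc},\kappa_{\rho r},\lambda_{uv},\lambda_v>0$, $\gamma_c\in(0,1]$, $\lambda_u\in(0,\zeta)$, $\lambda_{\rho r},\sigma_u,\sigma_c,\sigma_\tau,\eta\in(0,1)$, $\sigma_r\in(\sigma_c,1)$. A *normal step* for $(J,c)$ with fraction $\gamma$ is a vector $v\in\mathrm{Range}(J^T)$ with $\|v\|\le\sigma_{Jc}\|J^Tc\|$ and $\|c\|-\|c+Jv\|\ge\gamma\,(\|c\|-\|c-aJJ^Tc\|)$, $a=\min\{\sigma_{Jc},\|J^Tc\|^2/\|JJ^Tc\|^2\}$. In iteration $k=0,1,\dots$: * If $\|\bar c_k\|\le\epsilon_o$, set $\bar v_k=0$; otherwise $\bar v_k$ is a normal step for $(\bar J_k,\bar c_k)$ with fraction $\gamma_c$. * An iterative solver for $H_ku+\bar J_k^Ty=-(\bar g_k+H_k\bar v_k)$, $\bar J_ku=0$ gives $(\bar u_k,\bar y_k)$, one of its iterates, with residuals $\bar\rho_k=H_k\bar u_k+\bar J_k^T\bar y_k+\bar g_k+H_k\bar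 v_k$ and $\bar r_k=\bar J_k\bar u_k$; set $\bar d_k=\bar v_k+\bar u_k$ and $M_k=\max\{\bar u_k^TH_k\bar u_k,\lambda_u\|\bar u_k\|^2\}$. In both cases below, $\max\{\|\bar\rho_k\|,\|\bar r_k\|\}\le\lambda_{\rho r}\min\{\max\{\|\bar u_k\|,\|\bar J_k^T\bar c_k\|\},\kappa_{\rho r}\}$. * If $\|\bar c_k\|\le\epsilon_o$, then moreover $\bar u_k^TH_k\bar u_k\ge\lambda_u\|\bar u_k\|^2-\epsilon_o$, $\bar g_k^T\bar u_k+\frac12\bar u_k^TH_k\bar u_k\le\epsilon_o$, $\Delta\bar l(x_k,\bar\tau_{k-1},\bar u_k)\ge\bar\tau_{k-1}\sigma_uM_k-\epsilon_o$; and $\bar\tau_k=\bar\tau_{k-1}$. * If $\|\bar c_k\|>\epsilon_o$, then moreover (a) $\|\bar u_k\|\le\lambda_{uv}\|\bar v_k\|$, or both $\bar u_k^TH_k\bar u_k\ge\lambda_u\|\bar u_k\|^2$ and $(\bar g_k+H_k\bar v_k)^T\bar u_k+\max\{\frac12,1-\|\bar J_k^T\bar c_k\|\}\bar u_k^TH_k\bar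 u_k\le\lambda_v\|\bar v_k\|$; and (b) either $(\ast)$ $\Delta\bar l(x_k,\bar\tau_{k-1},\bar d_k)\ge\bar\tau_{k-1}\sigma_uM_k+\sigma_c(\|\bar c_k\|-\|\bar c_k+\bar J_k\bar v_k\|)$, or $\|\bar c_k\|-\|\bar c_k+\bar J_k\bar v_k+\bar r_k\|\ge\sigma_r(\|\bar c_k\|-\|\bar c_k+\bar J_k\bar v_k\|)>0$. If $(\ast)$ holds, $\bar\tau_k=\bar\tau_{k-1}$. Otherwise let $D_k=\bar g_k^T\bar d_k+M_k$ and $\tau^{\rm trial}_k=(1-\sigma_c/\sigma_r)(\|\bar c_k\|-\|\bar c_k+\bar J_k\bar v_k+\bar r_k\|)/D_k$ if $D_k>0$, $\tau_k^{\rm trial}=\infty$ if $D_k\le0$; then $\bar\tau_k=\bar\tau_{k-1}$ if $\bar\tau_{k-1}\le(1-\sigma_\tau)\tau_k^{\rm trial}$, and $\bar\tau_k=(1-\sigma_\tau)\tau^{\rm trial}_k$ otherwise. * $x_{k+1}=x_k+\bar\alpha_k\bar d_k$, with $\bar\alpha_k$ from one of two options. *Option A (adaptive)*, for $\Gamma>0$,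 with $\beta\in(0,1]$, $\theta,\bar\chi_{-1},\bar\zeta_{-1},\bar\xi_{-1},\sigma_\chi>0$, $\sigma_\zeta,\sigma_\xi\in(0,1)$ and $2(1-\eta)\beta\bar\xi_{-1}\max\{\bar\tau_{-1},1\}\le\bar\tau_{\min}L+\Gamma$, $\bar\tau_{\min}$ being the bound below. If $\|\bar u_k\|^2\ge\bar\chi_{k-1}\|\bar v_k\|^2$ and $\frac12\bar d_k^TH_k\bar d_k<\frac14\bar\zeta_{k-1}\|\bar u_k\|^2$, then $\bar\chi_k=(1+\sigma_\chi)\bar\chi_{k-1}$ and $\bar\zeta_k=(1-\sigma_\zeta)\bar\zeta_{k-1}$; otherwise both are kept. Put $t_k=\bar\tau_k$ if $\|\bar u_k\|^2\ge\bar\chi_k\|\bar v_k\|^2$, $t_k=1$ otherwise, and $\xi_k^{\rm trial}=\Delta\bar l(x_k,\bar\tau_k,\bar d_k)/(t_k\|\bar d_k\|^2)$; $\bar\xi_k=\bar\xi_{k-1}$ if $\bar\xi_{k-1}\le\xi^{\rm trial}_k$, and $\bar\xi_k=\min\{(1-\sigma_\xi)\bar\xi_{k-1},\xi_k^{\rm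 trial}\}$ otherwise. With $\alpha^{\rm suff}_k=\min\{\frac{2(1-\eta)\beta\Delta\bar l(x_k,\bar\tau_k,\bar d_k)}{(\bar\tau_kL+\Gamma)\|\bar d_k\|^2},1\}$ and $\alpha_k^{\min}=\frac{2(1-\eta)\beta\bar\xi_kt_k}{\bar\tau_kL+\Gamma}$, $\bar\alpha_k$ is the projection of $\alpha_k^{\rm suff}$ onto $[\alpha_k^{\min},\alpha_k^{\min}+\theta\beta]$. *Option L (line search)*, with $\alpha_u\in(0,1]$, $\nu\in(0,1)$: $\bar\alpha_k=\nu^j\alpha_u$ with the least $j\ge0$ such that $\alpha=\nu^j\alpha_u$ satisfies $\bar\phi(x_k+\alpha\bar d_k,\bar\tau_k)\le\bar\phi(x_k,\bar\tau_k)-\eta\alpha\Delta\bar l(x_k,\bar\tau_k,\bar d_k)+\epsilon_{A_k}$, where $\epsilon_{A_k}=2\bar\tau_k\epsilon_f+4\epsilon_c+\bar\tau_k\alpha_u\epsilon_g\|\bar d_k\|+\alpha_u\epsilon_J\|\bar d_k\|$. **Assumptions on the run.** For all $k$: $\|H_k\|\le\kappa_H$ and $u^TH_ku\ge\zeta\|u\|^2$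 for $u\in\mathrm{Null}(J_k)\cup\mathrm{Null}(\bar J_k)$; the solver's $u$-iterates converge to the exact tangential step and its residuals to $0$; $\bar J_k^T\bar c_k\ne0$ or $\bar g_k\notin\mathrm{Range}(\bar J_k^T)$; *no early termination*: $\Delta\bar l(x_k,\bar\tau_k,\bar d_k)>\epsilon_o$ if $\|\bar c_k\|\le\epsilon_o$, and $\bar J_k^T\bar c_k\ne0$ otherwise; $J_k$ and $\bar J_k$ have nontrivial null spaces; and $\bar\tau_k\ge\bar\tau_{\min}>0$. **Notation.** Let $f_{\inf}$ enter through $\phi_{\min}=\min\{0,\bar\tau_{-1}f_{\inf}\}$ and $\Phi=\bar\tau_{-1}|f_{\inf}|+\phi(x_0,\bar\tau_0)-\phi_{\min}$. For constants $\sigma_v,\kappa_{\bar d},\kappa_{\bar y^*},\kappa_{y^*},\xi_{\min},\kappa_\Delta>0$ put $$\alpha_l^A=\frac{2(1-\eta)\beta\xi_{\min}\min\{\bar\tau_{\min},1\}}{\bar\tau_{\min}L+\Gamma},\qquad \alpha_l^L=\min\Big\{\alpha_u,\frac{\nu(1-\eta)\kappa_\Delta}{\bar\tau_{-1}L+\Gamma}\Big\},\qquad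 \alpha_u^A=\Big(\frac{2(1-\eta)\bar\xi_{-1}\max\{\bar\tau_{-1},1\}}{\Gamma}+\theta\Big)\beta,\qquad \alpha_u^L=\alpha_u,$$ $$\mathcal E^A=\alpha_u^A\bar\tau_{-1}\kappa_{\bar d}\epsilon_g+2\epsilon_c+\alpha_u^A\kappa_{\bar d}\epsilon_J,\qquad \mathcal E^L=4\bar\tau_{-1}\epsilon_f+\bar\tau_{-1}\alpha_u\kappa_{\bar d}\epsilon_g+6\epsilon_c+\alpha_u\kappa_{\bar d}\epsilon_J,$$ $$\mathcal E_{Jc^2}=\max\big\{((\kappa_J+\epsilon_J)\epsilon_c+\kappa_c\epsilon_J)((\kappa_J+\epsilon_J)(\kappa_c+\epsilon_c)+\kappa_J\kappa_c),\ \kappa_J^2\epsilon_c^2\big\},$$ $$\kappa_1=4\lambda_{\rho r}^2(\zeta^{-1}+(\kappa_J+\epsilon_J)\kappa_\sigma^{-2})^2,\quad \kappa_2=24\zeta^{-2}\kappa_H^2\sigma_{Jc}^2,\quad S^i=\frac{4+2\kappa_1}{\bar\tau_{\min}\sigma_u\lambda_u\eta\alpha_l^i}+\frac{(\kappa_1+2\kappa_2)(\kappa_c+\epsilon_c)}{\sigma_c\sigma_v\eta\alpha_l^i}.$$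 **Theorem.** Let $i\in\{A,L\}$, and fix the parameters of the algorithm and of option $i$, $L,\Gamma,\kappa_g,\kappa_c,\kappa_J,\kappa_H,\zeta$, $\bar\tau_{\min}$, $\kappa_\sigma>0$ and a cap $\epsilon_{\max}>0$. There are constants $\sigma_v,\kappa_{\bar d},\kappa_{\bar y^*},\kappa_{y^*},\xi_{\min},\kappa_\Delta,C>0$, depending on these data only, such that the following holds for all $n,m$, all problems, noise levels $\epsilon_f,\epsilon_g,\epsilon_c,\epsilon_J\le\epsilon_{\max}$ and runs as above. For all $k$: $\sigma_v\|\bar J_k^T\bar c_k\|^2\le\|\bar c_k\|(\|\bar c_k\|-\|\bar c_k+\bar J_k\bar v_k\|)$ whenever $\|\bar c_k\|>\epsilon_o$; $\|\bar d_k\|\le\kappa_{\bar d}$; $\bar\xi_k\ge\xi_{\min}$ (option A); $\Delta\bar l(x_k,\bar\tau_k,\bar d_k)\ge\kappa_\Delta\|\bar d_k\|^2$; $\bar\alpha_k\ge\alpha_l^i$. Moreover, for all $k$: 1. $$\frac1{k+1}\sum_{j=0}^k\|J_j^Tc_j\|^2\le\frac{\Phi(\kappa_c+\epsilon_c)}{(k+1)\sigma_c\sigma_v\eta\alpha_l^i}+\frac{\kappa_c+\epsilon_c}{\sigma_c\sigma_v\eta\alpha_l^i}\mathcal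 E^i+\mathcal E_{Jc^2}.$$ 2. If all nonzero singular values of all $J_j$ and $\bar J_j$ are at least $\kappa_\sigma$, then for all normal steps $v_j$ for $(J_j,c_j)$ with a fraction $\gamma\in(0,1]$, the systems $H_ju+\bar J_j^Ty=-(\bar g_j+H_j\bar v_j)$, $\bar J_ju=0$ and $H_ju+J_j^Ty=-(\nabla f(x_j)+H_jv_j)$, $J_ju=0$ have solutions with $\|y\|\le\kappa_{\bar y^*}$ and $\|y\|\le\kappa_{y^*}$, respectively, and, for all matrices $Z_j$ whose columns are an orthonormal basis of $\mathrm{Null}(J_j)$, $$\frac1{k+1}\sum_{j=0}^k\frac{\|Z_j^T(\nabla f(x_j)+H_jv_j)\|^2}{\kappa_H^2}\le S^i\,\frac{\Phi}{k+1}+S^i\,\mathcal E^i+2\kappa_2\mathcal E_{Jc^2}+\kappa_1(\kappa_J+\epsilon_J)^2\epsilon_c^2+12\zeta^{-2}(\epsilon_g^2+\kappa_{\bar y^*}^2\epsilon_J^2+\kappa_{y^*}^2\epsilon_J^2).$$ 3. If all $\min\{m,n\}$ singular values of each $J_j$ are at least $\kappa_\sigma$, then $$\frac1{k+1}\sum_{j=0}^k\|c_j\|^2\le\frac{\Phi(\kappa_c+\epsilon_c)}{(k+1)\sigma_c\sigma_v\eta\alpha_l^i\kappa_\sigma^2}+\frac{\kappa_c+\epsilon_c}{\sigma_c\sigma_v\eta\alpha_l^i\kappa_\sigma^2}\mathcal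 E^i+\frac1{\kappa_\sigma^2}\mathcal E_{Jc^2}.$$ 4. If all $\min\{m,n\}$ singular values of each $\bar J_j$ are at least $\kappa_\sigma$, then $$\frac1{k+1}\sum_{j=0}^k\|c_j\|\le\frac{\Phi}{(k+1)\kappa_\sigma^2\sigma_c\sigma_v\eta\alpha_l^i}+\frac{1}{\kappa_\sigma^2\sigma_c\sigma_v\eta\alpha_l^i}\mathcal E^i+2\epsilon_c.$$ In each case the right-hand side is at most $C\big(\frac{\Phi}{k+1}+\epsilon_f+\epsilon_g+\epsilon_c+\epsilon_J\big)$. -/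

import Mathlib

open scoped InnerProduct Topology

noncomputable section

namespace NoisySQP

/-- `ℝⁿ` with the Euclidean norm. -/
abbrev Vec (n : ℕ) := EuclideanSpace ℝ (Fin n)

/-! ### Problem data, noise levels, bounds -/

/-- `min f(x)` subject to `c(x) = 0` on `ℝⁿ` with `m` constraints, with the noisy evaluations
of `f`, `∇f`, `c` and of the constraint Jacobian that the algorithm has access to. -/
structure Problem (n m : ℕ) where
  f : Vec n → ℝ
  c : Vec n → Vec m
  fbar : Vec n → ℝ
  gbar : Vec n → Vec n
  cbar : Vec n → Vec m
  Jbar : Vec n → Vec n →L[ℝ] Vec m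

/-- The true gradient of the objective. -/
def Problem.g {n m : ℕ} (P : Problem n m) (x : Vec n) : Vec n := gradient P.f x

/-- The true constraint Jacobian. Its transpose is the adjoint `(P.J x)†`. -/
def Problem.J {n m : ℕ} (P : Problem n m) (x : Vec n) : Vec n →L[ℝ] Vec m := fderiv ℝ P.c x

/-- Noise levels of `f`, `∇f`, `c`, `J`, and the optimistic feasibility parameter `o`. -/
structure Noise where
  f : ℝ
  g : ℝ
  c : ℝ
  J : ℝ
  o : ℝ

structure Noise.Admissible (ε : Noise) : Prop where
  f_nonneg : 0 ≤ ε.f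
  g_nonneg : 0 ≤ ε.g
  c_nonneg : 0 ≤ ε.c
  J_nonneg : 0 ≤ ε.J
  o_nonneg : 0 ≤ ε.o
  o_le_c : ε.o ≤ ε.c

/-- All noise levels are at most `M`. -/
def Noise.LE (ε : Noise) (M : ℝ) : Prop := ε.f ≤ M ∧ ε.g ≤ M ∧ ε.c ≤ M ∧ ε.J ≤ M

def Noise.total (ε : Noise) : ℝ := ε.f + ε.g + ε.c + ε.J

/-- Lipschitz constants `L` of `∇f` and `Γ` of the Jacobian, bounds on `∇f`, `c`, the Jacobian and
`H`, and the curvature constant `ζ` of `H`. -/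
structure Bounds where
  L : ℝ
  Γ : ℝ
  κg : ℝ
  κc : ℝ
  κJ : ℝ
  κH : ℝ
  ζ : ℝ

structure Bounds.Admissible (B : Bounds) : Prop where
  L_pos : 0 < B.L
  Γ_nonneg : 0 ≤ B.Γ
  κg_pos : 0 < B.κg
  κc_pos : 0 < B.κc
  κJ_pos : 0 < B.κJ
  κH_pos : 0 < B.κH
  ζ_pos : 0 < B.ζ

/-- Smoothness and boundedness of the problem on the open convex set `X`. Continuity of `∇f` and of
the Jacobian on `X` is part of their Lipschitz continuity. -/
structure Problem.SmoothOn {n m : ℕ} (P : Problem n m) (X : Set (Vec n)) (B : Bounds)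
    (finf fsup : ℝ) : Prop where
  isOpen : IsOpen X
  convex : Convex ℝ X
  f_diff : DifferentiableOn ℝ P.f X
  c_diff : DifferentiableOn ℝ P.c X
  f_lower : ∀ x ∈ X, finf ≤ P.f x
  f_upper : ∀ x ∈ X, P.f x ≤ fsup
  g_bound : ∀ x ∈ X, ‖P.g x‖ ≤ B.κg
  c_bound : ∀ x ∈ X, ‖P.c x‖ ≤ B.κc
  J_bound : ∀ x ∈ X, ‖P.J x‖ ≤ B.κJ
  g_lipschitz : ∀ x ∈ X, ∀ x' ∈ X, ‖P.g x - P.g x'‖ ≤ B.L * ‖x - x'‖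
  J_lipschitz : ∀ x ∈ X, ∀ x' ∈ X, ‖P.J x - P.J x'‖ ≤ B.Γ * ‖x - x'‖

/-- The noisy evaluations are within the noise levels on `X`. -/
structure Problem.NoiseOn {n m : ℕ} (P : Problem n m) (X : Set (Vec n)) (ε : Noise) : Prop where
  f_noise : ∀ x ∈ X, |P.fbar x - P.f x| ≤ ε.f
  g_noise : ∀ x ∈ X, ‖P.gbar x - P.g x‖ ≤ ε.g
  c_noise : ∀ x ∈ X, ‖P.cbar x - P.c x‖ ≤ ε.c
  J_noise : ∀ x ∈ X, ‖P.Jbar x - P.J x‖ ≤ ε.J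

/-! ### Parameters of the algorithm -/

/-- Parameters common to both step size options; `τ₀` is the initial merit parameter (index `-1`)
and `γc` is the Cauchy decrease fraction of the noisy normal step. -/
structure Params where
  τ₀ : ℝ
  σJc : ℝ
  γc : ℝ
  lamρr : ℝ
  κρr : ℝ
  lamuv : ℝ
  lamu : ℝ
  lamv : ℝ
  σu : ℝ
  σc : ℝ
  σr : ℝ
  στ : ℝ
  η : ℝ

structure Params.Admissible (p : Params) (B : Bounds) : Prop where
  τ₀_pos : 0 < p.τ₀
  σJc_pos : 0 < p.σJc
  γc_mem : p.γc ∈ Set.Ioc (0 : ℝ) 1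
  lamρr_mem : p.lamρr ∈ Set.Ioo (0 : ℝ) 1
  κρr_pos : 0 < p.κρr
  lamuv_pos : 0 < p.lamuv
  lamu_mem : p.lamu ∈ Set.Ioo 0 B.ζ
  lamv_pos : 0 < p.lamv
  σu_mem : p.σu ∈ Set.Ioo (0 : ℝ) 1
  σc_mem : p.σc ∈ Set.Ioo (0 : ℝ) 1
  σr_mem : p.σr ∈ Set.Ioo p.σc 1
  στ_mem : p.στ ∈ Set.Ioo (0 : ℝ) 1
  η_mem : p.η ∈ Set.Ioo (0 : ℝ) 1

/-- Parameters of the adaptive step size; `χ₀, ζ₀, ξ₀` are the initial values (index `-1`). -/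
structure AdaptiveParams where
  β : ℝ
  θ : ℝ
  χ₀ : ℝ
  ζ₀ : ℝ
  ξ₀ : ℝ
  σχ : ℝ
  σζ : ℝ
  σξ : ℝ

/-- Parameters of the backtracking line search: initial step size and reduction factor. -/
structure LineSearchParams where
  αu : ℝ
  ν : ℝ

/-- The two step size options. -/
inductive StepRule where
  | adaptive (a : AdaptiveParams)
  | lineSearch (l : LineSearchParams)

/-- Admissible parameters of the step size rule, for merit parameters in `[τmin, τ₀]`. The bound on
`β` keeps the lower safeguard of the adaptive step size at most `1`; it holds in particular when
`2 (1 - η) β ξ₀ max {τ₀, 1} ≤ Γ`. -/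
def StepRule.Admissible (B : Bounds) (p : Params) (τmin : ℝ) : StepRule → Prop
  | .adaptive a =>
      0 < B.Γ ∧ a.β ∈ Set.Ioc (0 : ℝ) 1 ∧ 0 < a.θ ∧ 0 < a.χ₀ ∧ 0 < a.ζ₀ ∧ 0 < a.ξ₀ ∧ 0 < a.σχ ∧
        a.σζ ∈ Set.Ioo (0 : ℝ) 1 ∧ a.σξ ∈ Set.Ioo (0 : ℝ) 1 ∧
        2 * (1 - p.η) * a.β * a.ξ₀ * max p.τ₀ 1 / (τmin * B.L + B.Γ) ≤ 1
  | .lineSearch l => l.αu ∈ Set.Ioc (0 : ℝ) 1 ∧ l.ν ∈ Set.Ioo (0 : ℝ) 1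

/-! ### Ingredients of one iteration -/

/-- `prev a s k` is `s (k - 1)`, with the value `a` at index `-1`. -/
def prev (a : ℝ) (s : ℕ → ℝ) : ℕ → ℝ
  | 0 => a
  | k + 1 => s k

/-- `v` is an inexact solution of `min ½‖c + J v‖²` over `v ∈ Range Jᵀ`, `‖v‖ ≤ σ ‖Jᵀ c‖`, with the
Cauchy decrease condition with fraction `γ`. -/
def IsNormalStep {n m : ℕ} (σ γ : ℝ) (J : Vec n →L[ℝ] Vec m) (c : Vec m) (v : Vec n) : Prop :=
  v ∈ Set.range (J†) ∧ ‖v‖ ≤ σ * ‖(J†) c‖ ∧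
    γ * (‖c‖ - ‖c + min σ (‖(J†) c‖ ^ 2 / ‖J ((J†) c)‖ ^ 2) • J (-((J†) c))‖) ≤ ‖c‖ - ‖c + J v‖

/-- `(u, y)` is an exact solution of the linear system of the tangential subproblem. -/
def IsKKT {n m : ℕ} (H : Vec n →L[ℝ] Vec n) (J : Vec n →L[ℝ] Vec m) (g v u : Vec n) (y : Vec m) :
    Prop :=
  H u + (J†) y = -(g + H v) ∧ J u = 0

namespace Problem

variable {n m : ℕ} (P : Problem n m)

/-- The true merit function. -/
def phi (x : Vec n) (τ : ℝ) : ℝ := τ * P.f x + ‖P.c x‖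

/-- The noisy merit function. -/
def phibar (x : Vec n) (τ : ℝ) : ℝ := τ * P.fbar x + ‖P.cbar x‖

/-- The reduction in the model of the noisy merit function. -/
def deltal (x : Vec n) (τ : ℝ) (d : Vec n) : ℝ :=
  -τ * inner ℝ (P.gbar x) d + ‖P.cbar x‖ - ‖P.cbar x + P.Jbar x d‖

end Problem

/-- The sequences generated by the algorithm. `v`, `u`, `y` are the normal components, tangential
components and multiplier estimates; `su k`, `sy k` is the sequence of inexact solutions which the
iterative solver generates at iteration `k`; `χ`, `ζ`, `ξ` are used by the adaptive step size
only. -/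
structure Run (n m : ℕ) where
  x : ℕ → Vec n
  H : ℕ → Vec n →L[ℝ] Vec n
  v : ℕ → Vec n
  u : ℕ → Vec n
  y : ℕ → Vec m
  su : ℕ → ℕ → Vec n
  sy : ℕ → ℕ → Vec m
  τ : ℕ → ℝ
  α : ℕ → ℝ
  χ : ℕ → ℝ
  ζ : ℕ → ℝ
  ξ : ℕ → ℝ

namespace Run

variable {n m : ℕ} (R : Run n m) (P : Problem n m)

/-- The search direction. -/
def d (k : ℕ) : Vec n := R.v k + R.u k

/-- The noisy gradient, constraint value and Jacobian, and the vector `J̄ᵀ c̄`, at iterate `k`. -/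
def gb (k : ℕ) : Vec n := P.gbar (R.x k)
def cb (k : ℕ) : Vec m := P.cbar (R.x k)
def Jb (k : ℕ) : Vec n →L[ℝ] Vec m := P.Jbar (R.x k)
def Jcb (k : ℕ) : Vec n := ((R.Jb P k)†) (R.cb P k)

/-- The true Jacobian and the vector `Jᵀ c` at iterate `k`. -/
def J (k : ℕ) : Vec n →L[ℝ] Vec m := P.J (R.x k)
def Jc (k : ℕ) : Vec n := ((R.J P k)†) (P.c (R.x k))

/-- First block of the residual of the tangential system at iteration `k`, at `(u, y)`. The second
block is `J̄ u`. -/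
def resρ (k : ℕ) (u : Vec n) (y : Vec m) : Vec n :=
  R.H k u + ((R.Jb P k)†) y + (R.gb P k + R.H k (R.v k))

/-- The curvature `uᵀ H u`. -/
def uHu (k : ℕ) : ℝ := inner ℝ (R.u k) (R.H k (R.u k))

/-- `max {uᵀ H u, λ_u ‖u‖²}`. -/
def curv (p : Params) (k : ℕ) : ℝ := max (R.uHu k) (p.lamu * ‖R.u k‖ ^ 2)

/-- The model reduction at iteration `k` with merit parameter `τ`. -/
def dl (k : ℕ) (τ : ℝ) : ℝ := P.deltal (R.x k) τ (R.d k)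

/-- Linearized noisy constraint reductions obtained with `v` and with `v + u`; here
`c̄ + J̄ v + r̄ = c̄ + J̄ v + J̄ u`. -/
def redv (k : ℕ) : ℝ := ‖R.cb P k‖ - ‖R.cb P k + R.Jb P k (R.v k)‖
def redr (k : ℕ) : ℝ := ‖R.cb P k‖ - ‖R.cb P k + R.Jb P k (R.v k) + R.Jb P k (R.u k)‖

/-- The residual condition that is common to both termination tests. -/
def ResidualTest (p : Params) (k : ℕ) : Prop :=
  max ‖R.resρ P k (R.u k) (R.y k)‖ ‖R.Jb P k (R.u k)‖ ≤
    p.lamρr * min (max ‖R.u k‖ ‖R.Jcb P k‖) p.κρr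

/-- Termination test 1, with previous merit parameter `τp`. -/
def Test1 (p : Params) (ε : Noise) (k : ℕ) (τp : ℝ) : Prop :=
  R.ResidualTest P p k ∧
  p.lamu * ‖R.u k‖ ^ 2 - ε.o ≤ R.uHu k ∧
  inner ℝ (R.gb P k) (R.u k) + 1 / 2 * R.uHu k ≤ ε.o ∧
  τp * p.σu * R.curv p k - ε.o ≤ P.deltal (R.x k) τp (R.u k)

/-- The model reduction condition of termination test 2. -/
def ModelReduction (p : Params) (k : ℕ) (τp : ℝ) : Prop :=
  τp * p.σu * R.curv p k + p.σc * R.redv P k ≤ R.dl P k τp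

/-- Termination test 2, with previous merit parameter `τp`. -/
def Test2 (p : Params) (k : ℕ) (τp : ℝ) : Prop :=
  R.ResidualTest P p k ∧
  (‖R.u k‖ ≤ p.lamuv * ‖R.v k‖ ∨
    (p.lamu * ‖R.u k‖ ^ 2 ≤ R.uHu k ∧
      inner ℝ (R.gb P k + R.H k (R.v k)) (R.u k) + max (1 / 2) (1 - ‖R.Jcb P k‖) * R.uHu k ≤
        p.lamv * ‖R.v k‖)) ∧
  (R.ModelReduction P p k τp ∨
    (p.σr * R.redv P k ≤ R.redr P k ∧ 0 < p.σr * R.redv P k))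

/-- The denominator `ḡᵀ d̄ + max {ūᵀ H ū, λ_u ‖ū‖²}` of the trial merit parameter. -/
def trialDen (p : Params) (k : ℕ) : ℝ := inner ℝ (R.gb P k) (R.d k) + R.curv p k

/-- The trial merit parameter, where it is finite, i.e. where `0 < trialDen`. -/
def τtrial (p : Params) (k : ℕ) : ℝ := (1 - p.σc / p.σr) * R.redr P k / R.trialDen P p k

/-- The merit parameter update from `τp`; the trial value is `∞` when `trialDen ≤ 0`. -/
def τupdate (p : Params) (k : ℕ) (τp : ℝ) : ℝ :=
  if R.trialDen P p k ≤ 0 ∨ τp ≤ (1 - p.στ) * R.τtrial P p k then τp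
  else (1 - p.στ) * R.τtrial P p k

/-- Computation of the normal and tangential components and of the merit parameter at
iteration `k`. -/
def Direction (p : Params) (ε : Noise) (k : ℕ) : Prop :=
  (‖R.cb P k‖ ≤ ε.o →
    R.v k = 0 ∧ R.τ k = prev p.τ₀ R.τ k ∧ R.Test1 P p ε k (prev p.τ₀ R.τ k)) ∧
  (ε.o < ‖R.cb P k‖ →
    IsNormalStep p.σJc p.γc (R.Jb P k) (R.cb P k) (R.v k) ∧
    R.Test2 P p k (prev p.τ₀ R.τ k) ∧
    (R.ModelReduction P p k (prev p.τ₀ R.τ k) → R.τ k = prev p.τ₀ R.τ k) ∧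
    (¬ R.ModelReduction P p k (prev p.τ₀ R.τ k) →
      R.τ k = R.τupdate P p k (prev p.τ₀ R.τ k)))

/-! The adaptive step size -/

/-- The condition that triggers an update of `χ` and `ζ`. -/
def DominateCond (a : AdaptiveParams) (k : ℕ) : Prop :=
  prev a.χ₀ R.χ k * ‖R.v k‖ ^ 2 ≤ ‖R.u k‖ ^ 2 ∧
    1 / 2 * inner ℝ (R.d k) (R.H k (R.d k)) < 1 / 4 * prev a.ζ₀ R.ζ k * ‖R.u k‖ ^ 2

/-- The step is tangentially dominated: `‖u‖² ≥ χ ‖v‖²`. -/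
def TangDominated (k : ℕ) : Prop := R.χ k * ‖R.v k‖ ^ 2 ≤ ‖R.u k‖ ^ 2

open Classical in
def ξtrial (k : ℕ) : ℝ :=
  if R.TangDominated k then R.dl P k (R.τ k) / (R.τ k * ‖R.d k‖ ^ 2)
  else R.dl P k (R.τ k) / ‖R.d k‖ ^ 2

def αsuff (B : Bounds) (p : Params) (a : AdaptiveParams) (k : ℕ) : ℝ :=
  min (2 * (1 - p.η) * a.β * R.dl P k (R.τ k) / ((R.τ k * B.L + B.Γ) * ‖R.d k‖ ^ 2)) 1

open Classical in
def αmin (B : Bounds) (p : Params) (a : AdaptiveParams) (k : ℕ) : ℝ :=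
  if R.TangDominated k then 2 * (1 - p.η) * a.β * R.ξ k * R.τ k / (R.τ k * B.L + B.Γ)
  else 2 * (1 - p.η) * a.β * R.ξ k / (R.τ k * B.L + B.Γ)

def αmax (B : Bounds) (p : Params) (a : AdaptiveParams) (k : ℕ) : ℝ :=
  R.αmin B p a k + a.θ * a.β

/-- The adaptive step size at iteration `k`: updates of `χ`, `ζ`, `ξ`, and projection of `αsuff`
onto `[αmin, αmax]`. -/
def AdaptiveStep (B : Bounds) (p : Params) (a : AdaptiveParams) (k : ℕ) : Prop :=
  (R.DominateCond a k →
    R.χ k = (1 + a.σχ) * prev a.χ₀ R.χ k ∧ R.ζ k = (1 - a.σζ) * prev a.ζ₀ R.ζ k) ∧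
  (¬ R.DominateCond a k → R.χ k = prev a.χ₀ R.χ k ∧ R.ζ k = prev a.ζ₀ R.ζ k) ∧
  (prev a.ξ₀ R.ξ k ≤ R.ξtrial P k → R.ξ k = prev a.ξ₀ R.ξ k) ∧
  (R.ξtrial P k < prev a.ξ₀ R.ξ k →
    R.ξ k = min ((1 - a.σξ) * prev a.ξ₀ R.ξ k) (R.ξtrial P k)) ∧
  R.α k = max (R.αmin B p a k) (min (R.αsuff P B p a k) (R.αmax B p a k))

/-! The line search -/

/-- The relaxation parameter of the line search. -/
def εA (ε : Noise) (l : LineSearchParams) (k : ℕ) : ℝ :=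
  2 * R.τ k * ε.f + 4 * ε.c + R.τ k * l.αu * ε.g * ‖R.d k‖ + l.αu * ε.J * ‖R.d k‖

/-- The relaxed Armijo condition for the step size `α`. -/
def Armijo (p : Params) (ε : Noise) (l : LineSearchParams) (k : ℕ) (α : ℝ) : Prop :=
  P.phibar (R.x k + α • R.d k) (R.τ k) ≤
    P.phibar (R.x k) (R.τ k) - p.η * α * R.dl P k (R.τ k) + R.εA ε l k

/-- Backtracking from `αu` with factor `ν`: the first step size that satisfies the relaxed Armijo
condition is taken. -/
def LineSearchStep (p : Params) (ε : Noise) (l : LineSearchParams) (k : ℕ) : Prop :=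
  ∃ j : ℕ, R.α k = l.ν ^ j * l.αu ∧ R.Armijo P p ε l k (l.ν ^ j * l.αu) ∧
    ∀ i < j, ¬ R.Armijo P p ε l k (l.ν ^ i * l.αu)

/-- The step size selection at iteration `k`. -/
def StepSize (B : Bounds) (p : Params) (ε : Noise) (k : ℕ) : StepRule → Prop
  | .adaptive a => R.AdaptiveStep P B p a k
  | .lineSearch l => R.LineSearchStep P p ε l k

/-! The algorithm and the assumptions on its runs -/

/-- The sequences in `R` are generated by the algorithm (with all iterations performed). -/
structure IsRun (B : Bounds) (p : Params) (rule : StepRule) (ε : Noise) : Prop where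
  direction : ∀ k, R.Direction P p ε k
  stepSize : ∀ k, R.StepSize P B p ε k rule
  update : ∀ k, R.x (k + 1) = R.x k + R.α k • R.d k

/-- The algorithm does not terminate, neither at an approximate first-order stationary point nor at
an approximate infeasible stationary point. -/
def NoEarlyTermination (ε : Noise) : Prop :=
  ∀ k, (‖R.cb P k‖ ≤ ε.o → ¬ R.dl P k (R.τ k) ≤ ε.o) ∧ (ε.o < ‖R.cb P k‖ → ‖R.Jcb P k‖ ≠ 0)

/-- The iterates and the full-step trial points stay in `X`. -/
def StaysIn (X : Set (Vec n)) : Prop := ∀ k, R.x k ∈ X ∧ R.x k + R.d k ∈ X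

/-- `H` is bounded, and uniformly positive definite on the null spaces of both the true and the
noisy Jacobian. -/
structure HessianBounds (B : Bounds) : Prop where
  bound : ∀ k, ‖R.H k‖ ≤ B.κH
  curvature : ∀ k u, R.J P k u = 0 ∨ R.Jb P k u = 0 → B.ζ * ‖u‖ ^ 2 ≤ inner ℝ u (R.H k u)

/-- The solver sequence converges in `u` to the exact tangential step and in the residuals to zero,
and the accepted inexact solution is one of its members. -/
def SolverAccuracy : Prop :=
  ∀ k, (∃ us ys, IsKKT (R.H k) (R.Jb P k) (R.gb P k) (R.v k) us ys ∧
      Filter.Tendsto (R.su k) Filter.atTop (𝓝 us)) ∧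
    Filter.Tendsto (fun t => R.resρ P k (R.su k t) (R.sy k t)) Filter.atTop (𝓝 0) ∧
    Filter.Tendsto (fun t => R.Jb P k (R.su k t)) Filter.atTop (𝓝 0) ∧
    ∃ t, R.u k = R.su k t ∧ R.y k = R.sy k t

/-- `J̄ᵀ c̄ ≠ 0` or `ḡ` is not in the range of `J̄ᵀ`, at every iterate. -/
def Nondegenerate : Prop :=
  ∀ k, R.Jcb P k ≠ 0 ∨ R.gb P k ∉ Set.range ((R.Jb P k)†)

/-- The null spaces of the true and of the noisy Jacobians are nontrivial. -/
def NontrivialNull : Prop :=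
  ∀ k, (∃ u, u ≠ 0 ∧ R.J P k u = 0) ∧ ∃ u, u ≠ 0 ∧ R.Jb P k u = 0

/-- `v` is a sequence of normal steps of the true problem, with Cauchy decrease fraction `γ`. -/
def TrueNormalSteps (p : Params) (γ : ℝ) (v : ℕ → Vec n) : Prop :=
  ∀ k, IsNormalStep p.σJc γ (R.J P k) (P.c (R.x k)) (v k)

/-- The standing assumptions on problem, noise and run. -/
structure Standing (X : Set (Vec n)) (B : Bounds) (p : Params) (rule : StepRule) (ε : Noise)
    (finf fsup : ℝ) : Prop where
  smooth : P.SmoothOn X B finf fsup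
  noise : P.NoiseOn X ε
  run : R.IsRun P B p rule ε
  staysIn : R.StaysIn X
  hessian : R.HessianBounds P B
  solver : R.SolverAccuracy P
  nondegenerate : R.Nondegenerate P
  noTermination : R.NoEarlyTermination P ε
  nontrivialNull : R.NontrivialNull P

end Run

/-- All `min(m, n)` singular values of the `m × n` matrix `J` are at least `κ`. -/
def SVBoundedBelow {n m : ℕ} (J : Vec n →L[ℝ] Vec m) (κ : ℝ) : Prop :=
  ∀ i < min m n, κ ≤ J.toLinearMap.singularValues i

/-- All nonzero singular values of `J` are at least `κ`. -/
def NonzeroSVBoundedBelow {n m : ℕ} (J : Vec n →L[ℝ] Vec m) (κ : ℝ) : Prop :=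
  ∀ i, J.toLinearMap.singularValues i ≠ 0 → κ ≤ J.toLinearMap.singularValues i

/-! ### The constants and the bounds -/

/-- Constants whose existence the analysis provides: `σv` for the decrease of the normal steps,
`κd` bounding the search directions, `κyb` and `κy` bounding multipliers of the noisy and the true
tangential systems, `ξmin` bounding the sequence `ξ` from below, and `κΔ` for the model
reduction. -/
structure Consts where
  σv : ℝ
  κd : ℝ
  κyb : ℝ
  κy : ℝ
  ξmin : ℝ
  κΔ : ℝ

def Consts.Pos (K : Consts) : Prop :=
  0 < K.σv ∧ 0 < K.κd ∧ 0 < K.κyb ∧ 0 < K.κy ∧ 0 < K.ξmin ∧ 0 < K.κΔ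

/-- What the constants `σv, κd, ξmin, κΔ` and the step size bound `αl` stand for along a run. -/
structure Consts.ValidFor {n m : ℕ} (K : Consts) (αl : ℝ) (P : Problem n m) (R : Run n m)
    (rule : StepRule) (ε : Noise) : Prop where
  decrease : ∀ k, ε.o < ‖R.cb P k‖ → K.σv * ‖R.Jcb P k‖ ^ 2 ≤ ‖R.cb P k‖ * R.redv P k
  direction : ∀ k, ‖R.d k‖ ≤ K.κd
  ξ_lower : ∀ a, rule = .adaptive a → ∀ k, K.ξmin ≤ R.ξ k
  model : ∀ k, K.κΔ * ‖R.d k‖ ^ 2 ≤ R.dl P k (R.τ k)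
  step : ∀ k, αl ≤ R.α k

/-- What the constants `κyb` and `κy` stand for: there are multipliers of the noisy and of the true
tangential systems (the latter with normal steps `v`) with these bounds. -/
def Consts.MultipliersFor {n m : ℕ} (K : Consts) (P : Problem n m) (R : Run n m) (v : ℕ → Vec n) :
    Prop :=
  ∀ k, (∃ us ys, IsKKT (R.H k) (R.Jb P k) (R.gb P k) (R.v k) us ys ∧ ‖ys‖ ≤ K.κyb) ∧
    ∃ us ys, IsKKT (R.H k) (R.J P k) (P.g (R.x k)) (v k) us ys ∧ ‖ys‖ ≤ K.κy

/-- The lower bound on the step sizes for merit parameters that are at least `τmin`. -/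
def alphaLow (B : Bounds) (p : Params) (τmin : ℝ) (K : Consts) : StepRule → ℝ
  | .adaptive a => 2 * (1 - p.η) * a.β * K.ξmin * min τmin 1 / (τmin * B.L + B.Γ)
  | .lineSearch l => min l.αu (l.ν * (1 - p.η) * K.κΔ / (p.τ₀ * B.L + B.Γ))

/-- The upper bound on the step sizes. -/
def alphaUp (B : Bounds) (p : Params) : StepRule → ℝ
  | .adaptive a => (2 * (1 - p.η) * a.ξ₀ * max p.τ₀ 1 / B.Γ + a.θ) * a.β
  | .lineSearch l => l.αu

/-- The error term of the merit function decrease. -/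
def meritError (B : Bounds) (p : Params) (ε : Noise) (K : Consts) (rule : StepRule) : ℝ :=
  match rule with
  | .adaptive _ =>
      alphaUp B p rule * p.τ₀ * K.κd * ε.g + 2 * ε.c + alphaUp B p rule * K.κd * ε.J
  | .lineSearch _ =>
      4 * p.τ₀ * ε.f + p.τ₀ * alphaUp B p rule * K.κd * ε.g + 6 * ε.c +
        alphaUp B p rule * K.κd * ε.J

/-- The perturbation bound of the squared infeasible stationarity error. -/
def errJc2 (B : Bounds) (ε : Noise) : ℝ :=
  max (((B.κJ + ε.J) * ε.c + B.κc * ε.J) *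
    ((B.κJ + ε.J) * (B.κc + ε.c) + B.κJ * B.κc)) (B.κJ ^ 2 * ε.c ^ 2)

/-- `τ₀ |f_inf| + φ(x_0, τ_0) - φ_min`, with `φ_min = min {0, τ₀ f_inf}`; here `τ₀` is the initial
merit parameter (index `-1`). -/
def gap {n m : ℕ} (P : Problem n m) (R : Run n m) (p : Params) (finf : ℝ) : ℝ :=
  p.τ₀ * |finf| + P.phi (R.x 0) (R.τ 0) - min 0 (p.τ₀ * finf)

section BoundsOfTheorem

variable (B : Bounds) (p : Params) (ε : Noise) (K : Consts)

/-- Bound on the averaged `‖Jᵀc‖²`, as a function of the gap `Φ`, the step size bound `αl`, the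
merit error `E` and the iteration `k`. -/
def boundJc (αl E Φ : ℝ) (k : ℕ) : ℝ :=
  Φ * (B.κc + ε.c) / (((k : ℝ) + 1) * p.σc * K.σv * p.η * αl) +
    (B.κc + ε.c) / (p.σc * K.σv * p.η * αl) * E + errJc2 B ε

def kappa1 (κσ : ℝ) : ℝ := 4 * p.lamρr ^ 2 * (1 / B.ζ + (B.κJ + ε.J) / κσ ^ 2) ^ 2

def kappa2 : ℝ := 24 / B.ζ ^ 2 * B.κH ^ 2 * p.σJc ^ 2

/-- The common coefficient of the gap and of the merit error in `boundStat`. -/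
def statCoef (τmin κσ αl : ℝ) : ℝ :=
  (4 + 2 * kappa1 B p ε κσ) / (τmin * p.σu * p.lamu * p.η * αl) +
    (kappa1 B p ε κσ + 2 * kappa2 B p) * (B.κc + ε.c) / (p.σc * K.σv * p.η * αl)

/-- Bound on the averaged `‖Zᵀ(∇f + H v)‖² / κ_H²`. -/
def boundStat (τmin κσ αl E Φ : ℝ) (k : ℕ) : ℝ :=
  statCoef B p ε K τmin κσ αl * (Φ / ((k : ℝ) + 1)) + statCoef B p ε K τmin κσ αl * E +
    2 * kappa2 B p * errJc2 B ε + kappa1 B p ε κσ * (B.κJ + ε.J) ^ 2 * ε.c ^ 2 +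
    12 / B.ζ ^ 2 * (ε.g ^ 2 + K.κyb ^ 2 * ε.J ^ 2 + K.κy ^ 2 * ε.J ^ 2)

/-- Bound on the averaged `‖c‖²` when the true Jacobians have full rank. -/
def boundC2 (κσ αl E Φ : ℝ) (k : ℕ) : ℝ :=
  Φ * (B.κc + ε.c) / (((k : ℝ) + 1) * p.σc * K.σv * p.η * αl * κσ ^ 2) +
    (B.κc + ε.c) / (p.σc * K.σv * p.η * αl * κσ ^ 2) * E + 1 / κσ ^ 2 * errJc2 B ε

/-- Bound on the averaged `‖c‖` when the noisy Jacobians have full rank. -/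
def boundC (κσ αl E Φ : ℝ) (k : ℕ) : ℝ :=
  Φ / (((k : ℝ) + 1) * κσ ^ 2 * p.σc * K.σv * p.η * αl) +
    1 / (κσ ^ 2 * p.σc * K.σv * p.η * αl) * E + 2 * ε.c

end BoundsOfTheorem

/-- The average of `a 0, …, a k`. -/
def avg (a : ℕ → ℝ) (k : ℕ) : ℝ := 1 / ((k : ℝ) + 1) * ∑ j ∈ Finset.range (k + 1), a j

end NoisySQP

end

noncomputable section

namespace NoisySQP

/-! ### Linear algebra -/

section LinearAlgebra

variable {n m : ℕ}

/-! The true merit function acts as a Lyapunov function. A Taylor estimate on the segment from `x k`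
to `x k + d k`, with noisy quantities substituted for exact ones, shows that each iteration lowers
it by at least `η α Δl`, up to the fixed error `meritError` (`phi_succ_le`). The merit parameter is
nonincreasing and the merit function is bounded below, so telescoping gives `η α_low ∑ Δl ≤ Φ +
(number of steps) * error` (`sum_dl_le`). Whatever is bounded by a multiple of the model reduction
`Δl` plus a constant therefore has a bounded average (`avg_le`).

Three bounds by `Δl` suffice: on `‖J̄ᵀc̄‖²` (`sq_norm_Jcb_le`), on `‖ū‖²` (`sq_norm_u_le`) and, by
combining them, on `‖d̄‖²` (`modelConst_le`). If `‖c̄‖ > ε.o`, they come from Cauchy decrease and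
from the model reduction condition, which the update of the merit parameter enforces (`le_dl`). If
`‖c̄‖ ≤ ε.o`, the absence of termination gives `Δl > ε.o`, so `Δl` dominates both `‖c̄‖` and the
slack in the first termination test. The bound on `‖d̄‖²` also keeps the step sizes away from zero.

Infeasible stationarity then follows by perturbing `Jᵀc`, and the constraint bounds by inverting
`Jᵀ` or `J̄ᵀ` on full rank Jacobians. For the reduced gradient, `Zᵀ` annihilates the range of `Jᵀ`,
so `κH` times the exact tangential step of the true problem is a bound. This step is compared with
the exact noisy step through coercivity of `H` on the null space, and the noisy step with the
accepted inexact one through the residual test (`sq_norm_stat_le`).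

The constants `ξmin` and `κΔ` are lower bounds only and may be shrunk. This makes `alphaLow` as
small as desired (`exists_alphaLow_le`): it falls below the proved step bound `stepLow`, and the
term of order `1 / αl` in `statCoef` absorbs the factor `statRatio`, so the precise values of
`kappa1` and `kappa2` need no sharp derivation. -/

theorem inner_adjoint_apply (J : Vec n →L[ℝ] Vec m) (x : Vec n) (y : Vec m) :
    inner ℝ x ((J†) y) = inner ℝ (J x) y :=
  ContinuousLinearMap.adjoint_inner_right J x y

theorem norm_adjoint_apply_le {J : Vec n →L[ℝ] Vec m} {M : ℝ} (hJ : ‖J‖ ≤ M) (c : Vec m) :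
    ‖(J†) c‖ ≤ M * ‖c‖ := by
  refine ((J†).le_opNorm c).trans ?_
  rw [LinearIsometryEquiv.norm_map]
  gcongr

theorem norm_apply_le {n m : ℕ} {J : Vec n →L[ℝ] Vec m} {M : ℝ} (hJ : ‖J‖ ≤ M) (c : Vec n) :
    ‖J c‖ ≤ M * ‖c‖ :=
  (J.le_opNorm c).trans (by gcongr)

/-- The Cauchy decrease condition bounds the decrease by the squared gradient norm. -/
theorem IsNormalStep.decrease {σ γ M : ℝ} {J : Vec n →L[ℝ] Vec m} {c : Vec m} {v : Vec n}
    (h : IsNormalStep σ γ J c v) (hσ : 0 < σ) (hγ : 0 < γ) (hM : 0 < M) (hJ : ‖J‖ ≤ M) :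
    γ / 2 * min σ (1 / M ^ 2) * ‖(J†) c‖ ^ 2 ≤ ‖c‖ * (‖c‖ - ‖c + J v‖) := by
  set w := (J†) c with hw
  set a := min σ (‖w‖ ^ 2 / ‖J w‖ ^ 2) with ha
  have hcau := h.2.2
  rw [← hw, ← ha] at hcau
  have hinner : inner ℝ c (J w) = ‖w‖ ^ 2 := by
    rw [real_inner_comm, ← inner_adjoint_apply, ← hw, real_inner_self_eq_norm_sq]
  have ha0 : 0 ≤ a := le_min hσ.le (by positivity)
  have haJ : a * ‖J w‖ ^ 2 ≤ ‖w‖ ^ 2 := by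
    rcases eq_or_ne (‖J w‖) 0 with h0 | h0
    · rw [h0]; nlinarith [sq_nonneg ‖w‖]
    · calc a * ‖J w‖ ^ 2 ≤ ‖w‖ ^ 2 / ‖J w‖ ^ 2 * ‖J w‖ ^ 2 := by gcongr; exact min_le_right _ _
        _ = ‖w‖ ^ 2 := by field_simp
  -- The cross term contributes `-2a‖w‖²` and the quadratic term at most `a‖w‖²`, because `a` does
  -- not exceed the exact line minimizer.
  have hsq : ‖c + a • J (-w)‖ ^ 2 ≤ ‖c‖ ^ 2 - a * ‖w‖ ^ 2 := by
    rw [norm_add_sq_real, inner_smul_right, map_neg, inner_neg_right, hinner, norm_smul, norm_neg,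
      mul_pow, Real.norm_eq_abs, sq_abs]
    nlinarith
  have hmin : min σ (1 / M ^ 2) * ‖w‖ ^ 2 ≤ a * ‖w‖ ^ 2 := by
    rcases eq_or_ne w 0 with h0 | h0
    · simp [h0]
    · gcongr
      refine min_le_min le_rfl ?_
      -- A nonzero `w` cannot lie in the kernel of `J`, since `⟪c, J w⟫ = ‖w‖²`. This keeps the
      -- quotient in `a` away from the convention for division by zero.
      have hJw : J w ≠ 0 := by
        intro h1
        rw [h1, inner_zero_right] at hinner
        exact h0 (norm_eq_zero.mp (pow_eq_zero_iff two_ne_zero |>.mp hinner.symm))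
      have h1 : 0 < ‖J w‖ := norm_pos_iff.mpr hJw
      rw [div_le_div_iff₀ (by positivity) (by positivity), one_mul]
      have := norm_apply_le hJ w
      calc ‖J w‖ ^ 2 ≤ (M * ‖w‖) ^ 2 := by gcongr
        _ = ‖w‖ ^ 2 * M ^ 2 := by ring
  set t := ‖c + a • J (-w)‖ with ht
  have ht0 : 0 ≤ t := norm_nonneg _
  have hc0 : 0 ≤ ‖c‖ := norm_nonneg _
  have htc : t ≤ ‖c‖ := by
    refine le_of_sq_le_sq ?_ hc0
    nlinarith [mul_nonneg ha0 (sq_nonneg ‖w‖)]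
  -- Difference of squares with `‖c‖ + t ≤ 2‖c‖`; this is the origin of the factor `γ / 2`.
  have h2 : min σ (1 / M ^ 2) * ‖w‖ ^ 2 ≤ 2 * ‖c‖ * (‖c‖ - t) := by nlinarith
  calc γ / 2 * min σ (1 / M ^ 2) * ‖w‖ ^ 2
      = γ / 2 * (min σ (1 / M ^ 2) * ‖w‖ ^ 2) := by ring
    _ ≤ γ / 2 * (2 * ‖c‖ * (‖c‖ - t)) := by gcongr
    _ = ‖c‖ * (γ * (‖c‖ - t)) := by ring
    _ ≤ ‖c‖ * (‖c‖ - ‖c + J v‖) := by gcongr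

theorem range_adjoint (J : Vec n →L[ℝ] Vec m) :
    LinearMap.range (J†).toLinearMap = (LinearMap.ker J.toLinearMap)ᗮ := by
  rw [LinearMap.orthogonal_ker]
  rfl

/-- Each vector is the sum of a null vector and a vector in the range of the transpose. -/
theorem exists_ker_add_range (J : Vec n →L[ℝ] Vec m) (x : Vec n) :
    ∃ z w, x = z + (J†) w ∧ J z = 0 := by
  obtain ⟨z, hz, q, hq, rfl⟩ :=
    (LinearMap.ker J.toLinearMap).exists_add_mem_mem_orthogonal x
  rw [← range_adjoint] at hq
  obtain ⟨w, rfl⟩ := hq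
  exact ⟨z, w, rfl, hz⟩

/-- The Fredholm alternative in finite dimension; it is the source of Lagrange multipliers. -/
theorem exists_adjoint_apply_of_forall_inner {J : Vec n →L[ℝ] Vec m} {x : Vec n}
    (h : ∀ z, J z = 0 → inner ℝ z x = 0) : ∃ y, (J†) y = x := by
  have : x ∈ (LinearMap.ker J.toLinearMap)ᗮ := by
    rw [Submodule.mem_orthogonal]
    exact fun z hz => h z hz
  rw [← range_adjoint] at this
  exact this

/-- In an eigenbasis of `JᵀJ`, `J` stretches each component by its singular value. Directions with
singular value zero lie in the kernel, hence are orthogonal to the range of `Jᵀ` and do not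
contribute. -/
theorem NonzeroSVBoundedBelow.le_norm_apply {J : Vec n →L[ℝ] Vec m} {κ : ℝ} (hκ : 0 ≤ κ)
    (h : NonzeroSVBoundedBelow J κ) (y : Vec m) : κ * ‖(J†) y‖ ≤ ‖J ((J†) y)‖ := by
  set w := (J†) y with hw
  set T := J.toLinearMap with hT
  have hn : Module.finrank ℝ (Vec n) = n := by simp
  set b := T.isSymmetric_adjoint_comp_self.eigenvectorBasis hn with hb
  have happ : ∀ i : Fin n, (J†) (J (b i)) = (T.singularValues i ^ 2) • b i := fun i => by
    have := T.isSymmetric_adjoint_comp_self.apply_eigenvectorBasis hn i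
    rw [← T.sq_singularValues_fin hn] at this
    exact this
  have hJw : ‖J w‖ ^ 2 = ∑ i : Fin n, T.singularValues i ^ 2 * (inner ℝ (b i) w) ^ 2 := by
    rw [← real_inner_self_eq_norm_sq, ← inner_adjoint_apply]
    rw [← b.sum_inner_mul_inner]
    refine Finset.sum_congr rfl fun i _ => ?_
    have h1 : inner ℝ (b i) ((J†) (J w)) = T.singularValues i ^ 2 * inner ℝ (b i) w := by
      rw [inner_adjoint_apply, real_inner_comm, ← inner_adjoint_apply, happ, inner_smul_right,
        real_inner_comm]
    rw [h1, real_inner_comm]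
    ring
  have hww : ‖w‖ ^ 2 = ∑ i : Fin n, (inner ℝ (b i) w) ^ 2 := by
    rw [← b.sum_sq_norm_inner_right]
    simp
  have hle : (κ * ‖w‖) ^ 2 ≤ ‖J w‖ ^ 2 := by
    rw [mul_pow, hJw, hww, Finset.mul_sum]
    refine Finset.sum_le_sum fun i _ => ?_
    by_cases hi : T.singularValues i = 0
    · have h1 : J (b i) = 0 := by
        rw [← norm_eq_zero, ← sq_eq_zero_iff, ← real_inner_self_eq_norm_sq, ← inner_adjoint_apply,
          happ, hi]
        simp
      rw [hw, inner_adjoint_apply, h1]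
      simp
    · have := h i hi
      gcongr
  exact le_of_sq_le_sq hle (norm_nonneg _)

/-- The bound passes to the transpose without its singular values: on the row space part `q` of `x`,
`‖J q‖² = ⟪q, JᵀJ q⟫ ≤ ‖q‖ ‖JᵀJ q‖`, while `κ‖q‖ ≤ ‖J q‖`. -/
theorem NonzeroSVBoundedBelow.le_norm_adjoint {J : Vec n →L[ℝ] Vec m} {κ : ℝ} (hκ : 0 ≤ κ)
    (h : NonzeroSVBoundedBelow J κ) (x : Vec n) : κ * ‖J x‖ ≤ ‖(J†) (J x)‖ := by
  obtain ⟨z, w, rfl, hz⟩ := exists_ker_add_range J x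
  rw [map_add, hz, zero_add]
  set q := (J†) w
  have h1 : κ * ‖q‖ ≤ ‖J q‖ := h.le_norm_apply hκ w
  have h2 : ‖J q‖ ^ 2 ≤ ‖q‖ * ‖(J†) (J q)‖ := by
    rw [← real_inner_self_eq_norm_sq, ← inner_adjoint_apply]
    exact real_inner_le_norm _ _
  rcases (norm_nonneg (J q)).eq_or_lt with h0 | h0
  · rw [← h0]; simp
  · refine le_of_mul_le_mul_left ?_ h0
    calc ‖J q‖ * (κ * ‖J q‖) = κ * ‖J q‖ ^ 2 := by ring
      _ ≤ κ * (‖q‖ * ‖(J†) (J q)‖) := by gcongr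
      _ = κ * ‖q‖ * ‖(J†) (J q)‖ := by ring
      _ ≤ ‖J q‖ * ‖(J†) (J q)‖ := by gcongr

/-- With a nontrivial null space, a lower bound on all singular values makes the transpose bounded
below. -/
theorem SVBoundedBelow.le_norm_adjoint {J : Vec n →L[ℝ] Vec m} {κ : ℝ} (hκ : 0 < κ)
    (h : SVBoundedBelow J κ) (hnull : ∃ u, u ≠ 0 ∧ J u = 0) (c : Vec m) :
    κ * ‖c‖ ≤ ‖(J†) c‖ := by
  set T := J.toLinearMap with hT
  have hn : Module.finrank ℝ (Vec n) = n := by simp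
  -- For `m ≥ n` the hypothesis would make all `n` singular values positive and `J` injective. The
  -- nontrivial null space thus leaves only the case of full row rank.
  have hlt : m < n := by
    by_contra! hmn
    have hinj : Function.Injective T := by
      rw [T.injective_iff_forall_lt_finrank_singularValues_pos, hn]
      intro i hi
      exact hκ.trans_le (h i (by omega))
    obtain ⟨u, hu, hJu⟩ := hnull
    exact hu (hinj (by rw [map_zero]; exact hJu))
  -- Singular values are indexed from zero, so the one whose index is the rank is the first to
  -- vanish.
  have hrank : m ≤ Module.finrank ℝ T.range := by
    by_contra! hr
    have := T.singularValues_finrank_range_self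
    have h1 := h (Module.finrank ℝ T.range) (by omega)
    rw [this] at h1
    linarith
  have hsurj : T.range = ⊤ := by
    apply Submodule.eq_top_of_finrank_eq
    refine le_antisymm (Submodule.finrank_le _) ?_
    simpa using hrank
  have hnz : NonzeroSVBoundedBelow J κ := by
    intro i hi
    have h1 : i < Module.finrank ℝ T.range := by
      rw [← T.singularValues_pos_iff_lt_finrank_range, T.singularValues_pos_iff_ne_zero]
      exact hi
    have h2 : Module.finrank ℝ T.range ≤ m := by
      simpa using Submodule.finrank_le T.range
    exact h i (by omega)
  obtain ⟨x, rfl⟩ : c ∈ T.range := hsurj ▸ Submodule.mem_top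
  exact hnz.le_norm_adjoint hκ.le x

/-- The tangential system is solvable if `H` is coercive on the null space. -/
theorem exists_isKKT {H : Vec n →L[ℝ] Vec n} {J : Vec n →L[ℝ] Vec m} {ζ : ℝ} (hζ : 0 < ζ)
    (hH : ∀ u, J u = 0 → ζ * ‖u‖ ^ 2 ≤ inner ℝ u (H u)) (g v : Vec n) :
    ∃ u y, IsKKT H J g v u y := by
  set N := LinearMap.ker J.toLinearMap
  -- The compression of `H` to the null space: coercivity makes it injective, hence surjective. The
  -- remaining defect is orthogonal to the null space and is matched by a multiplier.
  let A : N →ₗ[ℝ] N :=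
    (N.orthogonalProjectionOnto.toLinearMap ∘ₗ H.toLinearMap) ∘ₗ N.subtype
  have hA : ∀ (a : N) (x : Vec n), inner ℝ (a : Vec n) (N.orthogonalProjectionOnto x : Vec n) =
      inner ℝ (a : Vec n) x := fun a x => by
    exact N.inner_orthogonalProjectionOnto_eq_of_mem_left a x
  have hinj : Function.Injective A := by
    rw [← LinearMap.ker_eq_bot, LinearMap.ker_eq_bot']
    intro a ha
    have h1 : inner ℝ (a : Vec n) (H a) = 0 := by
      rw [← hA a (H a)]
      have : N.orthogonalProjectionOnto (H a) = 0 := ha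
      rw [this]; simp
    have h2 := hH a a.2
    rw [h1] at h2
    have h3 : ‖(a : Vec n)‖ ^ 2 ≤ 0 := by
      by_contra! h4
      nlinarith
    have h5 : (a : Vec n) = 0 := by
      rw [← norm_eq_zero]
      exact pow_eq_zero_iff two_ne_zero |>.mp (le_antisymm h3 (sq_nonneg _))
    exact Subtype.ext h5
  obtain ⟨u, hu⟩ := LinearMap.surjective_of_injective hinj (N.orthogonalProjectionOnto (-(g + H v)))
  obtain ⟨y, hy⟩ : ∃ y, (J†) y = -(g + H v) - H u := by
    refine exists_adjoint_apply_of_forall_inner fun z hz => ?_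
    rw [inner_sub_right, ← hA ⟨z, hz⟩ (-(g + H v)), ← hA ⟨z, hz⟩ (H u), ← hu]
    exact sub_self _
  exact ⟨u, y, by rw [hy]; abel, u.2⟩

/-! ### A priori and perturbation bounds for the tangential system -/

section KKT

variable {H : Vec n →L[ℝ] Vec n} {J : Vec n →L[ℝ] Vec m} {g v u : Vec n} {y : Vec m} {ζ κH κ : ℝ}

/-- The tangential component is bounded by the right-hand side. -/
theorem IsKKT.norm_le (h : IsKKT H J g v u y) (hζ : 0 < ζ)
    (hH : ∀ u, J u = 0 → ζ * ‖u‖ ^ 2 ≤ inner ℝ u (H u)) (hκH : ‖H‖ ≤ κH) :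
    ‖u‖ ≤ (‖g‖ + κH * ‖v‖) / ζ := by
  have h1 := hH u h.2
  have h2 : inner ℝ u (H u) + inner ℝ u ((J†) y) = - inner ℝ u (g + H v) := by
    rw [← inner_add_right, h.1, inner_neg_right]
  rw [inner_adjoint_apply, h.2, inner_zero_left, add_zero] at h2
  have h3 := neg_le_of_abs_le (abs_real_inner_le_norm u (g + H v))
  have h4 : ‖g + H v‖ ≤ ‖g‖ + κH * ‖v‖ := (norm_add_le _ _).trans (by gcongr; exact norm_apply_le hκH v)
  rw [le_div_iff₀ hζ]
  rcases (norm_nonneg u).eq_or_lt with h0 | h0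
  · rw [← h0, zero_mul]; exact (norm_nonneg _).trans h4
  · refine le_of_mul_le_mul_left ?_ h0
    calc ‖u‖ * (‖u‖ * ζ) = ζ * ‖u‖ ^ 2 := by ring
      _ ≤ ‖u‖ * ‖g + H v‖ := by linarith
      _ ≤ _ := by gcongr

/-- The multiplier can be chosen bounded if the nonzero singular values are bounded below. -/
theorem IsKKT.exists_multiplier (h : IsKKT H J g v u y) (hζ : 0 < ζ)
    (hH : ∀ u, J u = 0 → ζ * ‖u‖ ^ 2 ≤ inner ℝ u (H u)) (hκH : ‖H‖ ≤ κH) (hκ : 0 < κ)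
    (hJ : NonzeroSVBoundedBelow J κ) :
    ∃ y', IsKKT H J g v u y' ∧ ‖y'‖ ≤ (1 + κH / ζ) * (‖g‖ + κH * ‖v‖) / κ := by
  -- Multipliers are unique only up to the kernel of `Jᵀ`. Dropping that component leaves `J x`, on
  -- which `Jᵀ` is bounded below.
  obtain ⟨z, x, hx, hz⟩ := exists_ker_add_range (J†) y
  rw [ContinuousLinearMap.adjoint_adjoint] at hx
  have hJy : (J†) y = (J†) (J x) := by rw [hx, map_add, hz, zero_add]
  refine ⟨J x, ⟨by rw [← hJy]; exact h.1, h.2⟩, ?_⟩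
  rw [le_div_iff₀ hκ, mul_comm]
  refine (hJ.le_norm_adjoint hκ.le x).trans ?_
  have h1 : (J†) (J x) = -(g + H v + H u) := by
    rw [← hJy, eq_neg_iff_add_eq_zero]
    have := h.1
    rw [eq_neg_iff_add_eq_zero] at this
    rw [← this]; abel
  have h4 : ‖g + H v‖ ≤ ‖g‖ + κH * ‖v‖ := (norm_add_le _ _).trans (by gcongr; exact norm_apply_le hκH v)
  have hκH0 : 0 ≤ κH := (norm_nonneg _).trans hκH
  rw [h1, norm_neg]
  calc ‖g + H v + H u‖ ≤ ‖g + H v‖ + ‖H u‖ := norm_add_le _ _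
    _ ≤ (‖g‖ + κH * ‖v‖) + κH * ((‖g‖ + κH * ‖v‖) / ζ) := by
        gcongr
        exact (norm_apply_le hκH u).trans (by gcongr; exact h.norm_le hζ hH hκH)
    _ = _ := by ring

/-- Distance of an approximate solution of the tangential system to the exact one in terms of the
residuals. -/
theorem IsKKT.norm_sub_le (h : IsKKT H J g v u y) (hζ : 0 < ζ)
    (hH : ∀ u, J u = 0 → ζ * ‖u‖ ^ 2 ≤ inner ℝ u (H u)) (hκH : ‖H‖ ≤ κH) (hκ : 0 < κ)
    (hJ : NonzeroSVBoundedBelow J κ) (u' : Vec n) (y' : Vec m) :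
    ‖u' - u‖ ≤ ‖H u' + (J†) y' + (g + H v)‖ / ζ + (1 + κH / ζ) * (‖J u'‖ / κ) := by
  -- The two parts of the error need different arguments: the row space part is recovered from `J
  -- u'` by the singular value bound, the null space part by coercivity, since pairing with `z`
  -- removes the unknown multipliers.
  obtain ⟨z, q, hq, hz⟩ := exists_ker_add_range J (u' - u)
  set w := (J†) q
  set ρ := H u' + (J†) y' + (g + H v) with hρ
  have hκH0 : 0 ≤ κH := (norm_nonneg _).trans hκH
  have hJw : J w = J u' := by
    have := congrArg J hq
    rw [map_sub, h.2, sub_zero, map_add, hz, zero_add] at this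
    exact this.symm
  have hw : ‖w‖ ≤ ‖J u'‖ / κ := by
    rw [le_div_iff₀ hκ, mul_comm, ← hJw]
    exact hJ.le_norm_apply hκ.le q
  have hρ' : H z = ρ - H w - (J†) (y' - y) := by
    have h1 : H z = H u' - H u - H w := by
      have := congrArg H hq
      rw [map_sub, map_add] at this
      rw [this]; abel
    have h2 := h.1
    rw [eq_neg_iff_add_eq_zero] at h2
    rw [h1, map_sub, hρ]
    have h3 : H u = - ((J†) y + (g + H v)) := by
      rw [eq_neg_iff_add_eq_zero, ← add_assoc]; exact h2
    rw [h3]; abel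
  have hzz : ζ * ‖z‖ ^ 2 ≤ ‖z‖ * (‖ρ‖ + κH * ‖w‖) := by
    calc ζ * ‖z‖ ^ 2 ≤ inner ℝ z (H z) := hH z hz
      _ = inner ℝ z (ρ - H w) := by
          rw [hρ', inner_sub_right, inner_adjoint_apply, hz, inner_zero_left, sub_zero]
      _ ≤ ‖z‖ * ‖ρ - H w‖ := real_inner_le_norm _ _
      _ ≤ ‖z‖ * (‖ρ‖ + κH * ‖w‖) := by
          gcongr
          exact (_root_.norm_sub_le _ _).trans (by gcongr; exact norm_apply_le hκH w)
  have hz' : ‖z‖ ≤ (‖ρ‖ + κH * ‖w‖) / ζ := by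
    rw [le_div_iff₀ hζ]
    rcases (norm_nonneg z).eq_or_lt with h0 | h0
    · rw [← h0, zero_mul]; positivity
    · refine le_of_mul_le_mul_left ?_ h0
      linarith
  rw [hq]
  calc ‖z + w‖ ≤ ‖z‖ + ‖w‖ := norm_add_le _ _
    _ ≤ (‖ρ‖ + κH * ‖w‖) / ζ + ‖w‖ := by gcongr
    _ = ‖ρ‖ / ζ + (1 + κH / ζ) * ‖w‖ := by ring
    _ ≤ _ := by gcongr

/-- Sensitivity of the tangential component: comparison of exact solutions of two tangential
systems. -/
theorem IsKKT.norm_le_of_perturbed {J' : Vec n →L[ℝ] Vec m} {g' v' u' : Vec n} {y' : Vec m}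
    {εg εJ κy : ℝ} (h : IsKKT H J g v u y) (h' : IsKKT H J' g' v' u' y')
    (hH : ∀ u, J u = 0 → ζ * ‖u‖ ^ 2 ≤ inner ℝ u (H u)) (hκH : ‖H‖ ≤ κH)
    (hg : ‖g' - g‖ ≤ εg) (hJ : ‖J' - J‖ ≤ εJ) (hy : ‖y'‖ ≤ κy) :
    ζ * ‖u‖ ≤ εg + κy * εJ + κH * (‖u'‖ + ‖v'‖) + κH * ‖v‖ := by
  have hεJ : 0 ≤ εJ := (norm_nonneg _).trans hJ
  have hεg : 0 ≤ εg := (norm_nonneg _).trans hg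
  have hκy : 0 ≤ κy := (norm_nonneg _).trans hy
  have hκH0 : 0 ≤ κH := (norm_nonneg _).trans hκH
  -- Both stationarity equations are paired with `u`. Its own multiplier drops out because `J u =
  -- 0`; the other one meets `J' u = (J' - J) u` and is left with a factor of the Jacobian noise.
  have key : inner ℝ u (H u) = inner ℝ u (g' - g) + inner ℝ u (H u') + inner ℝ u (H v')
      + inner ℝ ((J' - J) u) y' - inner ℝ u (H v) := by
    have h1 := congrArg (inner ℝ u) h.1
    have h2 := congrArg (inner ℝ u) h'.1
    simp only [inner_add_right, inner_neg_right, inner_adjoint_apply, h.2, inner_zero_left] at h1 h2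
    rw [sub_apply, h.2, sub_zero, inner_sub_right]
    linarith
  have hb : ∀ a : Vec n, ‖H a‖ ≤ κH * ‖a‖ := norm_apply_le hκH
  have e1 : inner ℝ u (g' - g) ≤ ‖u‖ * εg := (real_inner_le_norm _ _).trans (by gcongr)
  have e2 : inner ℝ u (H u') ≤ ‖u‖ * (κH * ‖u'‖) :=
    (real_inner_le_norm _ _).trans (by gcongr; exact hb _)
  have e3 : inner ℝ u (H v') ≤ ‖u‖ * (κH * ‖v'‖) :=
    (real_inner_le_norm _ _).trans (by gcongr; exact hb _)
  have e4 : inner ℝ ((J' - J) u) y' ≤ (εJ * ‖u‖) * κy :=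
    (real_inner_le_norm _ _).trans (by gcongr; exact norm_apply_le hJ _)
  have e5 : - inner ℝ u (H v) ≤ ‖u‖ * (κH * ‖v‖) := by
    rw [← inner_neg_right]
    exact (real_inner_le_norm _ _).trans (by rw [norm_neg]; gcongr; exact hb _)
  have hu := hH u h.2
  rcases (norm_nonneg u).eq_or_lt with h0 | h0
  · rw [← h0, mul_zero]; positivity
  · refine le_of_mul_le_mul_left ?_ h0
    linarith

/-- The columns of `Z` span the null space, so the multiplier term disappears and the reduced
gradient equals `-Zᵀ H u`. -/
theorem IsKKT.norm_adjoint_le (h : IsKKT H J g v u y) (hκH : ‖H‖ ≤ κH) {q : ℕ}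
    (Z : Vec q →ₗᵢ[ℝ] Vec n) (hZ : LinearMap.range Z.toLinearMap = LinearMap.ker J.toLinearMap) :
    ‖(Z.toContinuousLinearMap.adjoint) (g + H v)‖ ≤ κH * ‖u‖ := by
  have h0 : (Z.toContinuousLinearMap.adjoint) ((J†) y) = 0 := by
    refine ext_inner_left ℝ fun x => ?_
    rw [inner_adjoint_apply, inner_adjoint_apply, inner_zero_right]
    have : Z x ∈ LinearMap.ker J.toLinearMap := hZ ▸ ⟨x, rfl⟩
    have h1 : J (Z.toContinuousLinearMap x) = 0 := this
    rw [h1, inner_zero_left]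
  have h1 : g + H v = -(H u) - (J†) y := by
    have := h.1
    rw [eq_neg_iff_add_eq_zero] at this
    rw [eq_comm, sub_eq_iff_eq_add, neg_eq_iff_add_eq_zero, ← this]; abel
  rw [h1, map_sub, h0, sub_zero, map_neg, norm_neg]
  calc _ ≤ 1 * ‖H u‖ := norm_adjoint_apply_le Z.norm_toContinuousLinearMap_le _
    _ ≤ κH * ‖u‖ := by rw [one_mul]; exact norm_apply_le hκH u

end KKT

end LinearAlgebra

/-! ### Taylor estimates and the decrease of the merit function -/

section Smooth

variable {n m : ℕ}

/-- First-order Taylor estimate for a map with Lipschitz derivative. -/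
theorem norm_taylor_le {G : Type*} [NormedAddCommGroup G] [NormedSpace ℝ G] {F : Vec n → G}
    {X : Set (Vec n)} {M : ℝ} (hX : IsOpen X) (hconv : Convex ℝ X) (hF : DifferentiableOn ℝ F X)
    (hlip : ∀ x ∈ X, ∀ x' ∈ X, ‖fderiv ℝ F x - fderiv ℝ F x'‖ ≤ M * ‖x - x'‖)
    {x d : Vec n} (hx : x ∈ X) (hxd : x + d ∈ X) {α : ℝ} (hα : α ∈ Set.Icc (0 : ℝ) 1) :
    ‖F (x + α • d) - F x - α • fderiv ℝ F x d‖ ≤ M / 2 * α ^ 2 * ‖d‖ ^ 2 := by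
  have hmem : ∀ t ∈ Set.Icc (0 : ℝ) 1, x + t • d ∈ X := fun t ht =>
    hconv.add_smul_mem hx hxd ht
  have hderiv : ∀ t ∈ Set.Icc (0 : ℝ) 1,
      HasDerivAt (fun t : ℝ => F (x + t • d) - F x - t • fderiv ℝ F x d)
        (fderiv ℝ F (x + t • d) d - fderiv ℝ F x d) t := by
    intro t ht
    have h1 : HasFDerivAt F (fderiv ℝ F (x + t • d)) (x + t • d) :=
      ((hF _ (hmem t ht)).differentiableAt (hX.mem_nhds (hmem t ht))).hasFDerivAt
    have h2 : HasDerivAt (fun t : ℝ => x + t • d) d t := by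
      simpa using ((hasDerivAt_id t).smul_const d).const_add x
    have h3 : HasDerivAt (fun t : ℝ => t • fderiv ℝ F x d) (fderiv ℝ F x d) t := by
      simpa using (hasDerivAt_id t).smul_const (fderiv ℝ F x d)
    exact ((h1.comp_hasDerivAt t h2).sub_const (F x)).sub h3
  -- A comparison argument replaces integration: the majorant `M t² ‖d‖² / 2` vanishes at `0` and
  -- its derivative dominates the norm of the derivative of the remainder.
  have := image_norm_le_of_norm_deriv_right_le_deriv_boundary (a := (0 : ℝ)) (b := 1)
    (f := fun t : ℝ => F (x + t • d) - F x - t • fderiv ℝ F x d)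
    (f' := fun t => fderiv ℝ F (x + t • d) d - fderiv ℝ F x d)
    (B := fun t => M / 2 * t ^ 2 * ‖d‖ ^ 2) (B' := fun t => M * t * ‖d‖ ^ 2)
    (fun t ht => (hderiv t ht).continuousAt.continuousWithinAt)
    (fun t ht => (hderiv t (Set.Ico_subset_Icc_self ht)).hasDerivWithinAt)
    (by simp)
    (fun t => by
      have := (((hasDerivAt_pow 2 t).const_mul (M / 2)).mul_const (‖d‖ ^ 2))
      convert! this using 1
      push_cast
      ring)
    (fun t ht => by
      have h1 := hlip _ (hmem t (Set.Ico_subset_Icc_self ht)) _ hx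
      rw [add_sub_cancel_left, norm_smul, Real.norm_of_nonneg ht.1] at h1
      rw [← sub_apply]
      calc _ ≤ ‖fderiv ℝ F (x + t • d) - fderiv ℝ F x‖ * ‖d‖ := ContinuousLinearMap.le_opNorm _ _
        _ ≤ (M * (t * ‖d‖)) * ‖d‖ := by gcongr
        _ = _ := by ring)
  exact this hα

variable {P : Problem n m} {X : Set (Vec n)} {B : Bounds} {finf fsup : ℝ} {ε : Noise}

theorem Problem.SmoothOn.f_le (h : P.SmoothOn X B finf fsup) {x d : Vec n} (hx : x ∈ X)
    (hxd : x + d ∈ X) {α : ℝ} (hα : α ∈ Set.Icc (0 : ℝ) 1) :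
    P.f (x + α • d) ≤ P.f x + α * inner ℝ (P.g x) d + B.L / 2 * α ^ 2 * ‖d‖ ^ 2 := by
  have hfd : ∀ x, fderiv ℝ P.f x = InnerProductSpace.toDual ℝ (Vec n) (P.g x) := fun x => by
    simp [Problem.g, gradient]
  have := norm_taylor_le h.isOpen h.convex h.f_diff (M := B.L)
    (fun x hx x' hx' => by
      rw [hfd, hfd, ← map_sub, LinearIsometryEquiv.norm_map]
      exact h.g_lipschitz x hx x' hx') hx hxd hα
  rw [hfd, InnerProductSpace.toDual_apply_apply, Real.norm_eq_abs] at this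
  have := (abs_le.mp this).2
  rw [smul_eq_mul] at this
  linarith

/-- The linearization is the convex combination `(1 - α) c + α (c + J d)`, to which the Taylor
remainder is added. -/
theorem Problem.SmoothOn.c_le (h : P.SmoothOn X B finf fsup) {x d : Vec n} (hx : x ∈ X)
    (hxd : x + d ∈ X) {α : ℝ} (hα : α ∈ Set.Icc (0 : ℝ) 1) :
    ‖P.c (x + α • d)‖ ≤
      (1 - α) * ‖P.c x‖ + α * ‖P.c x + P.J x d‖ + B.Γ / 2 * α ^ 2 * ‖d‖ ^ 2 := by
  have h1 := norm_taylor_le h.isOpen h.convex h.c_diff (M := B.Γ) h.J_lipschitz hx hxd hα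
  have h2 : P.c (x + α • d) = (P.c (x + α • d) - P.c x - α • fderiv ℝ P.c x d) +
      ((1 - α) • P.c x + α • (P.c x + P.J x d)) := by
    rw [Problem.J]; module
  rw [h2]
  calc _ ≤ ‖P.c (x + α • d) - P.c x - α • fderiv ℝ P.c x d‖ +
        (‖(1 - α) • P.c x‖ + ‖α • (P.c x + P.J x d)‖) :=
        (norm_add_le _ _).trans (by gcongr; exact norm_add_le _ _)
    _ ≤ _ := by
        rw [norm_smul, norm_smul, Real.norm_of_nonneg hα.1,
          Real.norm_of_nonneg (sub_nonneg.mpr hα.2)]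
        linarith

/-- Decrease of the true merit function in terms of the noisy model reduction. -/
theorem Problem.SmoothOn.phi_le (h : P.SmoothOn X B finf fsup) (hN : P.NoiseOn X ε) {x d : Vec n}
    (hx : x ∈ X) (hxd : x + d ∈ X) {α τ : ℝ} (hα : α ∈ Set.Icc (0 : ℝ) 1) (hτ : 0 ≤ τ) :
    P.phi (x + α • d) τ ≤ P.phi x τ - α * P.deltal x τ d +
      (τ * B.L + B.Γ) / 2 * α ^ 2 * ‖d‖ ^ 2 +
      α * (τ * ε.g * ‖d‖ + 2 * ε.c + ε.J * ‖d‖) := by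
  have hα0 := hα.1
  have h1 := h.f_le hx hxd hα
  have h2 := h.c_le hx hxd hα
  have h3 : inner ℝ (P.g x) d ≤ inner ℝ (P.gbar x) d + ε.g * ‖d‖ := by
    have e1 : inner ℝ (P.g x - P.gbar x) d ≤ ε.g * ‖d‖ :=
      (real_inner_le_norm _ _).trans (by
        gcongr; rw [norm_sub_rev]; exact hN.g_noise x hx)
    rw [inner_sub_left] at e1
    linarith
  have h4 : ‖P.c x + P.J x d‖ ≤ ‖P.cbar x + P.Jbar x d‖ + ε.c + ε.J * ‖d‖ := by
    have e1 : P.c x + P.J x d =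
        (P.cbar x + P.Jbar x d) - (P.cbar x - P.c x) - (P.Jbar x - P.J x) d := by
      rw [sub_apply]; abel
    rw [e1]
    refine (norm_sub_le _ _).trans ?_
    refine add_le_add ((norm_sub_le _ _).trans ?_) (norm_apply_le (hN.J_noise x hx) d)
    gcongr
    exact hN.c_noise x hx
  -- The constraint noise is paid twice, in `‖c + J d‖` and in `‖c‖`, hence the term `2 * ε.c`.
  have h5 : ‖P.cbar x‖ ≤ ‖P.c x‖ + ε.c := by
    have := norm_sub_norm_le (P.cbar x) (P.c x)
    linarith [hN.c_noise x hx]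
  have h1' := mul_le_mul_of_nonneg_left h1 hτ
  have h3' := mul_le_mul_of_nonneg_left h3 (mul_nonneg hα0 hτ)
  have h4' := mul_le_mul_of_nonneg_left h4 hα0
  have h5' := mul_le_mul_of_nonneg_left h5 hα0
  unfold Problem.phi Problem.deltal
  linarith

theorem Problem.NoiseOn.abs_phibar_sub_phi_le (hN : P.NoiseOn X ε) {x : Vec n} (hx : x ∈ X)
    {τ : ℝ} (hτ : 0 ≤ τ) : |P.phibar x τ - P.phi x τ| ≤ τ * ε.f + ε.c := by
  have h1 := hN.f_noise x hx
  have h2 := (abs_norm_sub_norm_le (P.cbar x) (P.c x)).trans (hN.c_noise x hx)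
  have h3 : P.phibar x τ - P.phi x τ =
      τ * (P.fbar x - P.f x) + (‖P.cbar x‖ - ‖P.c x‖) := by
    unfold Problem.phibar Problem.phi; ring
  rw [h3]
  refine (abs_add_le _ _).trans ?_
  rw [abs_mul, abs_of_nonneg hτ]
  gcongr

end Smooth

/-! ### Constants of the analysis -/

section Constants

variable (B : Bounds) (p : Params) (τmin M : ℝ)

/-- Decrease constant of the normal steps, for noise levels at most `M`. -/
def normalDecrease : ℝ := p.γc / 2 * min p.σJc (1 / (B.κJ + M) ^ 2)

/-- Bound on the normal components. -/
def normalBound : ℝ := p.σJc * ((B.κJ + M) * (B.κc + M))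

/-- Bound on the tangential components. -/
def tangentialBound : ℝ :=
  p.lamuv * normalBound B p M + (1 + (p.lamv * normalBound B p M + 2 * M +
    (B.κg + M + B.κH * normalBound B p M)) / (p.lamu / 2))

/-- Bound on the ratio of `‖J̄ᵀ c̄‖²` and the model reduction. -/
def stationarityRatio : ℝ := (B.κc + M) / (p.σc * normalDecrease B p M)

/-- Bound on the ratio of `‖ū‖²` and the model reduction. -/
def tangentialRatio : ℝ := 2 / (τmin * p.σu * p.lamu)

/-- Lower bound on the ratio of the model reduction and `‖d̄‖²`. -/
def modelConst : ℝ :=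
  1 / (2 * tangentialRatio p τmin + 2 * (p.σJc ^ 2 * stationarityRatio B p M))

/-- Lower bound on the sequence `ξ`. -/
def ratioLow (a : AdaptiveParams) : ℝ :=
  min a.ξ₀ ((1 - a.σξ) * (modelConst B p τmin M / max p.τ₀ 1))

/-- Lower bound on the step sizes. -/
def stepLow : StepRule → ℝ
  | .adaptive a =>
      2 * (1 - p.η) * a.β * ratioLow B p τmin M a * min τmin 1 / (p.τ₀ * B.L + B.Γ)
  | .lineSearch l =>
      min l.αu (l.ν * (1 - p.η) * modelConst B p τmin M / (p.τ₀ * B.L + B.Γ))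

variable {B p τmin M}

theorem normalDecrease_pos (hB : B.Admissible) (hp : p.Admissible B) (hM : 0 < M) :
    0 < normalDecrease B p M := by
  have := hp.γc_mem.1
  have := hp.σJc_pos
  have := hB.κJ_pos
  unfold normalDecrease
  positivity

theorem normalBound_pos (hB : B.Admissible) (hp : p.Admissible B) (hM : 0 < M) :
    0 < normalBound B p M := by
  have := hp.σJc_pos
  have := hB.κJ_pos
  have := hB.κc_pos
  unfold normalBound
  positivity

theorem tangentialBound_pos (hB : B.Admissible) (hp : p.Admissible B) (hM : 0 < M) :
    0 < tangentialBound B p M := by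
  have := hp.lamuv_pos
  have := hp.lamv_pos
  have := hp.lamu_mem.1
  have := hB.κg_pos
  have := hB.κH_pos
  have := normalBound_pos hB hp hM
  unfold tangentialBound
  positivity

theorem stationarityRatio_pos (hB : B.Admissible) (hp : p.Admissible B) (hM : 0 < M) :
    0 < stationarityRatio B p M := by
  have := hp.σc_mem.1
  have := hB.κc_pos
  have := normalDecrease_pos hB hp hM
  unfold stationarityRatio
  positivity

theorem tangentialRatio_pos (hp : p.Admissible B) (hτ : 0 < τmin) :
    0 < tangentialRatio p τmin := by
  have := hp.σu_mem.1
  have := hp.lamu_mem.1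
  unfold tangentialRatio
  positivity

theorem modelConst_pos (hB : B.Admissible) (hp : p.Admissible B) (hτ : 0 < τmin) (hM : 0 < M) :
    0 < modelConst B p τmin M := by
  have := stationarityRatio_pos hB hp hM
  have := tangentialRatio_pos hp hτ
  unfold modelConst
  positivity

theorem stepDen_pos (hB : B.Admissible) {τ : ℝ} (hτ : 0 < τ) : 0 < τ * B.L + B.Γ := by
  have := hB.L_pos
  have := hB.Γ_nonneg
  positivity

theorem ratioLow_pos (hB : B.Admissible) (hp : p.Admissible B) (hτ : 0 < τmin) (hM : 0 < M)
    {a : AdaptiveParams} (ha : (StepRule.adaptive a).Admissible B p τmin) :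
    0 < ratioLow B p τmin M a := by
  obtain ⟨-, -, -, -, -, hξ, -, -, hσξ, -⟩ := ha
  have := modelConst_pos hB hp hτ hM
  have := sub_pos.mpr hσξ.2
  unfold ratioLow
  positivity

theorem stepLow_pos (hB : B.Admissible) (hp : p.Admissible B) (hτ : 0 < τmin) (hM : 0 < M)
    {rule : StepRule} (hr : rule.Admissible B p τmin) : 0 < stepLow B p τmin M rule := by
  have h1 := sub_pos.mpr hp.η_mem.2
  have h2 := stepDen_pos hB hp.τ₀_pos
  cases rule with
  | adaptive a =>
    have := ratioLow_pos hB hp hτ hM hr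
    have := hr.2.1.1
    unfold stepLow
    positivity
  | lineSearch l =>
    have := modelConst_pos hB hp hτ hM
    have := hr.1.1
    have := hr.2.1
    unfold stepLow
    positivity

end Constants

/-! ### Estimates along a run -/

section Run

variable {n m : ℕ} {P : Problem n m} {R : Run n m} {X : Set (Vec n)} {B : Bounds} {p : Params}
  {rule : StepRule} {ε : Noise} {finf fsup τmin M : ℝ}


theorem Run.Standing.norm_Jb_le (S : R.Standing P X B p rule ε finf fsup) (k : ℕ) :
    ‖R.Jb P k‖ ≤ B.κJ + ε.J := by
  have h1 := S.smooth.J_bound _ (S.staysIn k).1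
  have h2 := S.noise.J_noise _ (S.staysIn k).1
  have h3 := norm_sub_norm_le (P.Jbar (R.x k)) (P.J (R.x k))
  unfold Run.Jb
  linarith

theorem Run.Standing.norm_cb_le (S : R.Standing P X B p rule ε finf fsup) (k : ℕ) :
    ‖R.cb P k‖ ≤ B.κc + ε.c := by
  have h1 := S.smooth.c_bound _ (S.staysIn k).1
  have h2 := S.noise.c_noise _ (S.staysIn k).1
  have h3 := norm_sub_norm_le (P.cbar (R.x k)) (P.c (R.x k))
  unfold Run.cb
  linarith

theorem Run.Standing.norm_c_le_cb (S : R.Standing P X B p rule ε finf fsup) (k : ℕ) :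
    ‖P.c (R.x k)‖ ≤ ‖R.cb P k‖ + ε.c := by
  have h2 := S.noise.c_noise _ (S.staysIn k).1
  have h3 := norm_sub_norm_le (P.c (R.x k)) (P.cbar (R.x k))
  rw [norm_sub_rev] at h3
  unfold Run.cb
  linarith

theorem Run.Standing.norm_gb_le (S : R.Standing P X B p rule ε finf fsup) (k : ℕ) :
    ‖R.gb P k‖ ≤ B.κg + ε.g := by
  have h1 := S.smooth.g_bound _ (S.staysIn k).1
  have h2 := S.noise.g_noise _ (S.staysIn k).1
  have h3 := norm_sub_norm_le (P.gbar (R.x k)) (P.g (R.x k))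
  unfold Run.gb
  linarith

theorem Run.Standing.norm_Jcb_le_cb (S : R.Standing P X B p rule ε finf fsup) (k : ℕ) :
    ‖R.Jcb P k‖ ≤ (B.κJ + ε.J) * ‖R.cb P k‖ :=
  norm_adjoint_apply_le (S.norm_Jb_le k) _

theorem Run.Standing.norm_Jcb_le (S : R.Standing P X B p rule ε finf fsup) (k : ℕ) :
    ‖R.Jcb P k‖ ≤ (B.κJ + ε.J) * (B.κc + ε.c) :=
  (S.norm_Jcb_le_cb k).trans <| by
    have := (norm_nonneg _).trans (S.norm_Jb_le k)
    gcongr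
    exact S.norm_cb_le k

theorem Run.Standing.norm_v_le (S : R.Standing P X B p rule ε finf fsup) (hp : p.Admissible B)
    (k : ℕ) : ‖R.v k‖ ≤ p.σJc * ‖R.Jcb P k‖ := by
  rcases le_or_gt ‖R.cb P k‖ ε.o with h | h
  · rw [((S.run.direction k).1 h).1, norm_zero]
    have := hp.σJc_pos
    positivity
  · exact ((S.run.direction k).2 h).1.2.1

theorem Run.Standing.decrease (S : R.Standing P X B p rule ε finf fsup) (hB : B.Admissible)
    (hp : p.Admissible B) (hM : 0 < M) (hεM : ε.LE M) {k : ℕ} (hk : ε.o < ‖R.cb P k‖) :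
    normalDecrease B p M * ‖R.Jcb P k‖ ^ 2 ≤ ‖R.cb P k‖ * R.redv P k := by
  have := hB.κJ_pos
  exact ((S.run.direction k).2 hk).1.decrease hp.σJc_pos hp.γc_mem.1 (M := B.κJ + M)
    (by positivity) ((S.norm_Jb_le k).trans (by gcongr; exact hεM.2.2.2))

/-- Strictness comes from the absence of termination at infeasible stationary points, `J̄ᵀc̄ ≠ 0`.
-/
theorem Run.Standing.redv_pos (S : R.Standing P X B p rule ε finf fsup) (hB : B.Admissible)
    (hp : p.Admissible B) (hM : 0 < M) (hεM : ε.LE M) {k : ℕ} (hk : ε.o < ‖R.cb P k‖) :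
    0 < R.redv P k := by
  have h1 := S.decrease hB hp hM hεM hk
  have h2 := (S.noTermination k).2 hk
  have h3 := normalDecrease_pos hB hp hM
  have h4 : 0 < ‖R.cb P k‖ * R.redv P k := lt_of_lt_of_le (by positivity) h1
  exact pos_of_mul_pos_right h4 (norm_nonneg _)

theorem Run.curv_nonneg (hp : p.Admissible B) (k : ℕ) : 0 ≤ R.curv p k := by
  have := hp.lamu_mem.1
  exact le_max_of_le_right (by positivity)

theorem Run.dl_eq (k : ℕ) (τ : ℝ) :
    R.dl P k τ = -τ * inner ℝ (R.gb P k) (R.d k) + R.redr P k := by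
  unfold Run.dl Problem.deltal Run.redr Run.gb Run.cb Run.Jb Run.d
  rw [map_add, ← add_assoc]
  ring

/-- The model reduction condition holds for the updated merit parameter. -/
theorem Run.Standing.le_dl (S : R.Standing P X B p rule ε finf fsup) (hB : B.Admissible)
    (hp : p.Admissible B) (hM : 0 < M) (hεM : ε.LE M) (hτ : ∀ k, 0 < R.τ k) {k : ℕ}
    (hk : ε.o < ‖R.cb P k‖) :
    R.τ k * p.σu * R.curv p k + p.σc * R.redv P k ≤ R.dl P k (R.τ k) := by
  obtain ⟨-, ⟨-, -, htest⟩, hmod, hnmod⟩ := (S.run.direction k).2 hk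
  by_cases hmr : R.ModelReduction P p k (prev p.τ₀ R.τ k)
  · rw [hmod hmr]; exact hmr
  · obtain ⟨hr1, hr2⟩ := htest.resolve_left hmr
    have hτk := hnmod hmr
    have hpos := hτ k
    have hcurv := R.curv_nonneg hp k
    have hσc := hp.σc_mem.1
    have hσr := hσc.trans hp.σr_mem.1
    have hred : 0 ≤ R.redr P k := (hr2.trans_le hr1).le
    have hredv := S.redv_pos hB hp hM hεM hk
    have hM1 : R.τ k * p.σu * R.curv p k ≤ R.τ k * R.curv p k := by
      have := hp.σu_mem.2
      have := mul_le_mul_of_nonneg_left this.le (mul_nonneg hpos.le hcurv)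
      linarith
    rw [R.dl_eq]
    have hD : R.trialDen P p k = inner ℝ (R.gb P k) (R.d k) + R.curv p k := rfl
    -- With a nonpositive denominator, `-τ ḡᵀd̄ ≥ τ * curv` for every positive `τ`, so no reduction
    -- of the merit parameter is needed.
    rcases le_or_gt (R.trialDen P p k) 0 with h0 | h0
    · have h1 : R.τ k * R.trialDen P p k ≤ 0 := mul_nonpos_of_nonneg_of_nonpos hpos.le h0
      have h2 : p.σc * R.redv P k ≤ p.σr * R.redv P k := by
        have := hp.σr_mem.1
        gcongr
      rw [hD] at h1
      linarith
    · have hfrac : 0 ≤ 1 - p.σc / p.σr := by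
        rw [sub_nonneg, div_le_one hσr]; exact hp.σr_mem.1.le
      have htr : R.τ k ≤ R.τtrial P p k := by
        have hnn : 0 ≤ R.τtrial P p k := div_nonneg (mul_nonneg hfrac hred) h0.le
        have hle : R.τ k ≤ (1 - p.στ) * R.τtrial P p k := by
          rw [hτk, Run.τupdate]
          split_ifs with hc
          · exact hc.resolve_left (not_le.mpr h0)
          · exact le_rfl
        have := mul_nonneg hp.στ_mem.1.le hnn
        linarith
      -- The inequality `τ ≤ τtrial` spends the fraction `1 - σc / σr` of `redr` on the objective
      -- part. The remaining `σc / σr` fraction is at least `σc * redv`.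
      rw [Run.τtrial, le_div_iff₀ h0, hD] at htr
      have h3 : p.σc * R.redv P k ≤ p.σc / p.σr * R.redr P k := by
        calc p.σc * R.redv P k = p.σc / p.σr * (p.σr * R.redv P k) := by field_simp
          _ ≤ _ := by gcongr
      linarith

/-- Here `v = 0` and `τ` is unchanged, so the first termination test speaks about the actual model
reduction. The strict bound from nontermination later absorbs its slack `ε.o`. -/
theorem Run.Standing.small_dl (S : R.Standing P X B p rule ε finf fsup) {k : ℕ}
    (hk : ‖R.cb P k‖ ≤ ε.o) :
    R.τ k * p.σu * R.curv p k - ε.o ≤ R.dl P k (R.τ k) ∧ ε.o < R.dl P k (R.τ k) := by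
  obtain ⟨hv, hτ, ht⟩ := (S.run.direction k).1 hk
  refine ⟨?_, not_le.mp ((S.noTermination k).1 hk)⟩
  have := ht.2.2.2
  rw [← hτ] at this
  unfold Run.dl Run.d
  rwa [hv, zero_add]

theorem Run.Standing.τ_le_prev (S : R.Standing P X B p rule ε finf fsup) (k : ℕ) :
    R.τ k ≤ prev p.τ₀ R.τ k := by
  rcases le_or_gt ‖R.cb P k‖ ε.o with h | h
  · exact ((S.run.direction k).1 h).2.1.le
  · obtain ⟨-, -, hmod, hnmod⟩ := (S.run.direction k).2 h
    by_cases hmr : R.ModelReduction P p k (prev p.τ₀ R.τ k)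
    · exact (hmod hmr).le
    · rw [hnmod hmr, Run.τupdate]
      split_ifs with hc
      · exact le_rfl
      · push Not at hc
        exact hc.2.le

theorem Run.Standing.τ_le (S : R.Standing P X B p rule ε finf fsup) (k : ℕ) :
    R.τ k ≤ p.τ₀ := by
  induction k with
  | zero => exact S.τ_le_prev 0
  | succ k ih => exact (S.τ_le_prev (k + 1)).trans ih

theorem Run.Standing.dl_pos (S : R.Standing P X B p rule ε finf fsup) (hB : B.Admissible)
    (hp : p.Admissible B) (hε : ε.Admissible) (hM : 0 < M) (hεM : ε.LE M) (hτ : ∀ k, 0 < R.τ k)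
    (k : ℕ) : 0 < R.dl P k (R.τ k) := by
  rcases le_or_gt ‖R.cb P k‖ ε.o with h | h
  · exact hε.o_nonneg.trans_lt (S.small_dl h).2
  · refine lt_of_lt_of_le ?_ (S.le_dl hB hp hM hεM hτ h)
    have := S.redv_pos hB hp hM hεM h
    have := hp.σc_mem.1
    have := hp.σu_mem.1
    have := hτ k
    have := R.curv_nonneg hp k
    positivity

/-- The infeasible stationarity measure is bounded by the model reduction. -/
theorem Run.Standing.sq_norm_Jcb_le (S : R.Standing P X B p rule ε finf fsup)
    (hB : B.Admissible) (hp : p.Admissible B) (hε : ε.Admissible) (hM : 0 < M) (hεM : ε.LE M)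
    (hτ : ∀ k, 0 < R.τ k) (k : ℕ) :
    ‖R.Jcb P k‖ ^ 2 ≤
      (B.κc + ε.c) / (p.σc * normalDecrease B p M) * R.dl P k (R.τ k) := by
  have hσc := hp.σc_mem.1
  have hσv := normalDecrease_pos hB hp hM
  have hcb := S.norm_cb_le k
  have hcb0 := norm_nonneg (R.cb P k)
  have hdl := S.dl_pos hB hp hε hM hεM hτ k
  rw [div_mul_eq_mul_div, le_div_iff₀ (by positivity)]
  rcases le_or_gt ‖R.cb P k‖ ε.o with h | h
  -- There is no Cauchy decrease in this case; nontermination gives `‖c̄‖ ≤ ε.o < Δl` instead.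
  · have h1 : ‖R.cb P k‖ ≤ R.dl P k (R.τ k) := h.trans (S.small_dl h).2.le
    have hκJ : 0 < B.κJ + M := by have := hB.κJ_pos; positivity
    have h2 : ‖R.Jcb P k‖ ≤ (B.κJ + M) * ‖R.cb P k‖ :=
      (S.norm_Jcb_le_cb k).trans (by gcongr; exact hεM.2.2.2)
    -- The crude estimate `‖J̄ᵀc̄‖ ≤ (κJ + M)‖c̄‖` fits under the constant of the other case because
    -- of the minimum inside `normalDecrease`.
    have h3 : p.σc * normalDecrease B p M ≤ 1 / (B.κJ + M) ^ 2 := by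
      calc p.σc * normalDecrease B p M ≤ 1 * normalDecrease B p M := by
            gcongr; exact hp.σc_mem.2.le
        _ = p.γc / 2 * min p.σJc (1 / (B.κJ + M) ^ 2) := by rw [one_mul, normalDecrease]
        _ ≤ 1 * (1 / (B.κJ + M) ^ 2) := by
            have h4 := hp.γc_mem.2
            have h5 := hp.σJc_pos
            refine mul_le_mul (by linarith) (min_le_right _ _) (by positivity) zero_le_one
        _ = _ := one_mul _
    calc ‖R.Jcb P k‖ ^ 2 * (p.σc * normalDecrease B p M)
        ≤ ((B.κJ + M) * ‖R.cb P k‖) ^ 2 * (1 / (B.κJ + M) ^ 2) := by gcongr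
      _ = ‖R.cb P k‖ * ‖R.cb P k‖ := by field_simp
      _ ≤ (B.κc + ε.c) * R.dl P k (R.τ k) := by gcongr; exact hcb0.trans hcb
  · have h1 := S.decrease hB hp hM hεM h
    have h2 := S.le_dl hB hp hM hεM hτ h
    have h3 : 0 ≤ R.τ k * p.σu * R.curv p k := by
      have := hp.σu_mem.1
      have := hτ k
      have := R.curv_nonneg hp k
      positivity
    calc ‖R.Jcb P k‖ ^ 2 * (p.σc * normalDecrease B p M)
        = p.σc * (normalDecrease B p M * ‖R.Jcb P k‖ ^ 2) := by ring
      _ ≤ p.σc * (‖R.cb P k‖ * R.redv P k) := by gcongr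
      _ = ‖R.cb P k‖ * (p.σc * R.redv P k) := by ring
      _ ≤ ‖R.cb P k‖ * R.dl P k (R.τ k) := by gcongr; linarith
      _ ≤ _ := by gcongr

/-- The cap `M` replaces the actual noise, so that constants built from this ratio are uniform over
all runs. -/
theorem Run.Standing.sq_norm_Jcb_le' (S : R.Standing P X B p rule ε finf fsup)
    (hB : B.Admissible) (hp : p.Admissible B) (hε : ε.Admissible) (hM : 0 < M) (hεM : ε.LE M)
    (hτ : ∀ k, 0 < R.τ k) (k : ℕ) :
    ‖R.Jcb P k‖ ^ 2 ≤ stationarityRatio B p M * R.dl P k (R.τ k) := by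
  refine (S.sq_norm_Jcb_le hB hp hε hM hεM hτ k).trans ?_
  have hσc := hp.σc_mem.1
  have hσv := normalDecrease_pos hB hp hM
  have hdl := S.dl_pos hB hp hε hM hεM hτ k
  unfold stationarityRatio
  gcongr
  exact hεM.2.2.1

theorem Run.Standing.sq_norm_v_le (S : R.Standing P X B p rule ε finf fsup)
    (hB : B.Admissible) (hp : p.Admissible B) (hε : ε.Admissible) (hM : 0 < M) (hεM : ε.LE M)
    (hτ : ∀ k, 0 < R.τ k) (k : ℕ) :
    ‖R.v k‖ ^ 2 ≤ p.σJc ^ 2 * stationarityRatio B p M * R.dl P k (R.τ k) := by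
  have hσJc := hp.σJc_pos
  calc ‖R.v k‖ ^ 2 ≤ (p.σJc * ‖R.Jcb P k‖) ^ 2 := by gcongr; exact S.norm_v_le hp k
    _ = p.σJc ^ 2 * ‖R.Jcb P k‖ ^ 2 := by ring
    _ ≤ p.σJc ^ 2 * (stationarityRatio B p M * R.dl P k (R.τ k)) := by
        gcongr; exact S.sq_norm_Jcb_le' hB hp hε hM hεM hτ k
    _ = _ := by ring

/-- The `2` in `tangentialRatio` pays for the first termination test: the curvature term is at most
`Δl + ε.o`, and `ε.o < Δl`. -/
theorem Run.Standing.sq_norm_u_le (S : R.Standing P X B p rule ε finf fsup)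
    (hB : B.Admissible) (hp : p.Admissible B) (hM : 0 < M) (hεM : ε.LE M)
    (hτ0 : 0 < τmin) (hτ : ∀ k, τmin ≤ R.τ k) (k : ℕ) :
    ‖R.u k‖ ^ 2 ≤ tangentialRatio p τmin * R.dl P k (R.τ k) := by
  have hτp : ∀ k, 0 < R.τ k := fun k => hτ0.trans_le (hτ k)
  have hσu := hp.σu_mem.1
  have hlamu := hp.lamu_mem.1
  have hcurv : p.lamu * ‖R.u k‖ ^ 2 ≤ R.curv p k := le_max_right _ _
  have h0 : τmin * p.σu * p.lamu * ‖R.u k‖ ^ 2 ≤ R.τ k * p.σu * R.curv p k := by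
    calc τmin * p.σu * p.lamu * ‖R.u k‖ ^ 2 = τmin * p.σu * (p.lamu * ‖R.u k‖ ^ 2) := by ring
      _ ≤ R.τ k * p.σu * R.curv p k := by
          have := hτ k
          have := hτp k
          gcongr
  have h1 : R.τ k * p.σu * R.curv p k ≤ 2 * R.dl P k (R.τ k) := by
    rcases le_or_gt ‖R.cb P k‖ ε.o with h | h
    · have := S.small_dl h
      linarith
    · have h2 := S.le_dl hB hp hM hεM hτp h
      have h3 := mul_pos hp.σc_mem.1 (S.redv_pos hB hp hM hεM h)
      have h4 : 0 ≤ R.τ k * p.σu * R.curv p k :=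
        mul_nonneg (mul_pos (hτp k) hσu).le (R.curv_nonneg hp k)
      linarith
  unfold tangentialRatio
  rw [div_mul_eq_mul_div, le_div_iff₀ (by positivity)]
  linarith

/-- The model reduction is bounded below by the squared norm of the search direction. -/
theorem Run.Standing.modelConst_le (S : R.Standing P X B p rule ε finf fsup)
    (hB : B.Admissible) (hp : p.Admissible B) (hε : ε.Admissible) (hM : 0 < M) (hεM : ε.LE M)
    (hτ0 : 0 < τmin) (hτ : ∀ k, τmin ≤ R.τ k) (k : ℕ) :
    modelConst B p τmin M * ‖R.d k‖ ^ 2 ≤ R.dl P k (R.τ k) := by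
  have hτp : ∀ k, 0 < R.τ k := fun k => hτ0.trans_le (hτ k)
  have h1 := S.sq_norm_u_le hB hp hM hεM hτ0 hτ k
  have h2 := S.sq_norm_v_le hB hp hε hM hεM hτp k
  have h3 : ‖R.d k‖ ^ 2 ≤ 2 * ‖R.v k‖ ^ 2 + 2 * ‖R.u k‖ ^ 2 := by
    have := norm_add_le (R.v k) (R.u k)
    have h4 : ‖R.d k‖ ^ 2 ≤ (‖R.v k‖ + ‖R.u k‖) ^ 2 := by unfold Run.d; gcongr
    nlinarith [sq_nonneg (‖R.v k‖ - ‖R.u k‖)]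
  have h5 := stationarityRatio_pos hB hp hM
  have h6 := tangentialRatio_pos hp hτ0
  have h7 := hp.σJc_pos
  unfold modelConst
  rw [div_mul_eq_mul_div, one_mul, div_le_iff₀ (by positivity)]
  linarith

/-- The model reduction is positive but vanishes at the zero direction. This legitimizes the
divisions by `‖d‖²` in the adaptive rule. -/
theorem Run.Standing.norm_d_pos (S : R.Standing P X B p rule ε finf fsup)
    (hB : B.Admissible) (hp : p.Admissible B) (hε : ε.Admissible) (hM : 0 < M) (hεM : ε.LE M)
    (hτ : ∀ k, 0 < R.τ k) (k : ℕ) : 0 < ‖R.d k‖ := by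
  rw [norm_pos_iff]
  intro h
  have := S.dl_pos hB hp hε hM hεM hτ k
  unfold Run.dl at this
  rw [h] at this
  simp [Problem.deltal] at this

theorem Run.Standing.norm_v_le_bound (S : R.Standing P X B p rule ε finf fsup)
    (hB : B.Admissible) (hp : p.Admissible B) (hε : ε.Admissible) (hεM : ε.LE M) (k : ℕ) :
    ‖R.v k‖ ≤ normalBound B p M := by
  have h1 := hp.σJc_pos
  have h2 := hB.κJ_pos
  have h3 := hB.κc_pos
  have h4 := hε.J_nonneg
  have h5 := hε.c_nonneg
  refine (S.norm_v_le hp k).trans ?_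
  unfold normalBound
  gcongr
  refine (S.norm_Jcb_le k).trans ?_
  have h6 := hεM.2.2.2
  have h7 := hεM.2.2.1
  exact mul_le_mul (by linarith) (by linarith) (by linarith) (by linarith)

/-- For `t > 1` the constant `b` is at most `b t`, and one factor `t` cancels. -/
theorem le_of_sq_le_linear {a b c t : ℝ} (ha : 0 < a) (hb : 0 ≤ b) (hc : 0 ≤ c)
    (h : a * t ^ 2 ≤ b + c * t) : t ≤ 1 + (b + c) / a := by
  rcases le_or_gt t 1 with h1 | h1
  · have : 0 ≤ (b + c) / a := by positivity
    linarith
  · have h2 : t ≤ (b + c) / a := by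
      rw [le_div_iff₀ ha]
      refine le_of_mul_le_mul_left ?_ (zero_lt_one.trans h1)
      nlinarith
    linarith

theorem Run.Standing.norm_u_le_bound (S : R.Standing P X B p rule ε finf fsup)
    (hB : B.Admissible) (hp : p.Admissible B) (hε : ε.Admissible) (hM : 0 < M) (hεM : ε.LE M)
    (k : ℕ) : ‖R.u k‖ ≤ tangentialBound B p M := by
  have hv := S.norm_v_le_bound hB hp hε hεM k
  have hlamuv := hp.lamuv_pos
  have hlamv := hp.lamv_pos
  have hlamu := hp.lamu_mem.1
  have hκg := hB.κg_pos
  have hκH := hB.κH_pos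
  have hV := normalBound_pos hB hp hM
  have hg : ‖R.gb P k‖ ≤ B.κg + M := (S.norm_gb_le k).trans (by gcongr; exact hεM.2.1)
  have ho : ε.o ≤ M := hε.o_le_c.trans hεM.2.2.1
  set V := normalBound B p M with hVdef
  have hu0 := norm_nonneg (R.u k)
  -- Apart from the alternative `‖u‖ ≤ lamuv * ‖v‖`, each test combines a lower curvature bound with
  -- an upper bound on a quadratic model, which gives this inequality. The `2 * M` covers `ε.o + ε.o
  -- / 2` in the first test, and `lamv * V` the slack of the second.
  have hquad : p.lamu / 2 * ‖R.u k‖ ^ 2 ≤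
      (p.lamv * V + 2 * M) + (B.κg + M + B.κH * V) * ‖R.u k‖ →
      ‖R.u k‖ ≤ tangentialBound B p M := by
    intro h
    have := le_of_sq_le_linear (by positivity) (by positivity) (by positivity) h
    unfold tangentialBound
    rw [← hVdef]
    have : 0 ≤ p.lamuv * V := by positivity
    linarith
  rcases le_or_gt ‖R.cb P k‖ ε.o with h | h
  · obtain ⟨-, h1, h2, -⟩ := ((S.run.direction k).1 h).2.2
    apply hquad
    have h3 : -inner ℝ (R.gb P k) (R.u k) ≤ (B.κg + M) * ‖R.u k‖ := by
      rw [← inner_neg_left]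
      exact (real_inner_le_norm _ _).trans (by rw [norm_neg]; gcongr)
    have h4 : 0 ≤ B.κH * V * ‖R.u k‖ := by positivity
    have h5 : 0 ≤ p.lamv * V := by positivity
    linarith
  · obtain ⟨-, hc, -⟩ := ((S.run.direction k).2 h).2.1
    rcases hc with hc | ⟨h1, h2⟩
    · have h3 : 0 ≤ (p.lamv * V + 2 * M + (B.κg + M + B.κH * V)) / (p.lamu / 2) := by positivity
      calc ‖R.u k‖ ≤ p.lamuv * V := hc.trans (by gcongr)
        _ ≤ tangentialBound B p M := by
            unfold tangentialBound
            rw [← hVdef]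
            linarith
    · apply hquad
      have h3 : -inner ℝ (R.gb P k + R.H k (R.v k)) (R.u k) ≤
          (B.κg + M + B.κH * V) * ‖R.u k‖ := by
        rw [← inner_neg_left]
        refine (real_inner_le_norm _ _).trans ?_
        rw [norm_neg]
        gcongr
        refine (norm_add_le _ _).trans ?_
        gcongr
        exact (norm_apply_le (S.hessian.bound k) _).trans (by gcongr)
      have hpos : 0 ≤ R.uHu k := le_trans (by positivity) h1
      have h4 : 1 / 2 * R.uHu k ≤ max (1 / 2) (1 - ‖R.Jcb P k‖) * R.uHu k := by
        gcongr
        exact le_max_left _ _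
      have h5 : p.lamv * ‖R.v k‖ ≤ p.lamv * V := by gcongr
      linarith

theorem Run.Standing.norm_d_le (S : R.Standing P X B p rule ε finf fsup)
    (hB : B.Admissible) (hp : p.Admissible B) (hε : ε.Admissible) (hM : 0 < M) (hεM : ε.LE M)
    (k : ℕ) : ‖R.d k‖ ≤ normalBound B p M + tangentialBound B p M :=
  (norm_add_le _ _).trans (add_le_add (S.norm_v_le_bound hB hp hε hεM k)
    (S.norm_u_le_bound hB hp hε hM hεM k))

end Run

/-! ### Step sizes and decrease of the merit function -/

section Steps

variable {n m : ℕ} {P : Problem n m} {R : Run n m} {X : Set (Vec n)} {B : Bounds} {p : Params}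
  {rule : StepRule} {ε : Noise} {finf fsup τmin M : ℝ}

open Classical in
/-- The factor `τ` or `1` in the definitions of `ξtrial` and `αmin`. -/
def Run.weight (R : Run n m) (k : ℕ) : ℝ := if R.TangDominated k then R.τ k else 1

theorem Run.ξtrial_eq (k : ℕ) :
    R.ξtrial P k = R.dl P k (R.τ k) / (R.weight k * ‖R.d k‖ ^ 2) := by
  unfold Run.ξtrial Run.weight
  split_ifs <;> simp

theorem Run.αmin_eq (a : AdaptiveParams) (k : ℕ) :
    R.αmin B p a k = 2 * (1 - p.η) * a.β * R.ξ k * R.weight k / (R.τ k * B.L + B.Γ) := by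
  unfold Run.αmin Run.weight
  split_ifs <;> simp

theorem Run.min_le_weight {k : ℕ} (hτ : τmin ≤ R.τ k) : min τmin 1 ≤ R.weight k := by
  unfold Run.weight
  split_ifs
  · exact (min_le_left _ _).trans hτ
  · exact min_le_right _ _

theorem Run.Standing.weight_le (S : R.Standing P X B p rule ε finf fsup) (k : ℕ) :
    R.weight k ≤ max p.τ₀ 1 := by
  unfold Run.weight
  split_ifs
  · exact (S.τ_le k).trans (le_max_left _ _)
  · exact le_max_right _ _

/-- The weight over the step size denominator is controlled by the bounds on the merit
parameter. -/
theorem Run.Standing.weight_div_le (S : R.Standing P X B p rule ε finf fsup)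
    (hB : B.Admissible) (hτ0 : 0 < τmin) (hτ : ∀ k, τmin ≤ R.τ k) (k : ℕ) :
    R.weight k / (R.τ k * B.L + B.Γ) ≤ max p.τ₀ 1 / (τmin * B.L + B.Γ) := by
  have h1 := stepDen_pos hB hτ0
  have h2 : τmin * B.L + B.Γ ≤ R.τ k * B.L + B.Γ := by
    have := hB.L_pos
    have := hτ k
    gcongr
  exact div_le_div₀ (le_max_of_le_right zero_le_one) (S.weight_le k) h1 h2

/-! ### The adaptive step size -/

section Adaptive

variable {a : AdaptiveParams}

theorem Run.Standing.ξ_le_ξtrial (S : R.Standing P X B p (.adaptive a) ε finf fsup)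
    (k : ℕ) : R.ξ k ≤ R.ξtrial P k := by
  obtain ⟨-, -, h1, h2, -⟩ := S.run.stepSize k
  rcases le_or_gt (prev a.ξ₀ R.ξ k) (R.ξtrial P k) with h | h
  · rw [h1 h]; exact h
  · rw [h2 h]; exact min_le_right _ _

/-- The trial ratios are uniformly bounded below whatever the history of `χ` and `ζ`, because these
affect only the weight, which is at most `max τ₀ 1`. -/
theorem Run.Standing.le_ξtrial (S : R.Standing P X B p (.adaptive a) ε finf fsup)
    (hB : B.Admissible) (hp : p.Admissible B) (hε : ε.Admissible) (hM : 0 < M) (hεM : ε.LE M)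
    (hτ0 : 0 < τmin) (hτ : ∀ k, τmin ≤ R.τ k) (k : ℕ) :
    modelConst B p τmin M / max p.τ₀ 1 ≤ R.ξtrial P k := by
  have hτp : ∀ k, 0 < R.τ k := fun k => hτ0.trans_le (hτ k)
  have h1 := S.modelConst_le hB hp hε hM hεM hτ0 hτ k
  have h2 := S.norm_d_pos hB hp hε hM hεM hτp k
  have h3 := S.weight_le k
  have h4 : 0 < R.weight k := lt_of_lt_of_le (by positivity) (R.min_le_weight (hτ k))
  have h5 := modelConst_pos hB hp hτ0 hM
  rw [R.ξtrial_eq, div_le_div_iff₀ (by positivity) (by positivity)]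
  calc modelConst B p τmin M * (R.weight k * ‖R.d k‖ ^ 2)
      = R.weight k * (modelConst B p τmin M * ‖R.d k‖ ^ 2) := by ring
    _ ≤ max p.τ₀ 1 * R.dl P k (R.τ k) := by gcongr
    _ = _ := mul_comm _ _

/-- A reduction happens only while the previous value exceeds the trial ratio, hence its uniform
lower bound. A reduction therefore undershoots that bound by at most the factor `1 - σξ`. -/
theorem Run.Standing.ξ_mem (S : R.Standing P X B p (.adaptive a) ε finf fsup)
    (hB : B.Admissible) (hp : p.Admissible B) (ha : (StepRule.adaptive a).Admissible B p τmin)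
    (hε : ε.Admissible) (hM : 0 < M) (hεM : ε.LE M)
    (hτ0 : 0 < τmin) (hτ : ∀ k, τmin ≤ R.τ k) (k : ℕ) :
    R.ξ k ∈ Set.Icc (ratioLow B p τmin M a) a.ξ₀ := by
  have hσ := ha.2.2.2.2.2.2.2.2.1
  have hmc : 0 < modelConst B p τmin M / max p.τ₀ 1 :=
    div_pos (modelConst_pos hB hp hτ0 hM) (lt_max_of_lt_right one_pos)
  have step : ∀ k, prev a.ξ₀ R.ξ k ∈ Set.Icc (ratioLow B p τmin M a) a.ξ₀ →
      R.ξ k ∈ Set.Icc (ratioLow B p τmin M a) a.ξ₀ := by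
    intro k hk
    obtain ⟨-, -, h1, h2, -⟩ := S.run.stepSize k
    have h3 := S.le_ξtrial hB hp hε hM hεM hτ0 hτ k
    rcases le_or_gt (prev a.ξ₀ R.ξ k) (R.ξtrial P k) with h | h
    · rw [h1 h]; exact hk
    · have hσ1 := sub_pos.mpr hσ.2
      have h4 : ratioLow B p τmin M a ≤ (1 - a.σξ) * (modelConst B p τmin M / max p.τ₀ 1) :=
        min_le_right _ _
      constructor
      · rw [h2 h]
        refine le_min (h4.trans ?_) (h4.trans ?_)
        · gcongr
          exact h3.trans h.le
        · have := mul_pos hσ.1 hmc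
          linarith
      · rw [h2 h]
        exact (min_le_right _ _).trans (h.le.trans hk.2)
  induction k with
  | zero => exact step 0 ⟨min_le_left _ _, le_rfl⟩
  | succ k ih => exact step (k + 1) ih

/-- The two entries of the minimum use different facts: the quotient dominates because `ξ ≤ ξtrial`,
and the entry `1` because of the restriction on `β` together with `ξ ≤ ξ₀`. -/
theorem Run.Standing.αmin_le_αsuff (S : R.Standing P X B p (.adaptive a) ε finf fsup)
    (hB : B.Admissible) (hp : p.Admissible B) (ha : (StepRule.adaptive a).Admissible B p τmin)
    (hε : ε.Admissible) (hM : 0 < M) (hεM : ε.LE M)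
    (hτ0 : 0 < τmin) (hτ : ∀ k, τmin ≤ R.τ k) (k : ℕ) :
    R.αmin B p a k ≤ R.αsuff P B p a k := by
  have hτp : ∀ k, 0 < R.τ k := fun k => hτ0.trans_le (hτ k)
  have hd := S.norm_d_pos hB hp hε hM hεM hτp k
  have hw : 0 < R.weight k := lt_of_lt_of_le (by positivity) (R.min_le_weight (hτ k))
  have hη := sub_pos.mpr hp.η_mem.2
  have hβ := ha.2.1.1
  have hden := stepDen_pos hB (hτp k)
  have hξ := S.ξ_mem hB hp ha hε hM hεM hτ0 hτ k
  have hξ0 := ha.2.2.2.2.2.1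
  rw [R.αmin_eq]
  refine le_min ?_ ?_
  · have h1 := S.ξ_le_ξtrial k
    rw [R.ξtrial_eq, le_div_iff₀ (by positivity)] at h1
    rw [div_le_div_iff₀ hden (by positivity)]
    calc 2 * (1 - p.η) * a.β * R.ξ k * R.weight k * ((R.τ k * B.L + B.Γ) * ‖R.d k‖ ^ 2)
        = 2 * (1 - p.η) * a.β * (R.τ k * B.L + B.Γ) * (R.ξ k * (R.weight k * ‖R.d k‖ ^ 2)) := by
          ring
      _ ≤ 2 * (1 - p.η) * a.β * (R.τ k * B.L + B.Γ) * R.dl P k (R.τ k) := by gcongr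
      _ = _ := by ring
  · refine le_trans ?_ ha.2.2.2.2.2.2.2.2.2
    have h2 := S.weight_div_le hB hτ0 hτ k
    calc 2 * (1 - p.η) * a.β * R.ξ k * R.weight k / (R.τ k * B.L + B.Γ)
        = 2 * (1 - p.η) * a.β * R.ξ k * (R.weight k / (R.τ k * B.L + B.Γ)) := by ring
      _ ≤ 2 * (1 - p.η) * a.β * a.ξ₀ * (max p.τ₀ 1 / (τmin * B.L + B.Γ)) := by
          gcongr
          exact hξ.2
      _ = _ := by ring

/-- Since `αmin ≤ αsuff`, the projection can only shorten `αsuff`, so the accepted step keeps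
sufficient decrease. -/
theorem Run.Standing.α_mem_adaptive (S : R.Standing P X B p (.adaptive a) ε finf fsup)
    (hB : B.Admissible) (hp : p.Admissible B) (ha : (StepRule.adaptive a).Admissible B p τmin)
    (hε : ε.Admissible) (hM : 0 < M) (hεM : ε.LE M)
    (hτ0 : 0 < τmin) (hτ : ∀ k, τmin ≤ R.τ k) (k : ℕ) :
    stepLow B p τmin M (.adaptive a) ≤ R.α k ∧ R.α k ≤ R.αsuff P B p a k ∧
      R.α k ≤ alphaUp B p (.adaptive a) := by
  have hτp : ∀ k, 0 < R.τ k := fun k => hτ0.trans_le (hτ k)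
  have hw : 0 < R.weight k := lt_of_lt_of_le (by positivity) (R.min_le_weight (hτ k))
  have hη := sub_pos.mpr hp.η_mem.2
  have hβ := ha.2.1.1
  have hθ := ha.2.2.1
  have hden := stepDen_pos hB (hτp k)
  have hξ := S.ξ_mem hB hp ha hε hM hεM hτ0 hτ k
  have hξ0 := ha.2.2.2.2.2.1
  have hlow := ratioLow_pos hB hp hτ0 hM ha
  have hξp := hlow.trans_le hξ.1
  have hα : R.α k = _ := (S.run.stepSize k).2.2.2.2
  refine ⟨?_, ?_, ?_⟩
  · rw [hα]
    refine le_trans ?_ (le_max_left _ _)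
    rw [R.αmin_eq]
    refine div_le_div₀ (by positivity) ?_ hden ?_
    · have h1 := hξ.1
      have h2 := R.min_le_weight (hτ k)
      gcongr
    -- The denominator is estimated by its value at `τ₀`; this is why `stepLow` has `τ₀` where
    -- `alphaLow` has `τmin`.
    · have h1 := S.τ_le k
      have h2 := hB.L_pos
      gcongr
  · rw [hα]
    exact max_le (S.αmin_le_αsuff hB hp ha hε hM hεM hτ0 hτ k) (min_le_left _ _)
  · have h1 : R.α k ≤ R.αmax B p a k := by
      rw [hα]
      refine max_le ?_ (min_le_right _ _)
      unfold Run.αmax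
      have := mul_pos hθ hβ
      linarith
    refine h1.trans ?_
    unfold Run.αmax alphaUp
    rw [R.αmin_eq]
    have hΓ := ha.1
    have h3 : R.weight k / (R.τ k * B.L + B.Γ) ≤ max p.τ₀ 1 / B.Γ := by
      refine div_le_div₀ (le_max_of_le_right zero_le_one) (S.weight_le k) hΓ ?_
      have := mul_pos (hτp k) hB.L_pos
      linarith
    calc 2 * (1 - p.η) * a.β * R.ξ k * R.weight k / (R.τ k * B.L + B.Γ) + a.θ * a.β
        = 2 * (1 - p.η) * a.β * R.ξ k * (R.weight k / (R.τ k * B.L + B.Γ)) + a.θ * a.β := by ring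
      _ ≤ 2 * (1 - p.η) * a.β * a.ξ₀ * (max p.τ₀ 1 / B.Γ) + a.θ * a.β := by
          gcongr
          exact hξ.2
      _ = _ := by ring

end Adaptive

/-- The relaxation `εA` pays exactly for the noise: comparing noisy and true merit functions at both
endpoints costs `2 τ ε.f + 2 ε.c`, and the Taylor estimate at most another `2 ε.c` and the gradient
and Jacobian terms. It remains to fit the Lipschitz term into `(1 - η) α Δl`, which holds for short
steps as `Δl` dominates `‖d‖²`. -/
theorem Run.Standing.armijo_of_le {l : LineSearchParams}
    (S : R.Standing P X B p (.lineSearch l) ε finf fsup)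
    (hB : B.Admissible) (hp : p.Admissible B) (hl : (StepRule.lineSearch l).Admissible B p τmin)
    (hε : ε.Admissible) (hM : 0 < M) (hεM : ε.LE M)
    (hτ0 : 0 < τmin) (hτ : ∀ k, τmin ≤ R.τ k) (k : ℕ) {α : ℝ} (hα0 : 0 ≤ α) (hαu : α ≤ l.αu)
    (hα : α ≤ (1 - p.η) * modelConst B p τmin M / (p.τ₀ * B.L + B.Γ)) :
    R.Armijo P p ε l k α := by
  have hτp : 0 < R.τ k := hτ0.trans_le (hτ k)
  have hα1 : α ∈ Set.Icc (0 : ℝ) 1 := ⟨hα0, hαu.trans hl.1.2⟩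
  obtain ⟨hx, hxd⟩ := S.staysIn k
  have hL := hB.L_pos
  have h1 := S.smooth.phi_le S.noise hx hxd hα1 hτp.le
  have h2 := (abs_le.mp (S.noise.abs_phibar_sub_phi_le hx hτp.le)).1
  have h3 := (abs_le.mp (S.noise.abs_phibar_sub_phi_le
    (S.smooth.convex.add_smul_mem hx hxd hα1) hτp.le)).2
  have h4 := S.modelConst_le hB hp hε hM hεM hτ0 hτ k
  have hη := sub_pos.mpr hp.η_mem.2
  have h5 : (R.τ k * B.L + B.Γ) / 2 * α ^ 2 * ‖R.d k‖ ^ 2 ≤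
      α * ((1 - p.η) * R.dl P k (R.τ k)) := by
    rw [le_div_iff₀ (stepDen_pos hB hp.τ₀_pos)] at hα
    have hden := stepDen_pos hB hτp
    have e1 : (R.τ k * B.L + B.Γ) * α ≤ (1 - p.η) * modelConst B p τmin M := by
      refine le_trans ?_ hα
      rw [mul_comm]
      gcongr
      exact S.τ_le k
    calc (R.τ k * B.L + B.Γ) / 2 * α ^ 2 * ‖R.d k‖ ^ 2
        = α * (1 / 2 * ((R.τ k * B.L + B.Γ) * α) * ‖R.d k‖ ^ 2) := by ring
      _ ≤ α * (1 * ((1 - p.η) * modelConst B p τmin M) * ‖R.d k‖ ^ 2) := by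
          have : 0 ≤ (R.τ k * B.L + B.Γ) * α := by positivity
          gcongr
          norm_num
      _ = α * ((1 - p.η) * (modelConst B p τmin M * ‖R.d k‖ ^ 2)) := by ring
      _ ≤ _ := by gcongr
  have h6 : α * (R.τ k * ε.g * ‖R.d k‖) ≤ R.τ k * l.αu * ε.g * ‖R.d k‖ := by
    have := hε.g_nonneg
    calc α * (R.τ k * ε.g * ‖R.d k‖) ≤ l.αu * (R.τ k * ε.g * ‖R.d k‖) := by gcongr
      _ = _ := by ring
  have h7 : α * (ε.J * ‖R.d k‖) ≤ l.αu * ε.J * ‖R.d k‖ := by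
    have := hε.J_nonneg
    calc α * (ε.J * ‖R.d k‖) ≤ l.αu * (ε.J * ‖R.d k‖) := by gcongr
      _ = _ := by ring
  have h8 : α * (2 * ε.c) ≤ 1 * (2 * ε.c) := by
    have := hε.c_nonneg
    gcongr
    exact hα1.2
  unfold Run.Armijo Run.εA
  change _ ≤ _ - α * R.dl P k (R.τ k) + _ + _ at h1
  linarith

/-- After at least one backtrack, the last rejected step must exceed the threshold of
`armijo_of_le`; accepting the next one loses a single factor `ν`. -/
theorem Run.Standing.stepLow_le_lineSearch {l : LineSearchParams}
    (S : R.Standing P X B p (.lineSearch l) ε finf fsup)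
    (hB : B.Admissible) (hp : p.Admissible B) (hl : (StepRule.lineSearch l).Admissible B p τmin)
    (hε : ε.Admissible) (hM : 0 < M) (hεM : ε.LE M)
    (hτ0 : 0 < τmin) (hτ : ∀ k, τmin ≤ R.τ k) (k : ℕ) :
    stepLow B p τmin M (.lineSearch l) ≤ R.α k := by
  obtain ⟨j, hj, -, hlt⟩ := S.run.stepSize k
  have hν := hl.2
  have hαu := hl.1.1
  rw [hj]
  cases j with
  | zero => rw [pow_zero, one_mul]; exact min_le_left _ _
  | succ i =>
    refine (min_le_right _ _).trans ?_
    by_contra! hc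
    refine hlt i (Nat.lt_succ_self i) (S.armijo_of_le hB hp hl hε hM hεM hτ0 hτ k ?_ ?_ ?_)
    · have := hν.1
      positivity
    · exact mul_le_of_le_one_left hαu.le (pow_le_one₀ hν.1.le hν.2.le)
    · refine le_of_mul_le_mul_left ?_ hν.1
      calc l.ν * (l.ν ^ i * l.αu) = l.ν ^ (i + 1) * l.αu := by ring
        _ ≤ l.ν * (1 - p.η) * modelConst B p τmin M / (p.τ₀ * B.L + B.Γ) := hc.le
        _ = _ := by ring

theorem Run.Standing.stepLow_le (S : R.Standing P X B p rule ε finf fsup)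
    (hB : B.Admissible) (hp : p.Admissible B) (hr : rule.Admissible B p τmin)
    (hε : ε.Admissible) (hM : 0 < M) (hεM : ε.LE M)
    (hτ0 : 0 < τmin) (hτ : ∀ k, τmin ≤ R.τ k) (k : ℕ) :
    stepLow B p τmin M rule ≤ R.α k := by
  cases rule with
  | adaptive a => exact (S.α_mem_adaptive hB hp hr hε hM hεM hτ0 hτ k).1
  | lineSearch l => exact S.stepLow_le_lineSearch hB hp hr hε hM hεM hτ0 hτ k

/-- Decrease of the true merit function in one iteration. -/
theorem Run.Standing.phi_succ_le (S : R.Standing P X B p rule ε finf fsup)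
    (hB : B.Admissible) (hp : p.Admissible B) (hr : rule.Admissible B p τmin)
    (hε : ε.Admissible) (hM : 0 < M) (hεM : ε.LE M)
    (hτ0 : 0 < τmin) (hτ : ∀ k, τmin ≤ R.τ k) {K : Consts} (hK : ∀ k, ‖R.d k‖ ≤ K.κd) (k : ℕ) :
    P.phi (R.x (k + 1)) (R.τ k) ≤
      P.phi (R.x k) (R.τ k) - p.η * R.α k * R.dl P k (R.τ k) + meritError B p ε K rule := by
  have hτp : 0 < R.τ k := hτ0.trans_le (hτ k)
  obtain ⟨hx, hxd⟩ := S.staysIn k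
  have hx' := (S.staysIn (k + 1)).1
  have hlow := S.stepLow_le hB hp hr hε hM hεM hτ0 hτ k
  have hα0 : 0 < R.α k := (stepLow_pos hB hp hτ0 hM hr).trans_le hlow
  have hg := hε.g_nonneg
  have hJ := hε.J_nonneg
  have hc := hε.c_nonneg
  have hf := hε.f_nonneg
  have hd := hK k
  have hd0 := norm_nonneg (R.d k)
  have hτ1 := S.τ_le k
  have hdl := S.dl_pos hB hp hε hM hεM (fun k => hτ0.trans_le (hτ k)) k
  have hτ₀ := hp.τ₀_pos
  have hη := sub_pos.mpr hp.η_mem.2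
  cases rule with
  | adaptive a =>
    obtain ⟨-, hsuff, hup⟩ := S.α_mem_adaptive hB hp hr hε hM hεM hτ0 hτ k
    have hα1 : R.α k ≤ 1 := hsuff.trans (min_le_right _ _)
    have h1 := S.smooth.phi_le S.noise hx hxd ⟨hα0.le, hα1⟩ hτp.le
    rw [← S.run.update] at h1
    have hdp := S.norm_d_pos hB hp hε hM hεM (fun k => hτ0.trans_le (hτ k)) k
    -- The bound `α ≤ αsuff` with `β ≤ 1` is exactly what keeps the Lipschitz term below `(1 - η) α
    -- Δl`.
    have h2 : (R.τ k * B.L + B.Γ) / 2 * R.α k ^ 2 * ‖R.d k‖ ^ 2 ≤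
        R.α k * ((1 - p.η) * R.dl P k (R.τ k)) := by
      have hden := stepDen_pos hB hτp
      have e1 := hsuff.trans (min_le_left _ _)
      rw [le_div_iff₀ (by positivity)] at e1
      have e2 : 2 * (1 - p.η) * a.β * R.dl P k (R.τ k) ≤
          2 * (1 - p.η) * 1 * R.dl P k (R.τ k) := by
        gcongr
        exact hr.2.1.2
      have e3 := mul_le_mul_of_nonneg_left (e1.trans e2) hα0.le
      linarith
    have h3 : R.α k * (R.τ k * ε.g * ‖R.d k‖) ≤
        alphaUp B p (.adaptive a) * p.τ₀ * K.κd * ε.g := by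
      have : 0 ≤ alphaUp B p (.adaptive a) := hα0.le.trans hup
      calc R.α k * (R.τ k * ε.g * ‖R.d k‖)
          ≤ alphaUp B p (.adaptive a) * (p.τ₀ * ε.g * K.κd) := by gcongr
        _ = _ := by ring
    have h4 : R.α k * (ε.J * ‖R.d k‖) ≤ alphaUp B p (.adaptive a) * K.κd * ε.J := by
      have : 0 ≤ alphaUp B p (.adaptive a) := hα0.le.trans hup
      calc R.α k * (ε.J * ‖R.d k‖) ≤ alphaUp B p (.adaptive a) * (ε.J * K.κd) := by gcongr
        _ = _ := by ring
    have h5 : R.α k * (2 * ε.c) ≤ 1 * (2 * ε.c) := by gcongr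
    unfold meritError
    change _ ≤ _ - R.α k * R.dl P k (R.τ k) + _ + _ at h1
    dsimp only
    linarith
  | lineSearch l =>
    obtain ⟨j, hj, harm, -⟩ := S.run.stepSize k
    rw [← hj] at harm
    unfold Run.Armijo Run.εA at harm
    rw [← S.run.update] at harm
    -- The Armijo condition concerns the noisy merit function. Returning to the true one at both
    -- endpoints costs another `2 (τ ε.f + ε.c)`, hence the coefficients `4` and `6` in
    -- `meritError`.
    have h2 := (abs_le.mp (S.noise.abs_phibar_sub_phi_le hx hτp.le)).2
    have h3 := (abs_le.mp (S.noise.abs_phibar_sub_phi_le hx' hτp.le)).1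
    have hαu : 0 < l.αu := hr.1.1
    have h4 : R.τ k * ε.f ≤ p.τ₀ * ε.f := by gcongr
    have h5 : R.τ k * l.αu * ε.g * ‖R.d k‖ ≤ p.τ₀ * l.αu * K.κd * ε.g := by
      calc R.τ k * l.αu * ε.g * ‖R.d k‖ ≤ p.τ₀ * l.αu * ε.g * K.κd := by gcongr
        _ = _ := by ring
    have h6 : l.αu * ε.J * ‖R.d k‖ ≤ l.αu * K.κd * ε.J := by
      calc l.αu * ε.J * ‖R.d k‖ ≤ l.αu * ε.J * K.κd := by gcongr
        _ = _ := by ring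
    unfold meritError alphaUp
    dsimp only
    linarith

/-- Only `τ k ∈ (0, τ₀]` is used: `τ k * finf` is smallest near `τ = 0` or at `τ₀`, depending on the
sign of `finf`, hence the minimum with `0`. -/
theorem Run.Standing.phi_lower (S : R.Standing P X B p rule ε finf fsup)
    (hτ0 : 0 < τmin) (hτ : ∀ k, τmin ≤ R.τ k) (k : ℕ) :
    min 0 (p.τ₀ * finf) ≤ P.phi (R.x k) (R.τ k) := by
  have hτp : 0 < R.τ k := hτ0.trans_le (hτ k)
  have h1 := mul_le_mul_of_nonneg_left (S.smooth.f_lower _ (S.staysIn k).1) hτp.le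
  have h2 := norm_nonneg (P.c (R.x k))
  have h3 : min 0 (p.τ₀ * finf) ≤ R.τ k * finf := by
    rcases le_or_gt 0 finf with h | h
    · exact (min_le_left _ _).trans (by positivity)
    · exact (min_le_right _ _).trans (mul_le_mul_of_nonpos_right (S.τ_le k) h.le)
  unfold Problem.phi
  linarith

theorem Run.Standing.gap_nonneg (S : R.Standing P X B p rule ε finf fsup)
    (hp : p.Admissible B) (hτ0 : 0 < τmin) (hτ : ∀ k, τmin ≤ R.τ k) :
    0 ≤ gap P R p finf := by
  have h1 := S.phi_lower hτ0 hτ 0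
  have h2 := mul_nonneg hp.τ₀_pos.le (abs_nonneg finf)
  unfold gap
  linarith

/-- The model reductions are summable up to the accumulated merit errors. -/
theorem Run.Standing.sum_dl_le (S : R.Standing P X B p rule ε finf fsup)
    (hB : B.Admissible) (hp : p.Admissible B) (hr : rule.Admissible B p τmin)
    (hε : ε.Admissible) (hM : 0 < M) (hεM : ε.LE M)
    (hτ0 : 0 < τmin) (hτ : ∀ k, τmin ≤ R.τ k) {K : Consts} (hK : ∀ k, ‖R.d k‖ ≤ K.κd) (k : ℕ) :
    p.η * stepLow B p τmin M rule * ∑ j ∈ Finset.range k, R.dl P j (R.τ j) ≤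
      gap P R p finf + k * meritError B p ε K rule := by
  -- The induction must carry the changing merit parameter. Where `f` is negative, lowering `τ`
  -- raises the merit function, by at most `|finf|` times the decrease of `τ`, and these increases
  -- telescope.
  have key : ∀ k : ℕ, p.η * stepLow B p τmin M rule * ∑ j ∈ Finset.range k, R.dl P j (R.τ j) ≤
      P.phi (R.x 0) (R.τ 0) - P.phi (R.x k) (R.τ k) + (R.τ 0 - R.τ k) * |finf| +
        k * meritError B p ε K rule := by
    intro k
    induction k with
    | zero => simp
    | succ k ih =>
      have h1 := S.phi_succ_le hB hp hr hε hM hεM hτ0 hτ hK k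
      have h2 : p.η * stepLow B p τmin M rule * R.dl P k (R.τ k) ≤
          p.η * R.α k * R.dl P k (R.τ k) := by
        have := S.dl_pos hB hp hε hM hεM (fun k => hτ0.trans_le (hτ k)) k
        have := hp.η_mem.1
        gcongr
        exact S.stepLow_le hB hp hr hε hM hεM hτ0 hτ k
      have h3 : P.phi (R.x (k + 1)) (R.τ (k + 1)) ≤
          P.phi (R.x (k + 1)) (R.τ k) + (R.τ k - R.τ (k + 1)) * |finf| := by
        have e1 : 0 ≤ R.τ k - R.τ (k + 1) := sub_nonneg.mpr (S.τ_le_prev (k + 1))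
        have e2 : -|finf| ≤ P.f (R.x (k + 1)) :=
          (neg_abs_le finf).trans (S.smooth.f_lower _ (S.staysIn (k + 1)).1)
        have e3 := mul_le_mul_of_nonneg_left e2 e1
        unfold Problem.phi
        linarith
      rw [Finset.sum_range_succ]
      push_cast
      linarith
  refine (key k).trans ?_
  have h1 := S.phi_lower hτ0 hτ k
  have h2 : (R.τ 0 - R.τ k) * |finf| ≤ p.τ₀ * |finf| := by
    have := S.τ_le 0
    have := hτ k
    gcongr
    linarith
  unfold gap
  linarith

end Steps

/-! ### Averages and error bounds -/

section Averages

variable {n m : ℕ} {P : Problem n m} {R : Run n m} {X : Set (Vec n)} {B : Bounds} {p : Params}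
  {rule : StepRule} {ε : Noise} {finf fsup τmin M κσ : ℝ}

/-- Averages of quantities that are bounded by the model reduction up to a constant error. -/
theorem Run.Standing.avg_le (S : R.Standing P X B p rule ε finf fsup)
    (hB : B.Admissible) (hp : p.Admissible B) (hr : rule.Admissible B p τmin)
    (hε : ε.Admissible) (hM : 0 < M) (hεM : ε.LE M)
    (hτ0 : 0 < τmin) (hτ : ∀ k, τmin ≤ R.τ k) {K : Consts} (hK : ∀ k, ‖R.d k‖ ≤ K.κd)
    {b : ℕ → ℝ} {A T e : ℝ} (hT : 0 ≤ T) (hb : ∀ j, b j ≤ A * R.dl P j (R.τ j) + e)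
    (hA : A ≤ T * (p.η * stepLow B p τmin M rule)) (k : ℕ) :
    avg b k ≤ T * (gap P R p finf / ((k : ℝ) + 1)) + T * meritError B p ε K rule + e := by
  have h1 := S.sum_dl_le hB hp hr hε hM hεM hτ0 hτ hK (k + 1)
  have h2 : ∑ j ∈ Finset.range (k + 1), b j ≤
      T * (gap P R p finf + (k + 1) * meritError B p ε K rule) + (k + 1) * e := by
    calc ∑ j ∈ Finset.range (k + 1), b j
        ≤ ∑ j ∈ Finset.range (k + 1), (A * R.dl P j (R.τ j) + e) :=
          Finset.sum_le_sum fun j _ => hb j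
      _ = A * ∑ j ∈ Finset.range (k + 1), R.dl P j (R.τ j) + (k + 1) * e := by
          rw [Finset.sum_add_distrib, ← Finset.mul_sum]; simp
      _ ≤ T * (p.η * stepLow B p τmin M rule) * ∑ j ∈ Finset.range (k + 1), R.dl P j (R.τ j) +
            (k + 1) * e := by
          have : 0 ≤ ∑ j ∈ Finset.range (k + 1), R.dl P j (R.τ j) := Finset.sum_nonneg fun j _ =>
            (S.dl_pos hB hp hε hM hεM (fun k => hτ0.trans_le (hτ k)) j).le
          gcongr
      _ = T * (p.η * stepLow B p τmin M rule * ∑ j ∈ Finset.range (k + 1), R.dl P j (R.τ j)) +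
            (k + 1) * e := by ring
      _ ≤ _ := by
          push_cast at h1
          gcongr
  unfold avg
  have hk : (0 : ℝ) < k + 1 := by positivity
  rw [one_div, inv_mul_le_iff₀ hk]
  refine h2.trans (le_of_eq ?_)
  field_simp

/-- The difference of squares factors. Its first factor is bounded by splitting the perturbation
into `J̄ᵀ(c̄ - c)` and `(J̄ - J)ᵀ c`, its second by the sizes of the two vectors; this is the first
entry of the maximum in `errJc2`. -/
theorem Run.Standing.sq_norm_Jc_le (S : R.Standing P X B p rule ε finf fsup)
    (hB : B.Admissible) (hε : ε.Admissible) (k : ℕ) :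
    ‖R.Jc P k‖ ^ 2 ≤ ‖R.Jcb P k‖ ^ 2 + errJc2 B ε := by
  have hx := (S.staysIn k).1
  have hκJ := hB.κJ_pos
  have hκc := hB.κc_pos
  have hJ := hε.J_nonneg
  have hc := hε.c_nonneg
  have h1 : ‖R.Jc P k‖ ≤ B.κJ * B.κc :=
    (norm_adjoint_apply_le (S.smooth.J_bound _ hx) _).trans (by
      gcongr; exact S.smooth.c_bound _ hx)
  have h2 := S.norm_Jcb_le k
  have h3 : ‖R.Jc P k - R.Jcb P k‖ ≤ (B.κJ + ε.J) * ε.c + B.κc * ε.J := by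
    have e1 : R.Jc P k - R.Jcb P k = -((R.Jb P k)†) (R.cb P k - P.c (R.x k)) -
        ((R.Jb P k - R.J P k)†) (P.c (R.x k)) := by
      unfold Run.Jc Run.Jcb
      rw [map_sub, map_sub, sub_apply]
      abel
    rw [e1]
    calc _ ≤ ‖((R.Jb P k)†) (R.cb P k - P.c (R.x k))‖ +
          ‖((R.Jb P k - R.J P k)†) (P.c (R.x k))‖ := by
          rw [← norm_neg (((R.Jb P k)†) (R.cb P k - P.c (R.x k)))]; exact norm_sub_le _ _
      _ ≤ (B.κJ + ε.J) * ε.c + ε.J * B.κc := by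
          refine add_le_add ((norm_adjoint_apply_le (S.norm_Jb_le k) _).trans ?_)
            ((norm_adjoint_apply_le (S.noise.J_noise _ hx) _).trans ?_)
          · gcongr; exact S.noise.c_noise _ hx
          · gcongr; exact S.smooth.c_bound _ hx
      _ = _ := by ring
  have h4 : ‖R.Jc P k‖ - ‖R.Jcb P k‖ ≤ (B.κJ + ε.J) * ε.c + B.κc * ε.J :=
    (norm_sub_norm_le _ _).trans h3
  have h5 : (‖R.Jc P k‖ - ‖R.Jcb P k‖) * (‖R.Jc P k‖ + ‖R.Jcb P k‖) ≤
      ((B.κJ + ε.J) * ε.c + B.κc * ε.J) * ((B.κJ + ε.J) * (B.κc + ε.c) + B.κJ * B.κc) := by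
    exact mul_le_mul h4 (by linarith) (by positivity) (by positivity)
  have h6 := h5.trans (le_max_left _ (B.κJ ^ 2 * ε.c ^ 2))
  unfold errJc2
  linarith

theorem errJc2_nonneg (B : Bounds) (ε : Noise) : 0 ≤ errJc2 B ε :=
  le_max_of_le_right (by positivity)

/-- The multipliers bound, for normal components bounded by `normalBound`. -/
def multiplierBound (B : Bounds) (p : Params) (M κσ : ℝ) : ℝ :=
  (1 + B.κH / B.ζ) * (B.κg + M + B.κH * normalBound B p M) / κσ

theorem multiplierBound_pos (hB : B.Admissible) (hp : p.Admissible B) (hM : 0 < M)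
    (hκσ : 0 < κσ) : 0 < multiplierBound B p M κσ := by
  have := hB.κH_pos
  have := hB.ζ_pos
  have := hB.κg_pos
  have := normalBound_pos hB hp hM
  unfold multiplierBound
  positivity

theorem Run.Standing.norm_trueNormalStep_le (S : R.Standing P X B p rule ε finf fsup)
    (hB : B.Admissible) (hp : p.Admissible B) (hM : 0 < M) {γ : ℝ} {v : ℕ → Vec n}
    (hv : R.TrueNormalSteps P p γ v) (k : ℕ) : ‖v k‖ ≤ normalBound B p M := by
  have hx := (S.staysIn k).1
  have hκJ := hB.κJ_pos
  have hκc := hB.κc_pos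
  have hσ := hp.σJc_pos
  refine (hv k).2.1.trans ?_
  unfold normalBound
  gcongr
  refine (norm_adjoint_apply_le (S.smooth.J_bound _ hx) _).trans ?_
  have := S.smooth.c_bound _ hx
  gcongr <;> linarith

theorem Run.Standing.exists_multipliers (S : R.Standing P X B p rule ε finf fsup)
    (hB : B.Admissible) (hp : p.Admissible B) (hε : ε.Admissible) (hM : 0 < M) (hεM : ε.LE M)
    (hκσ : 0 < κσ) (hJ : ∀ j, NonzeroSVBoundedBelow (R.J P j) κσ)
    (hJb : ∀ j, NonzeroSVBoundedBelow (R.Jb P j) κσ) {γ : ℝ} {v : ℕ → Vec n}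
    (hv : R.TrueNormalSteps P p γ v) (k : ℕ) :
    (∃ us ys, IsKKT (R.H k) (R.Jb P k) (R.gb P k) (R.v k) us ys ∧
        ‖ys‖ ≤ multiplierBound B p M κσ) ∧
      ∃ us ys, IsKKT (R.H k) (R.J P k) (P.g (R.x k)) (v k) us ys ∧
        ‖ys‖ ≤ multiplierBound B p M κσ := by
  have hζ := hB.ζ_pos
  have hκH := hB.κH_pos
  have hbound : ∀ g w : Vec n, ‖g‖ ≤ B.κg + M → ‖w‖ ≤ normalBound B p M →
      (1 + B.κH / B.ζ) * (‖g‖ + B.κH * ‖w‖) / κσ ≤ multiplierBound B p M κσ := by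
    intro g w hg hw
    unfold multiplierBound
    gcongr
  constructor
  · have hH : ∀ u, R.Jb P k u = 0 → B.ζ * ‖u‖ ^ 2 ≤ inner ℝ u (R.H k u) :=
      fun u hu => S.hessian.curvature k u (Or.inr hu)
    obtain ⟨u, y, h⟩ := exists_isKKT hζ hH (R.gb P k) (R.v k)
    obtain ⟨y', h', hy'⟩ := h.exists_multiplier hζ hH (S.hessian.bound k) hκσ (hJb k)
    exact ⟨u, y', h', hy'.trans (hbound _ _ ((S.norm_gb_le k).trans (by
      gcongr; exact hεM.2.1)) (S.norm_v_le_bound hB hp hε hεM k))⟩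
  · have hH : ∀ u, R.J P k u = 0 → B.ζ * ‖u‖ ^ 2 ≤ inner ℝ u (R.H k u) :=
      fun u hu => S.hessian.curvature k u (Or.inl hu)
    obtain ⟨u, y, h⟩ := exists_isKKT hζ hH (P.g (R.x k)) (v k)
    obtain ⟨y', h', hy'⟩ := h.exists_multiplier hζ hH (S.hessian.bound k) hκσ (hJ k)
    exact ⟨u, y', h', hy'.trans (hbound _ _ ((S.smooth.g_bound _ (S.staysIn k).1).trans (by
      linarith)) (S.norm_trueNormalStep_le hB hp hM hv k))⟩

/-- Sensitivity of the exact tangential step to the residuals of the solver. -/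
def residualFactor (B : Bounds) (p : Params) (κσ : ℝ) : ℝ :=
  p.lamρr * (1 / B.ζ + (1 + B.κH / B.ζ) / κσ)

/-- Bound on the ratio of the squared stationarity measure and the model reduction. -/
def statRatio (B : Bounds) (p : Params) (τmin M κσ : ℝ) : ℝ :=
  4 / B.ζ ^ 2 * B.κH ^ 2 *
    (2 * (1 + residualFactor B p κσ + p.σJc) ^ 2 *
      (tangentialRatio p τmin + stationarityRatio B p M) + p.σJc ^ 2 * stationarityRatio B p M)

theorem residualFactor_pos (hB : B.Admissible) (hp : p.Admissible B) (hκσ : 0 < κσ) :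
    0 < residualFactor B p κσ := by
  have := hB.κH_pos
  have := hB.ζ_pos
  have := hp.lamρr_mem.1
  unfold residualFactor
  positivity

theorem statRatio_pos (hB : B.Admissible) (hp : p.Admissible B) (hτ0 : 0 < τmin) (hM : 0 < M)
    (hκσ : 0 < κσ) : 0 < statRatio B p τmin M κσ := by
  have := hB.κH_pos
  have := hB.ζ_pos
  have := hp.σJc_pos
  have := residualFactor_pos hB hp hκσ
  have := tangentialRatio_pos hp hτ0
  have := stationarityRatio_pos hB hp hM
  unfold statRatio
  positivity

/-- The exact noisy tangential step is bounded by the inexact one and the infeasible stationarity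
measure. -/
theorem Run.Standing.norm_exact_le (S : R.Standing P X B p rule ε finf fsup)
    (hB : B.Admissible) (hp : p.Admissible B) (hκσ : 0 < κσ) {k : ℕ}
    (hJb : NonzeroSVBoundedBelow (R.Jb P k) κσ) {us : Vec n} {ys : Vec m}
    (h : IsKKT (R.H k) (R.Jb P k) (R.gb P k) (R.v k) us ys) :
    ‖us‖ ≤ (1 + residualFactor B p κσ) * (‖R.u k‖ + ‖R.Jcb P k‖) := by
  have hζ := hB.ζ_pos
  have hκH := hB.κH_pos
  have hlam := hp.lamρr_mem.1
  have h1 := h.norm_sub_le hζ (fun u hu => S.hessian.curvature k u (Or.inr hu))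
    (S.hessian.bound k) hκσ hJb (R.u k) (R.y k)
  have hres : R.ResidualTest P p k := by
    rcases le_or_gt ‖R.cb P k‖ ε.o with hc | hc
    · exact ((S.run.direction k).1 hc).2.2.1
    · exact ((S.run.direction k).2 hc).2.1.1
  -- The residual test is relaxed to a bound linear in `‖ū‖ + ‖J̄ᵀc̄‖`, both of which `Δl` controls.
  have hmax : p.lamρr * min (max ‖R.u k‖ ‖R.Jcb P k‖) p.κρr ≤
      p.lamρr * (‖R.u k‖ + ‖R.Jcb P k‖) := by
    gcongr
    refine (min_le_left _ _).trans (max_le ?_ ?_)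
    · linarith [norm_nonneg (R.Jcb P k)]
    · linarith [norm_nonneg (R.u k)]
  have hρ := (le_max_left _ _).trans (hres.trans hmax)
  have hr := (le_max_right _ _).trans (hres.trans hmax)
  have h2 : ‖us‖ ≤ ‖R.u k‖ + ‖R.u k - us‖ := by
    have := norm_sub_norm_le us (R.u k)
    rw [norm_sub_rev] at this
    linarith
  have hJ0 := norm_nonneg (R.Jcb P k)
  calc ‖us‖ ≤ ‖R.u k‖ + (‖R.resρ P k (R.u k) (R.y k)‖ / B.ζ +
        (1 + B.κH / B.ζ) * (‖R.Jb P k (R.u k)‖ / κσ)) := h2.trans (by gcongr; exact h1)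
    _ ≤ (‖R.u k‖ + ‖R.Jcb P k‖) + (p.lamρr * (‖R.u k‖ + ‖R.Jcb P k‖) / B.ζ +
        (1 + B.κH / B.ζ) * (p.lamρr * (‖R.u k‖ + ‖R.Jcb P k‖) / κσ)) := by
        gcongr
        linarith
    _ = _ := by unfold residualFactor; ring

/-- The stationarity measure is bounded by the model reduction and the noise. -/
theorem Run.Standing.sq_norm_stat_le (S : R.Standing P X B p rule ε finf fsup)
    (hB : B.Admissible) (hp : p.Admissible B) (hε : ε.Admissible) (hM : 0 < M) (hεM : ε.LE M)
    (hτ0 : 0 < τmin) (hτ : ∀ k, τmin ≤ R.τ k) (hκσ : 0 < κσ)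
    (hJ : ∀ j, NonzeroSVBoundedBelow (R.J P j) κσ)
    (hJb : ∀ j, NonzeroSVBoundedBelow (R.Jb P j) κσ) {γ : ℝ} {v : ℕ → Vec n}
    (hv : R.TrueNormalSteps P p γ v) (k : ℕ) {q : ℕ} (Z : Vec q →ₗᵢ[ℝ] Vec n)
    (hZ : LinearMap.range Z.toLinearMap = LinearMap.ker (R.J P k).toLinearMap) :
    ‖(Z.toContinuousLinearMap.adjoint) (P.g (R.x k) + R.H k (v k))‖ ^ 2 / B.κH ^ 2 ≤
      statRatio B p τmin M κσ * R.dl P k (R.τ k) +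
        (4 / B.ζ ^ 2 * (ε.g ^ 2 + multiplierBound B p M κσ ^ 2 * ε.J ^ 2) +
          4 / B.ζ ^ 2 * B.κH ^ 2 * p.σJc ^ 2 * errJc2 B ε) := by
  have hζ := hB.ζ_pos
  have hκH := hB.κH_pos
  have hσJc := hp.σJc_pos
  have hx := (S.staysIn k).1
  have hτp : ∀ k, 0 < R.τ k := fun k => hτ0.trans_le (hτ k)
  obtain ⟨⟨us, ys, hb, hys⟩, ut, yt, ht, -⟩ :=
    S.exists_multipliers hB hp hε hM hεM hκσ hJ hJb hv k
  have h1 : ‖(Z.toContinuousLinearMap.adjoint) (P.g (R.x k) + R.H k (v k))‖ ^ 2 / B.κH ^ 2 ≤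
      ‖ut‖ ^ 2 := by
    rw [div_le_iff₀ (by positivity), mul_comm, ← mul_pow]
    gcongr
    exact ht.norm_adjoint_le (S.hessian.bound k) Z hZ
  refine h1.trans ?_
  -- The true exact step is traded for the noisy one. Only the noisy multiplier enters, which is why
  -- one multiplier term suffices below.
  have h2 := ht.norm_le_of_perturbed hb
    (fun u hu => S.hessian.curvature k u (Or.inl hu)) (S.hessian.bound k)
    (S.noise.g_noise _ hx) (S.noise.J_noise _ hx) hys
  set w := ‖R.u k‖ + ‖R.Jcb P k‖
  set D := R.dl P k (R.τ k)
  have h3 : ‖us‖ + ‖R.v k‖ ≤ (1 + residualFactor B p κσ + p.σJc) * w := by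
    have e1 := S.norm_exact_le hB hp hκσ (hJb k) hb
    have e2 : ‖R.v k‖ ≤ p.σJc * w := (S.norm_v_le hp k).trans (by
      gcongr; exact le_add_of_nonneg_left (norm_nonneg _))
    linarith
  have hw : w ^ 2 ≤ 2 * ((tangentialRatio p τmin + stationarityRatio B p M) * D) := by
    have e1 := S.sq_norm_u_le hB hp hM hεM hτ0 hτ k
    have e2 := S.sq_norm_Jcb_le' hB hp hε hM hεM hτp k
    have e3 := sq_nonneg (‖R.u k‖ - ‖R.Jcb P k‖)
    nlinarith
  have h4 : (‖us‖ + ‖R.v k‖) ^ 2 ≤ (1 + residualFactor B p κσ + p.σJc) ^ 2 *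
      (2 * ((tangentialRatio p τmin + stationarityRatio B p M) * D)) := by
    calc (‖us‖ + ‖R.v k‖) ^ 2 ≤ ((1 + residualFactor B p κσ + p.σJc) * w) ^ 2 := by gcongr
      _ = (1 + residualFactor B p κσ + p.σJc) ^ 2 * w ^ 2 := by ring
      _ ≤ _ := by gcongr
  -- The normal step of the true problem is measured by `Jᵀc`; passing to the noisy `J̄ᵀc̄` brings
  -- in `errJc2`.
  have h5 : ‖v k‖ ^ 2 ≤ p.σJc ^ 2 * (stationarityRatio B p M * D + errJc2 B ε) := by
    calc ‖v k‖ ^ 2 ≤ (p.σJc * ‖R.Jc P k‖) ^ 2 := by gcongr; exact (hv k).2.1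
      _ = p.σJc ^ 2 * ‖R.Jc P k‖ ^ 2 := by ring
      _ ≤ _ := by
          gcongr
          have e1 := S.sq_norm_Jc_le hB hε k
          have e2 := S.sq_norm_Jcb_le' hB hp hε hM hεM hτp k
          linarith
  set κy := multiplierBound B p M κσ
  have h6 : (B.ζ * ‖ut‖) ^ 2 ≤ 4 * (ε.g ^ 2 + κy ^ 2 * ε.J ^ 2 +
      B.κH ^ 2 * (‖us‖ + ‖R.v k‖) ^ 2 + B.κH ^ 2 * ‖v k‖ ^ 2) := by
    have hsum : ∀ a b c d : ℝ, (a + b + c + d) ^ 2 ≤ 4 * (a ^ 2 + b ^ 2 + c ^ 2 + d ^ 2) := by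
      intro a b c d
      linarith [sq_nonneg (a - b), sq_nonneg (a - c), sq_nonneg (a - d), sq_nonneg (b - c),
        sq_nonneg (b - d), sq_nonneg (c - d)]
    calc (B.ζ * ‖ut‖) ^ 2 ≤ (ε.g + κy * ε.J + B.κH * (‖us‖ + ‖R.v k‖) + B.κH * ‖v k‖) ^ 2 := by
          gcongr
      _ ≤ _ := hsum _ _ _ _
      _ = _ := by ring
  have h7 : ‖ut‖ ^ 2 ≤ 4 / B.ζ ^ 2 * (ε.g ^ 2 + κy ^ 2 * ε.J ^ 2 +
      B.κH ^ 2 * (‖us‖ + ‖R.v k‖) ^ 2 + B.κH ^ 2 * ‖v k‖ ^ 2) := by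
    rw [div_mul_eq_mul_div, le_div_iff₀ (by positivity)]
    linarith
  calc ‖ut‖ ^ 2 ≤ 4 / B.ζ ^ 2 * (ε.g ^ 2 + κy ^ 2 * ε.J ^ 2 +
      B.κH ^ 2 * ((1 + residualFactor B p κσ + p.σJc) ^ 2 *
      (2 * ((tangentialRatio p τmin + stationarityRatio B p M) * D))) +
      B.κH ^ 2 * (p.σJc ^ 2 * (stationarityRatio B p M * D + errJc2 B ε))) :=
        h7.trans (by gcongr)
    _ = _ := by unfold statRatio; ring

/-- With noisy Jacobians of full rank, the constraint violation is bounded by the model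
reduction. -/
theorem Run.Standing.norm_c_le (S : R.Standing P X B p rule ε finf fsup)
    (hB : B.Admissible) (hp : p.Admissible B) (hε : ε.Admissible) (hM : 0 < M) (hεM : ε.LE M)
    (hτ : ∀ k, 0 < R.τ k) (hκσ : 0 < κσ) {k : ℕ} (hJb : SVBoundedBelow (R.Jb P k) κσ) :
    ‖P.c (R.x k)‖ ≤
      1 / (κσ ^ 2 * p.σc * normalDecrease B p M) * R.dl P k (R.τ k) + 2 * ε.c := by
  have hσc := hp.σc_mem.1
  have hσv := normalDecrease_pos hB hp hM
  have hdl := S.dl_pos hB hp hε hM hεM hτ k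
  have hc := S.norm_c_le_cb k
  rcases le_or_gt ‖R.cb P k‖ ε.o with h | h
  -- Here `‖c‖ ≤ ε.o + ε.c ≤ 2 ε.c` already, with no help from the model reduction.
  · have h1 := hε.o_le_c
    have h2 : 0 ≤ 1 / (κσ ^ 2 * p.σc * normalDecrease B p M) * R.dl P k (R.τ k) := by positivity
    linarith
  · have hcb : 0 < ‖R.cb P k‖ := hε.o_nonneg.trans_lt h
    have h1 : κσ * ‖R.cb P k‖ ≤ ‖R.Jcb P k‖ := hJb.le_norm_adjoint hκσ (S.nontrivialNull k).2 _
    have h2 := S.decrease hB hp hM hεM h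
    have h3 : p.σc * R.redv P k ≤ R.dl P k (R.τ k) := by
      have e1 := S.le_dl hB hp hM hεM hτ h
      have e2 : 0 ≤ R.τ k * p.σu * R.curv p k :=
        mul_nonneg (mul_pos (hτ k) hp.σu_mem.1).le (R.curv_nonneg hp k)
      linarith
    -- One factor `‖c̄‖` cancels: the normal decrease is linear in `‖c̄‖` on one side and, by full
    -- rank, quadratic on the other. This yields a bound on the norm itself rather than on its
    -- square.
    have h4 : ‖R.cb P k‖ ≤
        1 / (κσ ^ 2 * p.σc * normalDecrease B p M) * R.dl P k (R.τ k) := by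
      rw [div_mul_eq_mul_div, one_mul, le_div_iff₀ (by positivity)]
      refine le_of_mul_le_mul_left ?_ hcb
      calc ‖R.cb P k‖ * (‖R.cb P k‖ * (κσ ^ 2 * p.σc * normalDecrease B p M))
          = p.σc * (normalDecrease B p M * (κσ * ‖R.cb P k‖) ^ 2) := by ring
        _ ≤ p.σc * (normalDecrease B p M * ‖R.Jcb P k‖ ^ 2) := by gcongr
        _ ≤ p.σc * (‖R.cb P k‖ * R.redv P k) := by gcongr
        _ = ‖R.cb P k‖ * (p.σc * R.redv P k) := by ring
        _ ≤ _ := by gcongr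
    have := hε.c_nonneg
    linarith

end Averages

/-! ### Choice of the constants and size of the bounds -/

section Choice

variable {B : Bounds} {p : Params} {rule : StepRule} {τmin M κσ : ℝ}

/-- The constants `ξmin` and `κΔ` can be chosen so that the lower bound on the step sizes is below
any given level. -/
theorem exists_alphaLow_le (hB : B.Admissible) (hp : p.Admissible B) (hτ0 : 0 < τmin) (hM : 0 < M)
    (hr : rule.Admissible B p τmin) {δ : ℝ} (hδ : 0 < δ) :
    ∃ ξmin κΔ : ℝ, 0 < ξmin ∧ 0 < κΔ ∧ κΔ ≤ modelConst B p τmin M ∧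
      (∀ a, rule = .adaptive a → ξmin ≤ ratioLow B p τmin M a) ∧
      ∀ K : Consts, K.ξmin = ξmin → K.κΔ = κΔ →
        0 < alphaLow B p τmin K rule ∧ alphaLow B p τmin K rule ≤ δ := by
  have hη := sub_pos.mpr hp.η_mem.2
  have hmc := modelConst_pos hB hp hτ0 hM
  cases rule with
  | adaptive a =>
    have hβ := hr.2.1.1
    have hlow := ratioLow_pos hB hp hτ0 hM hr
    have hden := stepDen_pos hB hτ0
    -- The lower step bound is linear in `ξmin` with slope `c`, so `δ / c` is the value that meets
    -- the level `δ`.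
    set c := 2 * (1 - p.η) * a.β * min τmin 1 / (τmin * B.L + B.Γ) with hc
    have hc0 : 0 < c := by positivity
    refine ⟨min (ratioLow B p τmin M a) (δ / c), modelConst B p τmin M, by positivity, hmc, le_rfl,
      ?_, ?_⟩
    · rintro _ ⟨⟩
      exact min_le_left _ _
    · intro K hK _
      have h1 : alphaLow B p τmin K (.adaptive a) = K.ξmin * c := by
        rw [hc, alphaLow]; ring
      rw [h1, hK]
      refine ⟨by positivity, ?_⟩
      calc min (ratioLow B p τmin M a) (δ / c) * c ≤ δ / c * c := by
            gcongr; exact min_le_right _ _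
        _ = δ := by field_simp
  | lineSearch l =>
    have hαu := hr.1.1
    have hν := hr.2.1
    have hden := stepDen_pos hB hp.τ₀_pos
    set c := l.ν * (1 - p.η) / (p.τ₀ * B.L + B.Γ) with hc
    have hc0 : 0 < c := by positivity
    -- The line search bound does not involve `ξmin`, so any positive value serves; `κΔ` is the one
    -- to shrink.
    refine ⟨1, min (modelConst B p τmin M) (δ / c), one_pos, by positivity, min_le_left _ _,
      by rintro _ ⟨⟩, ?_⟩
    intro K _ hK
    have h1 : alphaLow B p τmin K (.lineSearch l) = min l.αu (K.κΔ * c) := by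
      rw [hc, alphaLow]; congr 1; ring
    rw [h1, hK]
    refine ⟨by positivity, (min_le_right _ _).trans ?_⟩
    calc min (modelConst B p τmin M) (δ / c) * c ≤ δ / c * c := by
          gcongr; exact min_le_right _ _
      _ = δ := by field_simp

theorem Noise.Admissible.le_total {ε : Noise} (hε : ε.Admissible) :
    ε.f ≤ ε.total ∧ ε.g ≤ ε.total ∧ ε.c ≤ ε.total ∧ ε.J ≤ ε.total ∧ 0 ≤ ε.total := by
  have := hε.f_nonneg
  have := hε.g_nonneg
  have := hε.c_nonneg
  have := hε.J_nonneg
  unfold Noise.total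
  refine ⟨?_, ?_, ?_, ?_, ?_⟩ <;> linarith

theorem alphaUp_nonneg (hp : p.Admissible B) (hr : rule.Admissible B p τmin) :
    0 ≤ alphaUp B p rule := by
  have hη := sub_pos.mpr hp.η_mem.2
  cases rule with
  | adaptive a =>
    obtain ⟨hΓ, ⟨hβ, -⟩, hθ, -, -, hξ, -⟩ := hr
    unfold alphaUp
    positivity
  | lineSearch l => exact hr.1.1.le

/-- The coefficient majorizes the error terms of both step rules at once. -/
theorem meritError_bounds (hp : p.Admissible B)
    (hr : rule.Admissible B p τmin) {K : Consts} (hK : 0 ≤ K.κd) {ε : Noise} (hε : ε.Admissible) :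
    0 ≤ meritError B p ε K rule ∧ meritError B p ε K rule ≤
      (4 * p.τ₀ + alphaUp B p rule * p.τ₀ * K.κd + 6 + alphaUp B p rule * K.κd) * ε.total := by
  have hα := alphaUp_nonneg hp hr
  have hτ := hp.τ₀_pos
  have hf := hε.f_nonneg
  have hg := hε.g_nonneg
  have hc := hε.c_nonneg
  have hJ := hε.J_nonneg
  obtain ⟨h1, h2, h3, h4, h5⟩ := hε.le_total
  have e1 : 4 * p.τ₀ * ε.f ≤ 4 * p.τ₀ * ε.total := by gcongr
  have e2 : alphaUp B p rule * p.τ₀ * K.κd * ε.g ≤ alphaUp B p rule * p.τ₀ * K.κd * ε.total := by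
    gcongr
  have e3 : alphaUp B p rule * K.κd * ε.J ≤ alphaUp B p rule * K.κd * ε.total := by gcongr
  have e4 : 0 ≤ 4 * p.τ₀ * ε.f := by positivity
  cases rule with
  | adaptive a =>
    unfold meritError
    exact ⟨by positivity, by dsimp only; linarith⟩
  | lineSearch l =>
    unfold meritError
    exact ⟨by positivity, by dsimp only; linarith⟩

/-- In each entry of the maximum, one factor that is first order in the noise is kept and the rest
is replaced by the cap. -/
theorem errJc2_le (hB : B.Admissible) {ε : Noise} (hε : ε.Admissible) (hεM : ε.LE M) :
    errJc2 B ε ≤ ((B.κJ + M + B.κc) * ((B.κJ + M) * (B.κc + M) + B.κJ * B.κc) +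
      B.κJ ^ 2 * M) * ε.total := by
  have hκJ := hB.κJ_pos
  have hκc := hB.κc_pos
  have hc := hε.c_nonneg
  have hJ := hε.J_nonneg
  obtain ⟨-, -, hcM, hJM⟩ := hεM
  obtain ⟨-, -, h3, h4, h5⟩ := hε.le_total
  have hM := hc.trans hcM
  have e1 : ((B.κJ + ε.J) * ε.c + B.κc * ε.J) *
      ((B.κJ + ε.J) * (B.κc + ε.c) + B.κJ * B.κc) ≤
      ((B.κJ + M) * ε.total + B.κc * ε.total) *
      ((B.κJ + M) * (B.κc + M) + B.κJ * B.κc) := by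
    gcongr
  have e2 : B.κJ ^ 2 * ε.c ^ 2 ≤ B.κJ ^ 2 * (M * ε.total) := by
    rw [sq ε.c]
    gcongr
  have e3 : 0 ≤ B.κJ ^ 2 * (M * ε.total) := by positivity
  have e4 : 0 ≤ ((B.κJ + M) * ε.total + B.κc * ε.total) *
      ((B.κJ + M) * (B.κc + M) + B.κJ * B.κc) := by positivity
  unfold errJc2
  refine max_le ?_ ?_ <;> linarith

/-- A bound that is linear in the gap and in the errors. -/
theorem linear_bound {T T' E CE e Ce G N : ℝ} (hT : 0 ≤ T) (hTT : T ≤ T') (hE : E ≤ CE * N)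
    (hCE : 0 ≤ CE) (he : e ≤ Ce * N) (hCe : 0 ≤ Ce) (hG : 0 ≤ G) (hN : 0 ≤ N) :
    T * G + T * E + e ≤ (T' * (1 + CE) + Ce) * (G + N) := by
  have hT' := hT.trans hTT
  have h1 : T * G ≤ T' * G := by gcongr
  have h2 : T * E ≤ T' * (CE * N) :=
    (mul_le_mul_of_nonneg_left hE hT).trans (by gcongr)
  have h3 : 0 ≤ T' * N + T' * CE * G + Ce * G := by positivity
  linarith

/-- This and the two lemmas after it expose the shape `T * G + T * E + e` shared by `avg_le` and
`linear_bound`. -/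
theorem boundJc_eq (B : Bounds) (p : Params) (ε : Noise) (K : Consts) (αl E Φ : ℝ) (k : ℕ) :
    boundJc B p ε K αl E Φ k =
      (B.κc + ε.c) / (p.σc * K.σv * p.η * αl) * (Φ / ((k : ℝ) + 1)) +
        (B.κc + ε.c) / (p.σc * K.σv * p.η * αl) * E + errJc2 B ε := by
  unfold boundJc
  congr 2
  rw [div_mul_div_comm]
  congr 1 <;> ring

theorem boundC2_eq (B : Bounds) (p : Params) (ε : Noise) (K : Consts) (κσ αl E Φ : ℝ) (k : ℕ) :
    boundC2 B p ε K κσ αl E Φ k =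
      (B.κc + ε.c) / (p.σc * K.σv * p.η * αl * κσ ^ 2) * (Φ / ((k : ℝ) + 1)) +
        (B.κc + ε.c) / (p.σc * K.σv * p.η * αl * κσ ^ 2) * E + 1 / κσ ^ 2 * errJc2 B ε := by
  unfold boundC2
  congr 2
  rw [div_mul_div_comm]
  congr 1 <;> ring

theorem boundC_eq (p : Params) (ε : Noise) (K : Consts) (κσ αl E Φ : ℝ) (k : ℕ) :
    boundC p ε K κσ αl E Φ k =
      1 / (κσ ^ 2 * p.σc * K.σv * p.η * αl) * (Φ / ((k : ℝ) + 1)) +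
        1 / (κσ ^ 2 * p.σc * K.σv * p.η * αl) * E + 2 * ε.c := by
  unfold boundC
  congr 2
  rw [div_mul_div_comm]
  congr 1 <;> ring

/-- Monotonicity in the noise makes the coefficient uniform once `ε'` is the worst admissible level.
The lower bound by `4 / (…)`, which grows as `αl` shrinks, is what later dominates `statRatio`. -/
theorem statCoef_le (hB : B.Admissible) (hp : p.Admissible B) (hτ0 : 0 < τmin) {K : Consts}
    (hK : 0 < K.σv) {αl : ℝ} (hα : 0 < αl) (hκσ : 0 < κσ) {ε ε' : Noise} (hε : ε.Admissible)
    (hJ : ε.J ≤ ε'.J) (hc : ε.c ≤ ε'.c) :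
    0 ≤ kappa1 B p ε κσ ∧ kappa1 B p ε κσ ≤ kappa1 B p ε' κσ ∧ 0 ≤ kappa2 B p ∧
      4 / (τmin * p.σu * p.lamu * p.η * αl) ≤ statCoef B p ε K τmin κσ αl ∧
      statCoef B p ε K τmin κσ αl ≤ statCoef B p ε' K τmin κσ αl := by
  have hκJ := hB.κJ_pos
  have hκc := hB.κc_pos
  have hζ := hB.ζ_pos
  have hσu := hp.σu_mem.1
  have hlamu := hp.lamu_mem.1
  have hη := hp.η_mem.1
  have hσc := hp.σc_mem.1
  have h1 := hε.J_nonneg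
  have h2 := hε.c_nonneg
  have k1 : 0 ≤ kappa1 B p ε κσ := by unfold kappa1; positivity
  have k2 : 0 ≤ kappa2 B p := by unfold kappa2; positivity
  have k3 : kappa1 B p ε κσ ≤ kappa1 B p ε' κσ := by
    unfold kappa1
    gcongr
  refine ⟨k1, k3, k2, ?_, ?_⟩
  · unfold statCoef
    have e1 : 0 ≤ (kappa1 B p ε κσ + 2 * kappa2 B p) * (B.κc + ε.c) /
        (p.σc * K.σv * p.η * αl) := by positivity
    have e2 : 4 / (τmin * p.σu * p.lamu * p.η * αl) ≤
        (4 + 2 * kappa1 B p ε κσ) / (τmin * p.σu * p.lamu * p.η * αl) := by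
      gcongr
      linarith
    linarith
  · have k4 : 0 ≤ kappa1 B p ε' κσ := k1.trans k3
    unfold statCoef
    gcongr

end Choice

end NoisySQP

end

/-! ### Choice of the constants and conclusion -/

open NoisySQP

theorem theorem3p20 (B : NoisySQP.Bounds) (hB : B.Admissible)
    (p : NoisySQP.Params) (hp : p.Admissible B) (τmin : ℝ) (hτmin : 0 < τmin)
    (rule : NoisySQP.StepRule) (hrule : rule.Admissible B p τmin)
    (κσ : ℝ) (hκσ : 0 < κσ) (εmax : ℝ) (hεmax : 0 < εmax) :
    ∃ (K : NoisySQP.Consts) (C : ℝ), K.Pos ∧ 0 < C ∧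
      0 < NoisySQP.alphaLow B p τmin K rule ∧
      ∀ (n m : ℕ) (P : NoisySQP.Problem n m) (R : NoisySQP.Run n m) (X : Set (NoisySQP.Vec n))
        (ε : NoisySQP.Noise) (finf fsup : ℝ),
        ε.Admissible → ε.LE εmax →
        R.Standing P X B p rule ε finf fsup →
        (∀ k, τmin ≤ R.τ k) →
        let αl := NoisySQP.alphaLow B p τmin K rule
        let E := NoisySQP.meritError B p ε K rule
        let Φ := NoisySQP.gap P R p finf
        K.ValidFor αl P R rule ε ∧
        (∀ k : ℕ,
          NoisySQP.avg (fun j => ‖R.Jc P j‖ ^ 2) k ≤ NoisySQP.boundJc B p ε K αl E Φ k ∧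
          NoisySQP.boundJc B p ε K αl E Φ k ≤ C * (Φ / ((k : ℝ) + 1) + ε.total)) ∧
        ((∀ j, NoisySQP.NonzeroSVBoundedBelow (R.J P j) κσ ∧
              NoisySQP.NonzeroSVBoundedBelow (R.Jb P j) κσ) →
          ∀ (γ : ℝ) (v : ℕ → NoisySQP.Vec n), γ ∈ Set.Ioc (0 : ℝ) 1 → R.TrueNormalSteps P p γ v →
            K.MultipliersFor P R v ∧
            ∀ (q : ℕ → ℕ) (Z : ∀ j, NoisySQP.Vec (q j) →ₗᵢ[ℝ] NoisySQP.Vec n),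
              (∀ j, LinearMap.range (Z j).toLinearMap = LinearMap.ker (R.J P j).toLinearMap) →
              ∀ k : ℕ,
                NoisySQP.avg (fun j =>
                    ‖((Z j).toContinuousLinearMap.adjoint) (P.g (R.x j) + R.H j (v j))‖ ^ 2 /
                      B.κH ^ 2) k ≤
                  NoisySQP.boundStat B p ε K τmin κσ αl E Φ k ∧
                NoisySQP.boundStat B p ε K τmin κσ αl E Φ k ≤
                  C * (Φ / ((k : ℝ) + 1) + ε.total)) ∧
        ((∀ j, NoisySQP.SVBoundedBelow (R.J P j) κσ) → ∀ k : ℕ,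
          NoisySQP.avg (fun j => ‖P.c (R.x j)‖ ^ 2) k ≤ NoisySQP.boundC2 B p ε K κσ αl E Φ k ∧
          NoisySQP.boundC2 B p ε K κσ αl E Φ k ≤ C * (Φ / ((k : ℝ) + 1) + ε.total)) ∧
        ((∀ j, NoisySQP.SVBoundedBelow (R.Jb P j) κσ) → ∀ k : ℕ,
          NoisySQP.avg (fun j => ‖P.c (R.x j)‖) k ≤ NoisySQP.boundC p ε K κσ αl E Φ k ∧
          NoisySQP.boundC p ε K κσ αl E Φ k ≤ C * (Φ / ((k : ℝ) + 1) + ε.total)) := by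
  have hηp := hp.η_mem.1
  have hσc := hp.σc_mem.1
  have hσu := hp.σu_mem.1
  have hlamu := hp.lamu_mem.1
  have hκc := hB.κc_pos
  have hκJ := hB.κJ_pos
  have hζ := hB.ζ_pos
  have hσv := normalDecrease_pos hB hp hεmax
  have hκd : 0 < normalBound B p εmax + tangentialBound B p εmax :=
    add_pos (normalBound_pos hB hp hεmax) (tangentialBound_pos hB hp hεmax)
  have hκy := multiplierBound_pos hB hp hεmax hκσ
  have hlow := stepLow_pos hB hp hτmin hεmax hrule
  have hratio := statRatio_pos hB hp hτmin hεmax hκσ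
  -- The first entry of `δ` puts `alphaLow` below the proved step bound. The second makes the
  -- leading term of `statCoef` at least `statRatio / (η * stepLow)`.
  obtain ⟨ξmin, κΔ, hξ, hκΔ, hκΔle, hξle, hα⟩ := exists_alphaLow_le hB hp hτmin hεmax hrule
    (δ := min (stepLow B p τmin εmax rule) (4 * stepLow B p τmin εmax rule /
      (statRatio B p τmin εmax κσ * (τmin * p.σu * p.lamu)))) (by positivity)
  set σv := normalDecrease B p εmax
  set κy := multiplierBound B p εmax κσ
  set slow := stepLow B p τmin εmax rule
  set ratio := statRatio B p τmin εmax κσ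
  let K : Consts := ⟨σv, normalBound B p εmax + tangentialBound B p εmax, κy, κy, ξmin, κΔ⟩
  obtain ⟨hα0, hαδ⟩ := hα K rfl rfl
  have hKd : 0 ≤ K.κd := hκd.le
  have hKv : 0 < K.σv := hσv
  set αl := alphaLow B p τmin K rule with hαl
  have hαlow : αl ≤ slow := hαδ.trans (min_le_left _ _)
  have hαratio : ratio * (τmin * p.σu * p.lamu) * αl ≤ 4 * slow := by
    have := hαδ.trans (min_le_right _ _)
    rwa [le_div_iff₀ (by positivity), mul_comm] at this
  set CE := 4 * p.τ₀ + alphaUp B p rule * p.τ₀ * K.κd + 6 + alphaUp B p rule * K.κd with hCE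
  have hCE0 : 0 ≤ CE := by
    have := alphaUp_nonneg hp hrule
    have := hp.τ₀_pos
    positivity
  set CJ := (B.κJ + εmax + B.κc) * ((B.κJ + εmax) * (B.κc + εmax) + B.κJ * B.κc) +
    B.κJ ^ 2 * εmax with hCJ
  have hCJ0 : 0 ≤ CJ := by positivity
  -- The worst noise level below the cap, at which the coefficients entering `C` are evaluated.
  let N : Noise := ⟨εmax, εmax, εmax, εmax, εmax⟩
  have hN : N.Admissible := ⟨hεmax.le, hεmax.le, hεmax.le, hεmax.le, hεmax.le, le_rfl⟩
  obtain ⟨hk1N, -, hk2, hSN, -⟩ := statCoef_le hB hp hτmin hKv hα0 hκσ hN (ε' := N) le_rfl le_rfl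
  have hSN0 : 0 ≤ statCoef B p N K τmin κσ αl := le_trans (by positivity) hSN
  set T₁ := (B.κc + εmax) / (p.σc * K.σv * p.η * αl) with hT₁
  set T₂ := statCoef B p N K τmin κσ αl with hT₂
  set T₃ := (B.κc + εmax) / (p.σc * K.σv * p.η * αl * κσ ^ 2) with hT₃
  set T₄ := 1 / (κσ ^ 2 * p.σc * K.σv * p.η * αl) with hT₄
  set e₂ := 2 * kappa2 B p * CJ + kappa1 B p N κσ * (B.κJ + εmax) ^ 2 * εmax +
    12 / B.ζ ^ 2 * (εmax + κy ^ 2 * εmax + κy ^ 2 * εmax) with he₂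
  have he₂0 : 0 ≤ e₂ := by positivity
  have hT₁0 : 0 ≤ T₁ := by positivity
  have hT₃0 : 0 ≤ T₃ := by positivity
  have hT₄0 : 0 ≤ T₄ := by positivity
  have hC₁ : 0 ≤ T₁ * (1 + CE) + CJ := by positivity
  have hC₂ : 0 ≤ T₂ * (1 + CE) + e₂ := by positivity
  have hC₃ : 0 ≤ T₃ * (1 + CE) + 1 / κσ ^ 2 * CJ := by positivity
  have hC₄ : 0 ≤ T₄ * (1 + CE) + 2 := by positivity
  refine ⟨K, (T₁ * (1 + CE) + CJ) + (T₂ * (1 + CE) + e₂) + (T₃ * (1 + CE) + 1 / κσ ^ 2 * CJ) +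
    (T₄ * (1 + CE) + 2) + 1, ⟨hσv, hκd, hκy, hκy, hξ, hκΔ⟩, by positivity, hα0, ?_⟩
  intro n m P R X ε finf fsup hε hεM S hτ
  dsimp only
  have hτp : ∀ k, 0 < R.τ k := fun k => hτmin.trans_le (hτ k)
  have hKdir : ∀ k, ‖R.d k‖ ≤ K.κd := S.norm_d_le hB hp hε hεmax hεM
  have hΦ := S.gap_nonneg hp hτmin hτ
  have hc0 := hε.c_nonneg
  have hJ0 := hε.J_nonneg
  have hg0 := hε.g_nonneg
  obtain ⟨hfM, hgM, hcM, hJM⟩ := id hεM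
  obtain ⟨-, hgt, hct, hJt, ht0⟩ := hε.le_total
  obtain ⟨hE0, hE⟩ := meritError_bounds hp hrule hKd hε
  have hJc2 := errJc2_le hB hε hεM
  have hJc20 := errJc2_nonneg B ε
  obtain ⟨hk1, hk1le, -, hS4, hSle⟩ :=
    statCoef_le hB hp hτmin hKv hα0 hκσ hε (ε' := N) hJM hcM
  -- The averages are governed by `stepLow`; the stated bounds contain the smaller `αl` and are
  -- therefore weaker.
  have hstep : ∀ A : ℝ, 0 ≤ A → A ≤ A / (p.η * αl) * (p.η * slow) := by
    intro A hA
    rw [div_mul_eq_mul_div, le_div_iff₀ (by positivity)]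
    gcongr
  have hsq : ∀ x : ℝ, 0 ≤ x → x ≤ εmax → x ≤ ε.total → x ^ 2 ≤ εmax * ε.total := by
    intro x h0 h1 h2
    rw [sq]
    gcongr
  have hG : ∀ k : ℕ, 0 ≤ gap P R p finf / ((k : ℝ) + 1) := fun k => by positivity
  have hfin : ∀ (k : ℕ) (c : ℝ), c ≤ (T₁ * (1 + CE) + CJ) + (T₂ * (1 + CE) + e₂) +
      (T₃ * (1 + CE) + 1 / κσ ^ 2 * CJ) + (T₄ * (1 + CE) + 2) + 1 →
      ∀ b, b ≤ c * (gap P R p finf / ((k : ℝ) + 1) + ε.total) →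
        b ≤ ((T₁ * (1 + CE) + CJ) + (T₂ * (1 + CE) + e₂) +
      (T₃ * (1 + CE) + 1 / κσ ^ 2 * CJ) + (T₄ * (1 + CE) + 2) + 1) *
          (gap P R p finf / ((k : ℝ) + 1) + ε.total) := by
    intro k c hc b hb
    exact hb.trans (mul_le_mul_of_nonneg_right hc (add_nonneg (hG k) ht0))
  refine ⟨⟨?_, hKdir, ?_, ?_, ?_⟩, ?_, ?_, ?_, ?_⟩
  · exact fun k hk => S.decrease hB hp hεmax hεM hk
  · rintro a rfl k
    exact (hξle a rfl).trans (S.ξ_mem hB hp hrule hε hεmax hεM hτmin hτ k).1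
  · intro k
    refine le_trans ?_ (S.modelConst_le hB hp hε hεmax hεM hτmin hτ k)
    gcongr
  · exact fun k => hαlow.trans (S.stepLow_le hB hp hrule hε hεmax hεM hτmin hτ k)
  · intro k
    rw [boundJc_eq]
    constructor
    · refine S.avg_le hB hp hrule hε hεmax hεM hτmin hτ hKdir
        (A := (B.κc + ε.c) / (p.σc * σv)) (by positivity) (fun j => ?_) ?_ k
      · exact (S.sq_norm_Jc_le hB hε j).trans
          (by gcongr; exact S.sq_norm_Jcb_le hB hp hε hεmax hεM hτp j)
      · refine (hstep _ (by positivity)).trans (le_of_eq ?_)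
        rw [div_div]
        congr 2
        ring
    · refine hfin k _ ?_ _ (linear_bound (T' := T₁) (by positivity) (by rw [hT₁]; gcongr) hE hCE0 hJc2
        hCJ0 (hG k) ht0)
      linarith
  · rintro hJ γ v - hv
    refine ⟨fun k => S.exists_multipliers hB hp hε hεmax hεM hκσ (fun j => (hJ j).1)
      (fun j => (hJ j).2) hv k, fun q Z hZ k => ?_⟩
    unfold boundStat
    rw [add_assoc, add_assoc]
    constructor
    · refine S.avg_le hB hp hrule hε hεmax hεM hτmin hτ hKdir (A := ratio)
        (le_trans (by positivity) hS4) (fun j => ?_) ?_ k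
      · refine (S.sq_norm_stat_le hB hp hε hεmax hεM hτmin hτ hκσ (fun j => (hJ j).1)
          (fun j => (hJ j).2) hv j (Z j) (hZ j)).trans ?_
        refine add_le_add le_rfl ?_
        have e1 : 4 / B.ζ ^ 2 * (ε.g ^ 2 + κy ^ 2 * ε.J ^ 2) ≤
            12 / B.ζ ^ 2 * (ε.g ^ 2 + κy ^ 2 * ε.J ^ 2 + κy ^ 2 * ε.J ^ 2) := by
          have : 0 ≤ κy ^ 2 * ε.J ^ 2 := by positivity
          gcongr
          · norm_num
          · linarith
        -- The required coefficient is `4`, whereas `2 * kappa2` provides `48`.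
        have e2 : 4 / B.ζ ^ 2 * B.κH ^ 2 * p.σJc ^ 2 * errJc2 B ε ≤
            2 * kappa2 B p * errJc2 B ε := by
          have : 0 ≤ 1 / B.ζ ^ 2 * B.κH ^ 2 * p.σJc ^ 2 * errJc2 B ε := by positivity
          calc _ = 4 * (1 / B.ζ ^ 2 * B.κH ^ 2 * p.σJc ^ 2 * errJc2 B ε) := by ring
            _ ≤ 48 * (1 / B.ζ ^ 2 * B.κH ^ 2 * p.σJc ^ 2 * errJc2 B ε) := by
                gcongr; norm_num
            _ = _ := by unfold kappa2; ring
        have e3 : 0 ≤ kappa1 B p ε κσ * (B.κJ + ε.J) ^ 2 * ε.c ^ 2 := by positivity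
        change _ ≤ _ + (_ + 12 / B.ζ ^ 2 * (ε.g ^ 2 + κy ^ 2 * ε.J ^ 2 + κy ^ 2 * ε.J ^ 2))
        linarith
      -- Here the second entry of `δ` pays off: the first summand of `statCoef` alone absorbs the
      -- whole ratio.
      · have e1 : ratio ≤ 4 / (τmin * p.σu * p.lamu * p.η * αl) * (p.η * slow) := by
          rw [div_mul_eq_mul_div, le_div_iff₀ (by positivity)]
          have := mul_le_mul_of_nonneg_left hαratio hηp.le
          linarith
        exact e1.trans (by gcongr)
    · refine hfin k _ ?_ _ (linear_bound (T' := T₂) (Ce := e₂)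
        (le_trans (by positivity) hS4) hSle hE hCE0 ?_ he₂0 (hG k) ht0)
      · linarith
      · have e1 : 2 * kappa2 B p * errJc2 B ε ≤ 2 * kappa2 B p * (CJ * ε.total) := by gcongr
        have e2 : kappa1 B p ε κσ * (B.κJ + ε.J) ^ 2 * ε.c ^ 2 ≤
            kappa1 B p N κσ * (B.κJ + εmax) ^ 2 * (εmax * ε.total) := by
          gcongr
          exact hsq _ hc0 hcM hct
        have e3 : 12 / B.ζ ^ 2 * (ε.g ^ 2 + κy ^ 2 * ε.J ^ 2 + κy ^ 2 * ε.J ^ 2) ≤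
            12 / B.ζ ^ 2 * (εmax * ε.total + κy ^ 2 * (εmax * ε.total) +
              κy ^ 2 * (εmax * ε.total)) := by
          have a1 := hsq _ hg0 hgM hgt
          have a2 := hsq _ hJ0 hJM hJt
          gcongr
        change _ + (_ + 12 / B.ζ ^ 2 * (ε.g ^ 2 + κy ^ 2 * ε.J ^ 2 + κy ^ 2 * ε.J ^ 2)) ≤ _
        refine (add_le_add e1 (add_le_add e2 e3)).trans (le_of_eq ?_)
        rw [he₂]
        ring
  · intro hJ k
    rw [boundC2_eq]
    constructor
    · refine S.avg_le hB hp hrule hε hεmax hεM hτmin hτ hKdir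
        (A := 1 / κσ ^ 2 * ((B.κc + ε.c) / (p.σc * σv))) (by positivity) (fun j => ?_) ?_ k
      · have e1 : κσ * ‖P.c (R.x j)‖ ≤ ‖R.Jc P j‖ :=
          (hJ j).le_norm_adjoint hκσ (S.nontrivialNull j).1 _
        have e2 := S.sq_norm_Jcb_le hB hp hε hεmax hεM hτp j
        have e3 := S.sq_norm_Jc_le hB hε j
        calc ‖P.c (R.x j)‖ ^ 2 = 1 / κσ ^ 2 * (κσ * ‖P.c (R.x j)‖) ^ 2 := by field_simp
          _ ≤ 1 / κσ ^ 2 * ‖R.Jc P j‖ ^ 2 := by gcongr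
          _ ≤ 1 / κσ ^ 2 * ((B.κc + ε.c) / (p.σc * σv) * R.dl P j (R.τ j) + errJc2 B ε) := by
              gcongr
              linarith
          _ = _ := by ring
      · refine (hstep _ (by positivity)).trans (le_of_eq ?_)
        rw [one_div_mul_eq_div, div_div, div_div]
        congr 2
        ring
    · refine hfin k _ ?_ _ (linear_bound (T' := T₃) (Ce := 1 / κσ ^ 2 * CJ) (by positivity)
        (by rw [hT₃]; gcongr) hE hCE0 (by rw [mul_assoc]; gcongr) (by positivity) (hG k) ht0)
      linarith
  · intro hJ k
    rw [boundC_eq]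
    constructor
    · refine S.avg_le hB hp hrule hε hεmax hεM hτmin hτ hKdir
        (A := 1 / (κσ ^ 2 * p.σc * σv)) (by positivity) (fun j => ?_) ?_ k
      · exact S.norm_c_le hB hp hε hεmax hεM hτp hκσ (hJ j)
      · refine (hstep _ (by positivity)).trans (le_of_eq ?_)
        rw [div_div]
        congr 2
        ring
    · refine hfin k _ ?_ _ (linear_bound (T' := T₄) (Ce := 2) (by positivity) le_rfl hE hCE0
        (by gcongr) (by positivity) (hG k) ht0)
      linarith
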